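/- **Conventions.** A *JB\*-morphism* is a complex linear map preserving the triple product. Matrix spaces and subspaces of C\*-algebras carry $\{a,b,c\}=\tfrac12(ab^*c+cb^*a)$. A *TRO* is a closed subspace of a C\*-algebra closed under $[x,y,z]=xy^*z$; a TRO-morphism is a linear map preserving $[\cdot,\cdot,\cdot]$. Let $C^{\rm I}_{m,n}$ be the complex $m\times n$ matrices ($m,n\ge 2$), $C^{\rm II}_n$ the skew-symmetric $n\times n$ matrices ($n\ge4$), $C^{\rm III}_n$ the symmetric $n\times n$ matrices ($n\ge2$). For these factors $Z$ put $\tau(C^{\rm I}_{m,n})=\mathbb M_{m,n}\oplus\mathbb M_{n,m}$ with $\rho_Z(A)=A\oplus A^\top$, and $\tau(C^{\rm II}_n)=\tau(C^{\rm III}_n)=\mathbb M_n$ with $\rho_Z$ the inclusion. For a JB\*-morphism $\varphi:Z\to W$, $\tau(\varphi):\tau(Z)\to\tau(W)$ denotes the TRO-morphism with $\tau(\varphi)\rho_Z=\rho_W\varphi$. TRO-morphisms $\Phi,\Psi$ into $\bigoplus_j\mathbb M_{k_j,l_j}$ are *unitarily equivalent* if $\Phi(x)=V\Psi(x)U$ for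 unitaries $V\in\bigoplus_j\mathbb M_{k_j}$, $U\in\bigoplus_j\mathbb M_{l_j}$; JB\*-morphisms $\varphi,\psi$ are unitarily equivalent if $\tau(\varphi),\tau(\psi)$ are. The *multiplicity matrix* $(\alpha_{ji})$ of $\varphi$ is the matrix of non-negative integers such that the $j$-th component of $\tau(\varphi)$ is unitarily equivalent to $\bigoplus_i \mathrm{id}_i^{\alpha_{ji}}\oplus 0$, where $\mathrm{id}_i$ is the identity representation of the $i$-th block of $\tau(Z)$. Let $\mathrm{diag}_k(A)$ (resp. $\mathrm{adiag}_k(A)$) be the block matrix with $k$ copies of $A$ on the block diagonal (resp. block antidiagonal). A morphism is of *class* $(A)_{k,\ell}$, $k,\ell\ge0$, if it is unitarily equivalent to the morphism sending $A$ to the block matrix with $\mathrm{diag}_k(A)$ in the upper left corner, $\mathrm{diag}_\ell(A^\top)$ in the lower right corner and zeros elsewhere; it is of *class* $(B)_{k,\varepsilon}$, $\varepsilon=\pm1$, if it is unitarily equivalent to the morphism sending $A$ to the block matrix with $\mathrm{adiag}_k(A)$ in the upper right corner, $\mathrm{adiag}_k(\varepsilon A^\top)$ in the lower left corner and zeros elsewhere.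 **Theorem.** (i) Let $Z$ and $W$ be factors of types I–III as above, with $Z\ne C^{\rm II}_4$. Then $(\tau(Z),\rho_Z)$ is the universal TRO of $Z$: every JB\*-morphism from $Z$ into a TRO factors through $\rho_Z$ by a unique TRO-morphism. Every JB\*-morphism $\varphi:Z\to W$ has a unique lift $\tau(\varphi)$ and a unique multiplicity matrix. If $\varphi\neq0$, its class and its multiplicity matrix are as follows, for some integer $\alpha\ge1$ (in the case I$\to$I, for some integers $\alpha,\beta\ge0$ that are not both zero) satisfying the stated bound: - $C^{\rm I}_{m,n}\to C^{\rm I}_{M,N}$: class $(A)_{\alpha,\beta}$, multiplicity $\begin{pmatrix}\alpha&\beta\\ \beta&\alpha\end{pmatrix}$, $\alpha m+\beta n\le M$, $\alpha n+\beta m\le N$; - $C^{\rm I}_{m,n}\to C^{\rm II}_N$: class $(B)_{\alpha,-}$, multiplicity $(\alpha\ \alpha)$, $\alpha(m+n)\le N$; - $C^{\rm I}_{m,n}\to C^{\rm III}_N$: class $(B)_{\alpha,+}$, multiplicity $(\alpha\ \alpha)$, $\alpha(m+n)\le N$; - $C^{\rm II}_n\to C^{\rm I}_{M,N}$ and $C^{\rm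 III}_n\to C^{\rm I}_{M,N}$: class $(A)_{\alpha,0}$, multiplicity $\begin{pmatrix}\alpha\\ \alpha\end{pmatrix}$, $\alpha n\le\min\{M,N\}$; - $C^{\rm II}_n\to C^{\rm II}_N$ and $C^{\rm III}_n\to C^{\rm III}_N$: class $(A)_{\alpha,0}$, multiplicity $(\alpha)$, $\alpha n\le N$; - $C^{\rm II}_n\to C^{\rm III}_N$: class $(B)_{\alpha,+}$, multiplicity $(2\alpha)$, $2\alpha n\le N$; - $C^{\rm III}_n\to C^{\rm II}_N$: class $(B)_{\alpha,-}$, multiplicity $(2\alpha)$, $2\alpha n\le N$. Conversely, every multiplicity matrix in this list whose parameters satisfy the stated conditions occurs for a non-zero JB\*-morphism. (ii)(a) Let $H_1\ne0$ and $H_2$ be complex Hilbert spaces with the triple product $\{x,y,z\}=\tfrac12(\langle x,y\rangle z+\langle z,y\rangle x)$. The non-zero JB\*-morphisms $H_1\to H_2$ are exactly the linear isometric embeddings. If $\dim H_1,\dim H_2<\infty$, they have multiplicity one in the following sense: for every orthonormal basis $b_1,\dots,b_n$ of $H_1$, the vectors $\varphi(b_1),\dots,\varphi(b_n)$ are the first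 $n$ elements of an orthonormal basis of $H_2$. (ii)(b) Let $Z_1,Z_2$ be spin factors of finite dimensions $n\ge3$ and $m\ge2$: $Z_1$ is the linear span, in a non-zero unital C\*-algebra, of self-adjoint elements $s_1,\dots,s_n$ with $s_is_j+s_js_i=2\delta_{ij}1$, and similarly for $Z_2$. Let $\langle\cdot,\cdot\rangle$ be the canonical scalar products, given by $xy^*+y^*x=2\langle x,y\rangle 1$. The non-zero JB\*-morphisms $\varphi:Z_1\to Z_2$ are exactly the maps $\varphi=\mu U$ with $\mu\in\mathbb C$, $|\mu|=1$, and $U:Z_1\to Z_2$ a linear isometric embedding for the canonical Hilbert space structures such that $U(x^*)=U(x)^*$ for all $x\in Z_1$. They have multiplicity one in the following sense: $n\le m$, and there are $\mu$ with $|\mu|=1$ and self-adjoint $t_1,\dots,t_m$ spanning $Z_2$ with $t_it_j+t_jt_i=2\delta_{ij}1$ such that $\varphi(s_i)=\mu t_i$ for $i\le n$. -/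

import Mathlib

open Matrix

universe u v

noncomputable section

namespace JBStar

/-! ### Triple products and JC*-triples of matrices -/

/-- The triple product `{a, b, c} = (a b* c + c b* a) / 2` of rectangular matrices. -/
def triple {m n : ℕ} (a b c : Matrix (Fin m) (Fin n) ℂ) : Matrix (Fin m) (Fin n) ℂ :=
  (1 / 2 : ℂ) • (a * bᴴ * c + c * bᴴ * a)

/-- Skew-symmetric complex `n × n` matrices. -/
def skewMatrices (n : ℕ) : Submodule ℂ (Matrix (Fin n) (Fin n) ℂ) where
  carrier := {A | Aᵀ = -A}
  add_mem' := by
    intro a b (ha : aᵀ = -a) (hb : bᵀ = -b)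
    change (a + b)ᵀ = -(a + b)
    rw [transpose_add, ha, hb, neg_add]
  zero_mem' := by
    change (0 : Matrix (Fin n) (Fin n) ℂ)ᵀ = -0
    simp
  smul_mem' := by
    intro c a (ha : aᵀ = -a)
    change (c • a)ᵀ = -(c • a)
    rw [transpose_smul, ha, smul_neg]

/-- Symmetric complex `n × n` matrices. -/
def symmMatrices (n : ℕ) : Submodule ℂ (Matrix (Fin n) (Fin n) ℂ) where
  carrier := {A | Aᵀ = A}
  add_mem' := by
    intro a b (ha : aᵀ = a) (hb : bᵀ = b)
    change (a + b)ᵀ = a + b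
    rw [transpose_add, ha, hb]
  zero_mem' := transpose_zero
  smul_mem' := by
    intro c a (ha : aᵀ = a)
    change (c • a)ᵀ = c • a
    rw [transpose_smul, ha]

/-- The classical finite dimensional matrix factors: `rect m n` is type I (all `m × n` matrices),
`symp n` is type II (skew-symmetric `n × n` matrices), `herm n` is type III (symmetric `n × n`
matrices). The restrictions on the sizes are imposed separately. -/
inductive Factor where
  | rect (m n : ℕ)
  | symp (n : ℕ)
  | herm (n : ℕ)

namespace Factor

/-- The number of rows of the matrices in the factor. -/
abbrev rows : Factor → ℕ
  | rect m _ => m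
  | symp n => n
  | herm n => n

/-- The number of columns of the matrices in the factor. -/
abbrev cols : Factor → ℕ
  | rect _ n => n
  | symp n => n
  | herm n => n

/-- The underlying complex vector space of matrices. -/
def carrier : (F : Factor) → Submodule ℂ (Matrix (Fin F.rows) (Fin F.cols) ℂ)
  | rect _ _ => ⊤
  | symp n => skewMatrices n
  | herm n => symmMatrices n

/-- The elements of the factor. -/
abbrev Elt (F : Factor) : Type := F.carrier

theorem transpose_triple {n : ℕ} (a b c : Matrix (Fin n) (Fin n) ℂ) :
    (triple a b c)ᵀ = triple aᵀ bᵀ cᵀ := by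
  have h : ∀ x : Matrix (Fin n) (Fin n) ℂ, xᴴᵀ = xᵀᴴ := fun x => by
    ext i j; simp [conjTranspose_apply]
  simp only [triple, transpose_smul, transpose_add, transpose_mul, h, Matrix.mul_assoc]
  rw [add_comm]

theorem triple_mem : ∀ (F : Factor) {a b c : Matrix (Fin F.rows) (Fin F.cols) ℂ},
    a ∈ F.carrier → b ∈ F.carrier → c ∈ F.carrier → triple a b c ∈ F.carrier
  | rect _ _, _, _, _, _, _, _ => Submodule.mem_top
  | symp n, a, b, c, ha, hb, hc => by
    have ha' : aᵀ = -a := ha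
    have hb' : bᵀ = -b := hb
    have hc' : cᵀ = -c := hc
    change (triple a b c)ᵀ = -(triple a b c)
    rw [transpose_triple, ha', hb', hc']
    simp only [triple, conjTranspose_neg, Matrix.neg_mul, Matrix.mul_neg, neg_neg]
    rw [← smul_neg, neg_add]
  | herm n, a, b, c, ha, hb, hc => by
    have ha' : aᵀ = a := ha
    have hb' : bᵀ = b := hb
    have hc' : cᵀ = c := hc
    change (triple a b c)ᵀ = triple a b c
    rw [transpose_triple, ha', hb', hc']

/-- The triple product of the factor. -/
def tri (F : Factor) (a b c : F.Elt) : F.Elt :=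
  ⟨triple a.1 b.1 c.1, F.triple_mem a.2 b.2 c.2⟩

/-- Sizes allowed for the domain of a morphism: type I without the Hilbert spaces, type II without
the factor of `4 × 4` matrices, which is the six-dimensional spin factor, and type III. -/
def IsSource : Factor → Prop
  | rect m n => 2 ≤ m ∧ 2 ≤ n
  | symp n => 5 ≤ n
  | herm n => 2 ≤ n

/-- Sizes allowed for the codomain of a morphism. -/
def IsTarget : Factor → Prop
  | rect m n => 2 ≤ m ∧ 2 ≤ n
  | symp n => 4 ≤ n
  | herm n => 2 ≤ n

end Factor

/-- JB*-morphisms: complex linear maps that preserve the triple product. -/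
def IsJBHom {Z W : Factor} (φ : Z.Elt →ₗ[ℂ] W.Elt) : Prop :=
  ∀ a b c, φ (Z.tri a b c) = W.tri (φ a) (φ b) (φ c)

/-! ### Finite dimensional TROs -/

/-- The TRO `⨁ i, M_{r i, c i}(ℂ)`, with ternary product `x y* z` in each block. -/
abbrev TRO {p : ℕ} (r c : Fin p → ℕ) : Type :=
  ∀ i : Fin p, Matrix (Fin (r i)) (Fin (c i)) ℂ

section TROs

variable {p q : ℕ} {r c : Fin p → ℕ} {k l : Fin q → ℕ}

/-- TRO-morphisms: complex linear maps that preserve `[x, y, z] = x y* z`. -/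
def IsTROHom (Φ : TRO r c →ₗ[ℂ] TRO k l) : Prop :=
  ∀ x y z : TRO r c, Φ (fun i => x i * (y i)ᴴ * z i) =
    fun j => Φ x j * (Φ y j)ᴴ * Φ z j

/-- Unitary equivalence of TRO-morphisms: `Φ x = V (Ψ x) U` with unitaries `V` and `U` in the left
and the right C*-algebra `⨁ j, M_{k j}(ℂ)` and `⨁ j, M_{l j}(ℂ)` of the target. -/
def TROEquivalent (Φ Ψ : TRO r c →ₗ[ℂ] TRO k l) : Prop :=
  ∃ (V : ∀ j, Matrix.unitaryGroup (Fin (k j)) ℂ) (U : ∀ j, Matrix.unitaryGroup (Fin (l j)) ℂ),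
    ∀ x j, Φ x j = (V j : Matrix (Fin (k j)) (Fin (k j)) ℂ) * Ψ x j *
      (U j : Matrix (Fin (l j)) (Fin (l j)) ℂ)

/-- `Φ` has multiplicity matrix `α`: up to unitaries on the left and on the right, its component
in the block `j` of the target is `⨁ i, id_i ^ (α j i)`, completed by zeros, where `id_i` is the
identity representation of the block `i` of the source. (The order in which the rows and columns
are listed is immaterial, as permutation matrices are unitary.) -/
def TROHasMultiplicity (Φ : TRO r c →ₗ[ℂ] TRO k l) (α : Matrix (Fin q) (Fin p) ℕ) : Prop :=
  ∀ j, ∃ (V : Matrix.unitaryGroup (Fin (k j)) ℂ) (U : Matrix.unitaryGroup (Fin (l j)) ℂ)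
    (z z' : ℕ)
    (e : (Σ i : Fin p, Fin (r i) × Fin (α j i)) ⊕ Fin z ≃ Fin (k j))
    (f : (Σ i : Fin p, Fin (c i) × Fin (α j i)) ⊕ Fin z' ≃ Fin (l j)),
    ∀ x : TRO r c, Φ x j =
      (V : Matrix (Fin (k j)) (Fin (k j)) ℂ) *
        Matrix.reindex e f (Matrix.fromBlocks
          (Matrix.blockDiagonal' fun i => Matrix.blockDiagonal fun _ : Fin (α j i) => x i) 0 0 0) *
        (U : Matrix (Fin (l j)) (Fin (l j)) ℂ)

end TROs

/-! ### The universal TRO of a factor, unitary equivalence and multiplicities of morphisms -/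

namespace Factor

/-- The number of blocks of the universal TRO. -/
abbrev tauBlocks : Factor → ℕ
  | rect _ _ => 2
  | symp _ => 1
  | herm _ => 1

/-- The row sizes of the blocks of the universal TRO. -/
abbrev tauRows : (F : Factor) → Fin F.tauBlocks → ℕ
  | rect m n => ![m, n]
  | symp n => fun _ => n
  | herm n => fun _ => n

/-- The column sizes of the blocks of the universal TRO. -/
abbrev tauCols : (F : Factor) → Fin F.tauBlocks → ℕ
  | rect m n => ![n, m]
  | symp n => fun _ => n
  | herm n => fun _ => n

/-- The universal TRO `τ(Z)`: it is `M_{m,n} ⊕ M_{n,m}` for type I (non-Hilbertian) and `M_n` for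
the types II and III. -/
abbrev Tau (F : Factor) : Type := TRO F.tauRows F.tauCols

/-- The canonical embedding `ρ_Z : Z → τ(Z)`: `A ↦ A ⊕ Aᵀ` for type I, the inclusion into `M_n`
for the types II and III. -/
def rho : (F : Factor) → F.Elt → F.Tau
  | rect m n, A => fun i =>
    match i with
    | 0 => (A.1 : Matrix (Fin m) (Fin n) ℂ)
    | 1 => (A.1 : Matrix (Fin m) (Fin n) ℂ)ᵀ
  | symp _, A => fun _ => A.1
  | herm _, A => fun _ => A.1

end Factor

/-- `τ(Z)` with `ρ_Z` is the universal TRO of `Z`: every JB*-morphism of `Z` into a TRO `T` (a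
closed subspace of a C*-algebra, closed under `x y* z`) factors through `ρ_Z` by a unique
TRO-morphism `τ(Z) → T`. -/
def IsUniversalTRO (Z : Factor) : Prop :=
  ∀ (B : Type u) [CStarAlgebra B] (T : Submodule ℂ B), IsClosed (T : Set B) →
    (∀ x ∈ T, ∀ y ∈ T, ∀ z ∈ T, x * star y * z ∈ T) →
    ∀ φ : Z.Elt →ₗ[ℂ] B, (∀ a, φ a ∈ T) →
      (∀ a b c, φ (Z.tri a b c) =
        (1 / 2 : ℂ) • (φ a * star (φ b) * φ c + φ c * star (φ b) * φ a)) →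
      ∃! Φ : Z.Tau →ₗ[ℂ] B, (∀ x, Φ x ∈ T) ∧
        (∀ x y z : Z.Tau, Φ (fun i => x i * (y i)ᴴ * z i) = Φ x * star (Φ y) * Φ z) ∧
        ∀ a, Φ (Z.rho a) = φ a

section Morphisms

variable {Z W : Factor}

/-- `Φ` is the TRO-morphism `τ(φ)`, that is, `Φ ∘ ρ_Z = ρ_W ∘ φ`. -/
def IsLift (φ : Z.Elt →ₗ[ℂ] W.Elt) (Φ : Z.Tau →ₗ[ℂ] W.Tau) : Prop :=
  IsTROHom Φ ∧ ∀ A, Φ (Z.rho A) = W.rho (φ A)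

/-- Unitary equivalence of JB*-morphisms: `τ(φ)` and `τ(ψ)` are unitarily equivalent. -/
def UnitarilyEquivalent (φ ψ : Z.Elt →ₗ[ℂ] W.Elt) : Prop :=
  ∃ Φ Ψ : Z.Tau →ₗ[ℂ] W.Tau, IsLift φ Φ ∧ IsLift ψ Ψ ∧ TROEquivalent Φ Ψ

/-- The multiplicity matrix of a JB*-morphism `φ` is that of `τ(φ)`. -/
def HasMultiplicity (φ : Z.Elt →ₗ[ℂ] W.Elt)
    (α : Matrix (Fin W.tauBlocks) (Fin Z.tauBlocks) ℕ) : Prop :=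
  ∃ Φ : Z.Tau →ₗ[ℂ] W.Tau, IsLift φ Φ ∧ TROHasMultiplicity Φ α

end Morphisms

/-- The multiplicity matrix `α` occurs for a non-zero JB*-morphism from `Z` to `W`. -/
def Occurs (Z W : Factor) (α : Matrix (Fin W.tauBlocks) (Fin Z.tauBlocks) ℕ) : Prop :=
  ∃ φ : Z.Elt →ₗ[ℂ] W.Elt, IsJBHom φ ∧ φ ≠ 0 ∧ HasMultiplicity φ α

/-! ### The standard classes -/

/-- `diag_k(A)`: `k` copies of `A` along the diagonal. An index is a pair (position inside the
block, number of the block). -/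
def diagCopies (k : ℕ) {m n : ℕ} (A : Matrix (Fin m) (Fin n) ℂ) :
    Matrix (Fin m × Fin k) (Fin n × Fin k) ℂ :=
  Matrix.blockDiagonal fun _ : Fin k => A

/-- `adiag_k(A)`: `k` copies of `A` along the block antidiagonal. -/
def adiagCopies (k : ℕ) {m n : ℕ} (A : Matrix (Fin m) (Fin n) ℂ) :
    Matrix (Fin m × Fin k) (Fin n × Fin k) ℂ :=
  (diagCopies k A).submatrix id (Prod.map id Fin.rev)

/-- Lists `k` blocks of size `m`, then a block of size `z`, then `l` blocks of size `n`, in this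
order, as the indices `0, …, M - 1`. -/
def listBlocks (k m z l n : ℕ) {M : ℕ} (h : k * m + z + l * n = M) :
    ((Fin m × Fin k) ⊕ Fin z) ⊕ (Fin n × Fin l) ≃ Fin M :=
  ((Equiv.sumCongr
    ((Equiv.sumCongr ((Equiv.prodComm _ _).trans finProdFinEquiv) (Equiv.refl _)).trans
      finSumFinEquiv)
    ((Equiv.prodComm _ _).trans finProdFinEquiv)).trans finSumFinEquiv).trans (finCongr h)

/-- The `M × N` block matrix with `diag_k(A)` in the upper left corner, `diag_l(Aᵀ)` in the lower
right corner, and zeros elsewhere. -/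
def formA (k l z z' : ℕ) {m n M N : ℕ} (h : k * m + z + l * n = M) (h' : k * n + z' + l * m = N)
    (A : Matrix (Fin m) (Fin n) ℂ) : Matrix (Fin M) (Fin N) ℂ :=
  Matrix.reindex (listBlocks k m z l n h) (listBlocks k n z' l m h')
    (Matrix.fromBlocks (Matrix.fromBlocks (diagCopies k A) 0 0 0) 0 0 (diagCopies l Aᵀ))

/-- The `M × N` block matrix with `adiag_k(A)` in the upper right corner, `adiag_k(ε Aᵀ)` in the
lower left corner, and zeros elsewhere. -/
def formB (k z z' : ℕ) (ε : ℂ) {m n M N : ℕ} (h : k * m + z + k * n = M)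
    (h' : k * m + z' + k * n = N) (A : Matrix (Fin m) (Fin n) ℂ) : Matrix (Fin M) (Fin N) ℂ :=
  Matrix.reindex (listBlocks k m z k n h) (listBlocks k m z' k n h')
    (Matrix.fromBlocks 0 (Matrix.fromRows (adiagCopies k A) 0)
      (Matrix.fromCols (adiagCopies k (ε • Aᵀ)) 0) 0)

section Classes

variable {Z W : Factor}

/-- The class `(A)_{k,l}`: unitarily equivalent to the morphism `A ↦ formA k l A`. -/
def ClassA (k l : ℕ) (φ : Z.Elt →ₗ[ℂ] W.Elt) : Prop :=
  ∃ (ψ : Z.Elt →ₗ[ℂ] W.Elt) (z z' : ℕ) (h : k * Z.rows + z + l * Z.cols = W.rows)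
    (h' : k * Z.cols + z' + l * Z.rows = W.cols),
    IsJBHom ψ ∧ (∀ A, (ψ A).1 = formA k l z z' h h' A.1) ∧ UnitarilyEquivalent φ ψ

/-- The class `(B)_{k,ε}`: unitarily equivalent to the morphism `A ↦ formB k ε A`. -/
def ClassB (k : ℕ) (ε : ℂ) (φ : Z.Elt →ₗ[ℂ] W.Elt) : Prop :=
  ∃ (ψ : Z.Elt →ₗ[ℂ] W.Elt) (z z' : ℕ) (h : k * Z.rows + z + k * Z.cols = W.rows)
    (h' : k * Z.rows + z' + k * Z.cols = W.cols),
    IsJBHom ψ ∧ (∀ A, (ψ A).1 = formB k z z' ε h h' A.1) ∧ UnitarilyEquivalent φ ψ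

end Classes

/-! ### Hilbert spaces -/

/-- The triple product `{x, y, z} = (⟨x, y⟩ z + ⟨z, y⟩ x) / 2` of a Hilbert space, with the scalar
product `⟨x, y⟩` linear in `x` (in Mathlib's notation this is `inner ℂ y x`). -/
def hilbertTriple {H : Type*} [NormedAddCommGroup H] [InnerProductSpace ℂ H] (x y z : H) : H :=
  (1 / 2 : ℂ) • (inner ℂ y x • z + inner ℂ y z • x)

/-! ### Spin factors -/

section Spin

variable {A : Type*} [CStarAlgebra A] {n : ℕ}

/-- Self-adjoint elements `s_1, …, s_n` with `s_i s_j + s_j s_i = 2 δ_{ij} 1`. -/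
structure IsSpinSystem (s : Fin n → A) : Prop where
  selfAdjoint : ∀ i, star (s i) = s i
  anticomm : ∀ i j, s i * s j + s j * s i = if i = j then 2 else 0

/-- The spin factor spanned by the system `s`. -/
def spinFactor (s : Fin n → A) : Submodule ℂ A := Submodule.span ℂ (Set.range s)

/-- The canonical scalar product, determined by `x y* + y* x = 2 ⟨x, y⟩ 1`. -/
def spinInner (x y : A) : ℂ :=
  Classical.epsilon fun c : ℂ => x * star y + star y * x = (2 * c) • (1 : A)

theorem IsSpinSystem.star_mem {s : Fin n → A} (hs : IsSpinSystem s) {x : A}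
    (hx : x ∈ spinFactor s) : star x ∈ spinFactor s := by
  refine Submodule.span_induction (p := fun x _ => star x ∈ spinFactor s) ?_ ?_ ?_ ?_ hx
  · rintro _ ⟨i, rfl⟩
    rw [hs.selfAdjoint]
    exact Submodule.subset_span ⟨i, rfl⟩
  · simp
  · intro x y _ _ hx hy
    rw [star_add]
    exact Submodule.add_mem _ hx hy
  · intro a x _ hx
    rw [star_smul]
    exact Submodule.smul_mem _ _ hx

theorem IsSpinSystem.exists_anticomm {s : Fin n → A} (hs : IsSpinSystem s) {x y : A}
    (hx : x ∈ spinFactor s) (hy : y ∈ spinFactor s) :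
    ∃ c : ℂ, x * y + y * x = (2 * c) • (1 : A) := by
  have h := Submodule.span_induction₂ (R := ℂ) (s := Set.range s) (t := Set.range s)
    (p := fun x y _ _ => ∃ c : ℂ, x * y + y * x = (2 * c) • (1 : A)) ?_ ?_ ?_ ?_ ?_ ?_ ?_ hx hy
  · exact h
  · rintro _ _ ⟨i, rfl⟩ ⟨j, rfl⟩
    refine ⟨if i = j then 1 else 0, ?_⟩
    rw [hs.anticomm]
    split_ifs
    · rw [mul_one, ← Algebra.algebraMap_eq_smul_one, map_ofNat]
    · simp
  · intro y _; exact ⟨0, by simp⟩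
  · intro y _; exact ⟨0, by simp⟩
  · rintro x y z _ _ _ ⟨c, hc⟩ ⟨d, hd⟩
    refine ⟨c + d, ?_⟩
    rw [mul_add 2, add_smul, ← hc, ← hd]; noncomm_ring
  · rintro x y z _ _ _ ⟨c, hc⟩ ⟨d, hd⟩
    refine ⟨c + d, ?_⟩
    rw [mul_add 2, add_smul, ← hc, ← hd]; noncomm_ring
  · rintro r x y _ _ ⟨c, hc⟩
    refine ⟨r * c, ?_⟩
    rw [smul_mul_assoc, mul_smul_comm, ← smul_add, hc, smul_smul]; congr 1; ring
  · rintro r x y _ _ ⟨c, hc⟩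
    refine ⟨r * c, ?_⟩
    rw [smul_mul_assoc, mul_smul_comm, ← smul_add, hc, smul_smul]; congr 1; ring

theorem IsSpinSystem.spinInner_spec {s : Fin n → A} (hs : IsSpinSystem s) {x y : A}
    (hx : x ∈ spinFactor s) (hy : y ∈ spinFactor s) :
    x * star y + star y * x = (2 * spinInner x y) • (1 : A) :=
  Classical.epsilon_spec (p := fun c : ℂ => x * star y + star y * x = (2 * c) • (1 : A))
    (hs.exists_anticomm hx (hs.star_mem hy))

theorem IsSpinSystem.triple_mem {s : Fin n → A} (hs : IsSpinSystem s) {x y z : A}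
    (hx : x ∈ spinFactor s) (hy : y ∈ spinFactor s) (hz : z ∈ spinFactor s) :
    (1 / 2 : ℂ) • (x * star y * z + z * star y * x) ∈ spinFactor s := by
  obtain ⟨a, ha⟩ := hs.exists_anticomm hx (hs.star_mem hy)
  obtain ⟨b, hb⟩ := hs.exists_anticomm hx hz
  obtain ⟨c, hc⟩ := hs.exists_anticomm hz (hs.star_mem hy)
  have key : x * star y * z + z * star y * x
      = (2 * a) • z - (2 * b) • star y + (2 * c) • x := by
    have h1 : (2 * a) • z = (x * star y + star y * x) * z := by rw [ha]; simp
    have h2 : (2 * b) • star y = star y * (x * z + z * x) := by rw [hb]; simp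
    have h3 : (2 * c) • x = (z * star y + star y * z) * x := by rw [hc]; simp
    rw [h1, h2, h3]; noncomm_ring
  rw [key]
  exact Submodule.smul_mem _ _ (Submodule.add_mem _ (Submodule.sub_mem _
    (Submodule.smul_mem _ _ hz) (Submodule.smul_mem _ _ (hs.star_mem hy)))
    (Submodule.smul_mem _ _ hx))

/-- The triple product `(x y* z + z y* x) / 2` on a spin factor. -/
def IsSpinSystem.tri {s : Fin n → A} (hs : IsSpinSystem s) (x y z : spinFactor s) :
    spinFactor s :=
  ⟨(1 / 2 : ℂ) • (x.1 * star y.1 * z.1 + z.1 * star y.1 * x.1), hs.triple_mem x.2 y.2 z.2⟩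

/-- The canonical involution on a spin factor. -/
def IsSpinSystem.inv {s : Fin n → A} (hs : IsSpinSystem s) (x : spinFactor s) : spinFactor s :=
  ⟨star x.1, hs.star_mem x.2⟩

end Spin

end JBStar

end

open JBStar JBStar.Factor

/-!
The theorem is proved by elementary algebra with grids in star rings; no structure theory of
JB*-triples or of C*-algebras is used.

*Universal TROs.* A triple homomorphism `φ` of a factor `Z` into a star ring sends the standard basis
to a grid, that is, to elements with prescribed triple products. A grid splits into ternary matrix
units: a rectangular grid is the sum of a system of matrix units and of an orthogonal transposed
system (`IsRectGrid.exists_units`), a symmetric grid comes from one system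
(`isMatrixUnits_of_symmetric`), and so does a skew-symmetric one with at least five indices
(`IsSkewGrid.exists_units`), where the fifth index makes the left and the right matrix units
independent of the choices. Matrix units are the same as a TRO-morphism from a matrix space, which
gives the extension of `φ` to `τ(Z)`; it is unique because `ρ(Z)` generates `τ(Z)`
(`eq_top_of_rho_mem`).

*Multiplicities.* A TRO-morphism between finite dimensional TROs is a direct sum of identity
representations: an orthonormal basis of the initial space of the image of one matrix unit is
transported by the other ones (`IsMatrixTernaryHom.exists_isometries`). The multiplicities are
pinned down by Hilbert–Schmidt norms (`HasTraceMultiplicity`), which makes them unique, and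
morphisms with equal multiplicities unitarily equivalent.

*The list.* By its uniqueness the lift commutes, up to a sign, with the canonical involutions of
`τ(Z)` and `τ(W)` (`IsLift.flip`), hence the multiplicity matrix is invariant under the exchange of
the blocks (`HasMultiplicity.swap`). Between the types II and III the sign is `-1`, so that the
image of a diagonal matrix unit is a skew-symmetric partial isometry, whose rank, the multiplicity,
is even (`even_of_transpose_eq_neg`). The bounds count dimensions. Each matrix in the list belongs
to one of the standard morphisms, whose multiplicities are read off from traces
(`IsForm.exists_hom`), so each morphism is unitarily equivalent to a standard one.

*Hilbert spaces and spin factors.* The cubes `{x, x, x}` show that a non-zero morphism of Hilbert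
spaces is isometric. For spin factors the relations between the images `a i` of the generators,
together with a third generator, show that `a i` is a common phase times self-adjoint elements that
form a spin system (`exists_spinSystem_of_morphism`); the rest is orthogonal geometry.
-/

set_option linter.unusedSectionVars false

namespace JBStar

/-! ### Matrix units of a TRO -/

section MatrixUnits

variable {B : Type*} [Ring B] [StarRing B] {m n : ℕ}

/-- Ternary matrix units: elements of a star ring that multiply under `x y* z` as the standard
basis of the `m × n` matrices does. -/
def IsMatrixUnits (e : Fin m → Fin n → B) : Prop :=
  ∀ i j k l p q, e i j * star (e k l) * e p q = if j = l ∧ k = p then e i q else 0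

/-- A system of matrix units is spanned by its first column `x` and its first row `y`, linked by
the partial isometry `a` in their common corner. -/
theorem IsMatrixUnits.of_column_row {a : B} {x : Fin m → B} {y : Fin n → B}
    (ha : a * star a * a = a)
    (hx : ∀ i k, star (x i) * x k = if i = k then star a * a else 0)
    (hy : ∀ j l, y j * star (y l) = if j = l then a * star a else 0) :
    IsMatrixUnits fun i j => x i * star a * y j := by
  intro i j k l p q
  have h : x i * star a * y j * star (x k * star a * y l) * (x p * star a * y q)
      = x i * star a * (y j * star (y l)) * a * (star (x k) * x p) * star a * y q := by
    simp only [star_mul, star_star, mul_assoc]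
  have ha' : star a * a * star a = star a := by
    simpa [mul_assoc] using congrArg star ha
  rw [h, hx, hy]
  by_cases h1 : j = l <;> by_cases h2 : k = p <;> simp only [h1, h2, if_true, if_false,
    and_true, and_false, mul_zero, zero_mul]
  have : x i * star a * (a * star a) * a * (star a * a) * star a * y q
      = x i * (star a * a * star a * a * star a * a * star a) * y q := by noncomm_ring
  rw [this]
  simp only [ha']

variable [Algebra ℂ B] [StarModule ℂ B]

/-- The linear map `X ↦ ∑ X i j • e i j`. -/
noncomputable def ofUnits (e : Fin m → Fin n → B) : Matrix (Fin m) (Fin n) ℂ →ₗ[ℂ] B where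
  toFun X := ∑ i, ∑ j, X i j • e i j
  map_add' X Y := by simp only [Matrix.add_apply, add_smul, Finset.sum_add_distrib]
  map_smul' c X := by simp only [Matrix.smul_apply, smul_eq_mul, mul_smul, Finset.smul_sum,
    RingHom.id_apply]

theorem ofUnits_apply (e : Fin m → Fin n → B) (X : Matrix (Fin m) (Fin n) ℂ) :
    ofUnits e X = ∑ i, ∑ j, X i j • e i j := rfl

theorem ofUnits_single (e : Fin m → Fin n → B) (i : Fin m) (j : Fin n) (c : ℂ) :
    ofUnits e (single i j c) = c • e i j := by
  rw [ofUnits_apply, Finset.sum_eq_single i, Finset.sum_eq_single j]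
  · simp
  · intro k _ hk; simp [hk.symm]
  · simp
  · intro k _ hk; simp [hk.symm]
  · simp

/-- Induction on the three arguments reduces the claim to standard basis matrices. -/
theorem IsMatrixUnits.ofUnits_mul {e : Fin m → Fin n → B} (he : IsMatrixUnits e)
    (X Y Z : Matrix (Fin m) (Fin n) ℂ) :
    ofUnits e (X * Yᴴ * Z) = ofUnits e X * star (ofUnits e Y) * ofUnits e Z := by
  induction X using Matrix.induction_on' with
  | h_zero => simp
  | h_add X X' h h' => simp only [Matrix.add_mul, map_add, add_mul, h, h']
  | h_std_basis i j x =>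
  induction Y using Matrix.induction_on' with
  | h_zero => simp
  | h_add Y Y' h h' =>
    simp only [Matrix.add_mul, Matrix.mul_add, conjTranspose_add, map_add, star_add, add_mul,
      mul_add, h, h']
  | h_std_basis k l y =>
  induction Z using Matrix.induction_on' with
  | h_zero => simp
  | h_add Z Z' h h' => simp only [Matrix.mul_add, map_add, mul_add, h, h']
  | h_std_basis p q z =>
  rw [conjTranspose_single]
  simp only [ofUnits_single, star_smul, smul_mul_assoc, mul_smul_comm, he _ _ _ _ _ _]
  by_cases h1 : j = l
  · by_cases h2 : k = p
    · subst h1 h2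
      rw [single_mul_single_same, single_mul_single_same, ofUnits_single]
      simp [smul_smul, mul_comm, mul_left_comm]
    · simp [h2]
  · simp [h1]

theorem ofUnits_mul_star_eq_zero {m' n' : ℕ} {e : Fin m → Fin n → B} {f : Fin m' → Fin n' → B}
    (h : ∀ i j k l, e i j * star (f k l) = 0) (X Y) : ofUnits e X * star (ofUnits f Y) = 0 := by
  simp [ofUnits_apply, star_sum, Finset.sum_mul, Finset.mul_sum, h]

theorem star_ofUnits_mul_eq_zero {m' n' : ℕ} {e : Fin m → Fin n → B} {f : Fin m' → Fin n' → B}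
    (h : ∀ i j k l, star (e i j) * f k l = 0) (X Y) : star (ofUnits e X) * ofUnits f Y = 0 := by
  simp [ofUnits_apply, star_sum, Finset.sum_mul, Finset.mul_sum, h]

end MatrixUnits

/-! ### Rectangular grids -/

section RectGrid

variable {B : Type*} [Ring B] [StarRing B] [Algebra ℂ B] [StarModule ℂ B] {m n : ℕ}

theorem eq_zero_of_add_self {x : B} (h : x + x = 0) : x = 0 := by
  have h2 : (2 : ℂ) • x = 0 := by rw [two_smul, h]
  exact (smul_eq_zero_iff_right two_ne_zero).1 h2

/-- Triple orthogonality of a tripotent `x` and an element `y` means that the left and the right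
supports are orthogonal. -/
theorem orthogonal_of_triple {x y : B} (h : x * star x * x = x)
    (h₁ : x * star x * y + y * star x * x = 0) (h₂ : x * star y * x = 0) :
    star x * y = 0 ∧ y * star x = 0 := by
  have h' : star x * x * star x = star x := by simpa [mul_assoc] using congrArg star h
  have h₂' : star x * y * star x = 0 := by simpa [mul_assoc] using congrArg star h₂
  constructor
  · linear_combination (norm := noncomm_ring) -(h' * y) + star x * h₁ - h₂' * x
  · linear_combination (norm := noncomm_ring) -(y * h') + h₁ * star x - x * h₂'

/-- Elements of a star ring whose triple products are those of the standard basis of the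
`m × n` matrices. -/
def IsRectGrid (u : Fin m → Fin n → B) : Prop :=
  ∀ i j k l p q, u i j * star (u k l) * u p q + u p q * star (u k l) * u i j =
    (if j = l ∧ k = p then u i q else 0) + (if q = l ∧ k = i then u p j else 0)

namespace IsRectGrid

variable {u : Fin m → Fin n → B}

theorem transpose (hu : IsRectGrid u) : IsRectGrid fun j i => u i j := by
  intro i j k l p q
  have h := hu j i l k q p
  simp only [h, @eq_comm _ k, @eq_comm _ l]
  rw [add_comm]
  simp only [and_comm]

theorem tripotent (hu : IsRectGrid u) (i j) : u i j * star (u i j) * u i j = u i j := by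
  have h := hu i j i j i j
  simp only [and_self, if_true] at h
  rw [← sub_eq_zero]
  apply eq_zero_of_add_self
  linear_combination (norm := noncomm_ring) h

theorem quadratic_eq_zero (hu : IsRectGrid u) {i j k l} (h : (i, j) ≠ (k, l)) :
    u i j * star (u k l) * u i j = 0 := by
  apply eq_zero_of_add_self
  rw [hu i j k l i j]
  have : ¬ (j = l ∧ k = i) := fun h' => h (by rw [h'.1, h'.2])
  simp [this]

theorem orthogonal (hu : IsRectGrid u) {i j k l} (hi : i ≠ k) (hj : j ≠ l) :
    star (u i j) * u k l = 0 ∧ u k l * star (u i j) = 0 := by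
  refine orthogonal_of_triple (hu.tripotent i j) ?_ (hu.quadratic_eq_zero fun h => hi (by simp_all))
  rw [hu i j i j k l]
  simp [hi, hj.symm]

theorem row (hu : IsRectGrid u) (i) {j l} (h : j ≠ l) :
    u i j * star (u i j) * u i l + u i l * star (u i j) * u i j = u i l := by
  rw [hu]; simp [h.symm]

theorem row_ne (hu : IsRectGrid u) (i) {j k l} (hj : j ≠ l) (hk : k ≠ l) :
    u i j * star (u i l) * u i k + u i k * star (u i l) * u i j = 0 := by
  rw [hu]; simp [hj, hk]

variable {i₀ i₁ : Fin m} {j₀ j₁ : Fin n}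

/-- The component in the first block of the corner of the grid. -/
theorem corner_eq (hu : IsRectGrid u) {i j} (hi : i ≠ i₀) (hj : j ≠ j₀) :
    u i₀ j * star (u i₀ j) * u i₀ j₀ = u i₀ j₀ * star (u i j₀) * u i j₀ := by
  have hc := hu.transpose.row j₀ hi
  have hr := hu.row i₀ hj
  have h1 := (hu.orthogonal hi.symm hj).1
  have h2 := (hu.orthogonal hi hj.symm).2
  linear_combination (norm := noncomm_ring) -(u i₀ j * star (u i₀ j) * hc)
    + hr * star (u i j₀) * u i j₀ + u i₀ j * h1 * star (u i j₀) * u i₀ j₀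
    - u i₀ j₀ * star (u i₀ j) * h2 * u i j₀

/-- The corner of the first component of the grid with base point `(i₀, j₀)`; it does not depend
on the auxiliary index `j₁ ≠ j₀`. -/
def corner (u : Fin m → Fin n → B) (i₀ : Fin m) (j₀ j₁ : Fin n) : B :=
  u i₀ j₁ * star (u i₀ j₁) * u i₀ j₀

theorem corner_eq_column (hu : IsRectGrid u) {i} (hi : i ≠ i₀) (hj : j₁ ≠ j₀) :
    corner u i₀ j₀ j₁ = u i₀ j₀ * star (u i j₀) * u i j₀ := hu.corner_eq hi hj

theorem corner_eq_row (hu : IsRectGrid u) (hi : i₁ ≠ i₀) (hj : j₁ ≠ j₀) {j} (h : j ≠ j₀) :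
    corner u i₀ j₀ j₁ = u i₀ j * star (u i₀ j) * u i₀ j₀ := by
  rw [hu.corner_eq hi h, ← hu.corner_eq hi hj, corner]

theorem corner_mul_star_mul (hu : IsRectGrid u) :
    corner u i₀ j₀ j₁ * star (u i₀ j₀) * u i₀ j₀ = corner u i₀ j₀ j₁ := by
  linear_combination (norm := (simp only [corner]; noncomm_ring))
    u i₀ j₁ * star (u i₀ j₁) * hu.tripotent i₀ j₀

theorem mul_star_mul_corner (hu : IsRectGrid u) (hi : i₁ ≠ i₀) (hj : j₁ ≠ j₀) :
    u i₀ j₀ * star (u i₀ j₀) * corner u i₀ j₀ j₁ = corner u i₀ j₀ j₁ := by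
  rw [hu.corner_eq_column hi hj]
  linear_combination (norm := noncomm_ring) hu.tripotent i₀ j₀ * star (u i₁ j₀) * u i₁ j₀

theorem star_corner_mul (hu : IsRectGrid u) (hj : j₁ ≠ j₀) {i} (hi : i ≠ i₀) :
    star (corner u i₀ j₀ j₁) * u i j₀ = 0 := by
  simp only [corner, star_mul, star_star, mul_assoc, (hu.orthogonal hi.symm hj).1, mul_zero]

theorem corner_mul_star (hu : IsRectGrid u) (hi : i₁ ≠ i₀) (hj : j₁ ≠ j₀) {j} (h : j ≠ j₀) :
    corner u i₀ j₀ j₁ * star (u i₀ j) = 0 := by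
  simp only [hu.corner_eq_column hi hj, mul_assoc, (hu.orthogonal hi.symm h).2, mul_zero]

/-- The base point of the grid splits into the corners of the two orthogonal systems. -/
theorem corner_add_corner (hu : IsRectGrid u) (hi : i₁ ≠ i₀) (hj : j₁ ≠ j₀) :
    corner u i₀ j₀ j₁ + corner (fun j i => u i j) j₀ i₀ i₁ = u i₀ j₀ := by
  rw [hu.transpose.corner_eq_column hj hi, corner, hu.row i₀ hj]

theorem corner_mul_star_corner (hu : IsRectGrid u) (hi : i₁ ≠ i₀) (hj : j₁ ≠ j₀) :
    corner u i₀ j₀ j₁ * star (corner (fun j i => u i j) j₀ i₀ i₁) = 0 := by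
  rw [hu.transpose.corner_eq_column hj hi, corner]
  have h : star (u i₀ j₁) * u i₀ j₀ * star (u i₀ j₁) = 0 := by
    simpa [mul_assoc] using congrArg star (hu.quadratic_eq_zero (i := i₀) (j := j₁) (k := i₀)
      (l := j₀) (fun h => hj (by simp_all)))
  simp only [star_mul, star_star]
  linear_combination (norm := noncomm_ring) u i₀ j₁ * h * u i₀ j₁ * star (u i₀ j₀)

theorem star_corner_mul_corner (hu : IsRectGrid u) (hi : i₁ ≠ i₀) (hj : j₁ ≠ j₀) :
    star (corner u i₀ j₀ j₁) * corner (fun j i => u i j) j₀ i₀ i₁ = 0 := by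
  rw [hu.corner_eq_column hi hj, corner]
  have h := hu.quadratic_eq_zero (i := i₁) (j := j₀) (k := i₀) (l := j₀) (fun h => hi (by simp_all))
  simp only [star_mul, star_star]
  linear_combination (norm := noncomm_ring) star (u i₁ j₀) * h * star (u i₁ j₀) * u i₀ j₀

theorem corner_mul_star_eq (hu : IsRectGrid u) (hi : i₁ ≠ i₀) (hj : j₁ ≠ j₀) :
    corner u i₀ j₀ j₁ * star (u i₀ j₀) = corner u i₀ j₀ j₁ * star (corner u i₀ j₀ j₁) := by
  rw [← hu.corner_add_corner hi hj, star_add, mul_add, hu.corner_mul_star_corner hi hj, add_zero]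

theorem star_corner_mul_eq (hu : IsRectGrid u) (hi : i₁ ≠ i₀) (hj : j₁ ≠ j₀) :
    star (corner u i₀ j₀ j₁) * u i₀ j₀ = star (corner u i₀ j₀ j₁) * corner u i₀ j₀ j₁ := by
  rw [← hu.corner_add_corner hi hj, mul_add, hu.star_corner_mul_corner hi hj, add_zero]

theorem corner_tripotent (hu : IsRectGrid u) (hi : i₁ ≠ i₀) (hj : j₁ ≠ j₀) :
    corner u i₀ j₀ j₁ * star (corner u i₀ j₀ j₁) * corner u i₀ j₀ j₁ = corner u i₀ j₀ j₁ := by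
  rw [mul_assoc, ← hu.star_corner_mul_eq hi hj, ← mul_assoc, ← hu.corner_mul_star_eq hi hj,
    hu.corner_mul_star_mul]

/-- The Gram matrix of the column of the base point, compressed by the corner: the relation that
makes the column of the first component a column of matrix units. -/
theorem column_gram (hu : IsRectGrid u) (hi : i₁ ≠ i₀) (hj : j₁ ≠ j₀) (i k) :
    corner u i₀ j₀ j₁ * star (u i j₀) * u k j₀ * star (corner u i₀ j₀ j₁) =
      if i = k then corner u i₀ j₀ j₁ * star (corner u i₀ j₀ j₁) else 0 := by
  by_cases hk : k = i₀
  · subst hk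
    by_cases hik : i = k
    · subst hik; rw [hu.corner_mul_star_mul, if_pos rfl]
    · have h := congrArg star (hu.star_corner_mul hj hik)
      have h' := congrArg star (hu.corner_mul_star_eq hi hj)
      simp only [star_mul, star_star, star_zero] at h h'
      rw [if_neg hik, mul_assoc, h', ← mul_assoc, mul_assoc (corner _ _ _ _), h, mul_zero, zero_mul]
  · have h := hu.star_corner_mul hj hk
    by_cases hik : i = k
    · subst hik
      rw [if_pos rfl, hu.corner_eq_column hk hj]
      linear_combination (norm := noncomm_ring)
        u i₀ j₀ * star (u i j₀) * hu.tripotent i j₀ * star (u i₀ j₀ * star (u i j₀) * u i j₀)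
    · rw [if_neg hik]
      by_cases hi' : i = i₀
      · subst hi'
        rw [hu.corner_mul_star_eq hi hj, mul_assoc (corner _ _ _ _), h, mul_zero, zero_mul]
      · have h1 := hu.transpose.row_ne j₀ (Ne.symm hi') (Ne.symm hik)
        have h2 := (hu.orthogonal (Ne.symm hk) hj).1
        simp only [corner]
        linear_combination (norm := noncomm_ring)
          u i₀ j₁ * star (u i₀ j₁) * h1 * star (u i₀ j₁ * star (u i₀ j₁) * u i₀ j₀)
          - u i₀ j₁ * h2 * star (u i j₀) * u i₀ j₀ * star (u i₀ j₁ * star (u i₀ j₁) * u i₀ j₀)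

/-- The counterpart of `column_gram` for the row of the base point. -/
theorem row_gram (hu : IsRectGrid u) (hi : i₁ ≠ i₀) (hj : j₁ ≠ j₀) (j l) :
    star (corner u i₀ j₀ j₁) * u i₀ j * star (u i₀ l) * corner u i₀ j₀ j₁ =
      if j = l then star (corner u i₀ j₀ j₁) * corner u i₀ j₀ j₁ else 0 := by
  by_cases hl : l = j₀
  · subst hl
    by_cases hjl : j = l
    · subst hjl
      rw [if_pos rfl, mul_assoc, mul_assoc, ← mul_assoc (u i₀ j), hu.mul_star_mul_corner hi hj]
    · have h := congrArg star (hu.corner_mul_star hi hj hjl)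
      have h' := congrArg star (hu.star_corner_mul_eq hi hj)
      simp only [star_mul, star_star, star_zero] at h h'
      rw [if_neg hjl, mul_assoc, h', ← mul_assoc, mul_assoc (star _), h, mul_zero, zero_mul]
  · by_cases hjl : j = l
    · subst hjl
      rw [if_pos rfl, hu.corner_eq_row hi hj hl]
      linear_combination (norm := noncomm_ring)
        star (u i₀ j * star (u i₀ j) * u i₀ j₀) * hu.tripotent i₀ j * star (u i₀ j) * u i₀ j₀
    · rw [if_neg hjl]
      by_cases hj' : j = j₀
      · subst hj'
        have h := hu.corner_mul_star hi hj hl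
        rw [hu.star_corner_mul_eq hi hj, mul_assoc (star _), h, mul_zero, zero_mul]
      · have h1 := hu.row_ne i₀ hjl (Ne.symm hl)
        have h2 := (hu.orthogonal hi.symm hj').2
        have h2 := congrArg star h2
        have h3 := (hu.orthogonal hi (Ne.symm hj')).2
        rw [hu.corner_eq_column hi hj]
        linear_combination (norm := noncomm_ring)
          star (u i₀ j₀ * star (u i₁ j₀) * u i₁ j₀) * h1 * star (u i₁ j₀) * u i₁ j₀
          - star (u i₀ j₀ * star (u i₁ j₀) * u i₁ j₀) * u i₀ j₀ * star (u i₀ l) * h3 * u i₁ j₀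

/-- The first component of a rectangular grid, generated by the corner, the column and the row of
the base point. -/
theorem isMatrixUnits (hu : IsRectGrid u) (hi : i₁ ≠ i₀) (hj : j₁ ≠ j₀) :
    IsMatrixUnits fun i j => u i j₀ * star (corner u i₀ j₀ j₁) * u i₀ j := by
  have ha := hu.corner_tripotent hi hj
  have hc := hu.column_gram hi hj
  have hr := hu.row_gram hi hj
  set a := corner u i₀ j₀ j₁
  have ha' : star a * a * star a = star a := by simpa [mul_assoc] using congrArg star ha
  have key := IsMatrixUnits.of_column_row (a := a) (x := fun i => u i j₀ * star a * a)
    (y := fun j => a * star a * u i₀ j) ha ?_ ?_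
  · convert key using 3 with i j
    linear_combination (norm := noncomm_ring) -(u i j₀ * ha' * a * star a * u i₀ j)
      - u i j₀ * ha' * u i₀ j
  · intro i k
    have : star (u i j₀ * star a * a) * (u k j₀ * star a * a)
      = star a * (a * star (u i j₀) * u k j₀ * star a) * a := by
      simp only [star_mul, star_star, mul_assoc]
    rw [this, hc]
    split_ifs
    · linear_combination (norm := noncomm_ring) ha' * a
    · simp
  · intro j l
    have : a * star a * u i₀ j * star (a * star a * u i₀ l)
      = a * (star a * u i₀ j * star (u i₀ l) * a) * star a := by
      simp only [star_mul, star_star, mul_assoc]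
    rw [this, hr]
    split_ifs
    · linear_combination (norm := noncomm_ring) ha * star a
    · simp

end IsRectGrid

/-- A rectangular grid is the sum of a system of matrix units and of an orthogonal transposed
system. -/
theorem IsRectGrid.exists_units {u : Fin m → Fin n → B} (hu : IsRectGrid u) (hm : 2 ≤ m)
    (hn : 2 ≤ n) : ∃ (e : Fin m → Fin n → B) (f : Fin n → Fin m → B), IsMatrixUnits e ∧
      IsMatrixUnits f ∧ (∀ i j k l, star (e i j) * f k l = 0) ∧
      (∀ i j k l, e i j * star (f k l) = 0) ∧ ∀ i j, u i j = e i j + f j i := by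
  obtain ⟨i₀, i₁, hi⟩ : ∃ i₀ i₁ : Fin m, i₁ ≠ i₀ :=
    ⟨⟨0, by omega⟩, ⟨1, by omega⟩, by simp⟩
  obtain ⟨j₀, j₁, hj⟩ : ∃ j₀ j₁ : Fin n, j₁ ≠ j₀ :=
    ⟨⟨0, by omega⟩, ⟨1, by omega⟩, by simp⟩
  have hut := hu.transpose
  have hab := hu.corner_add_corner hi hj
  have h1 := hu.corner_mul_star_corner hi hj
  have h2 := hu.star_corner_mul_corner hi hj
  have ea := fun i => hu.star_corner_mul hj (i := i) (i₀ := i₀)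
  have ea' := fun j => hu.corner_mul_star hi hj (j := j)
  have eb := fun j => hut.star_corner_mul hi (i := j) (i₀ := j₀)
  have eb' := fun i => hut.corner_mul_star hj hi (j := i)
  have ha := hu.corner_tripotent hi hj
  have hb := hut.corner_tripotent hj hi
  have E := hu.isMatrixUnits hi hj
  have F := hut.isMatrixUnits hj hi
  set a := IsRectGrid.corner u i₀ j₀ j₁ with ha_def
  set b := IsRectGrid.corner (fun j i => u i j) j₀ i₀ i₁ with hb_def
  have h1' : b * star a = 0 := by simpa using congrArg star h1
  have h2' : star b * a = 0 := by simpa using congrArg star h2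
  -- the corners of the two systems are separated by the first column and by the first row
  have ab : ∀ i, a * star (u i j₀) * b = 0 := by
    intro i
    by_cases h : i = i₀
    · subst h
      rw [← hab, star_add, mul_add, h1, add_zero, mul_assoc, h2, mul_zero]
    · have := hu.quadratic_eq_zero (i := i₀) (j := j₀) (k := i) (l := j₀)
        (fun h' => h (by simp_all))
      rw [ha_def, hb_def, hut.corner_eq_column hj hi, IsRectGrid.corner]
      linear_combination (norm := noncomm_ring)
        u i₀ j₁ * star (u i₀ j₁) * this * star (u i₀ j₁) * u i₀ j₁
  have ab' : ∀ j, star a * u i₀ j * star b = 0 := by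
    intro j
    by_cases h : j = j₀
    · subst h
      rw [← hab, mul_add, h2, add_zero, mul_assoc, h1, mul_zero]
    · have := hu.quadratic_eq_zero (i := i₀) (j := j₀) (k := i₀) (l := j)
        (fun h' => h (by simp_all))
      have := congrArg star this
      simp only [star_mul, star_star, star_zero] at this
      rw [ha_def, hb_def, hu.corner_eq_column hi hj, IsRectGrid.corner]
      simp only [star_mul, star_star]
      linear_combination (norm := noncomm_ring)
        star (u i₁ j₀) * u i₁ j₀ * this * u i₁ j₀ * star (u i₁ j₀)
  refine ⟨_, _, E, F, ?_, ?_, ?_⟩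
  · intro i j l k
    have : a * star (u i j₀) * u i₀ l * star b = 0 := by
      by_cases hi' : i = i₀
      · subst hi'
        rw [← hab, star_add, mul_add, h1, add_zero, mul_assoc, mul_assoc, ← mul_assoc (star a), ab',
          mul_zero]
      · by_cases hl : l = j₀
        · subst hl
          rw [← hab, mul_assoc, add_mul, h1, zero_add, ← mul_assoc, ab, zero_mul]
        · rw [mul_assoc a, (hu.orthogonal hi' (Ne.symm hl)).1, mul_zero, zero_mul]
    simp only [star_mul, star_star]
    linear_combination (norm := noncomm_ring) star (u i₀ j) * this * u k j₀
  · intro i j l k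
    have : star a * u i₀ j * star (u k j₀) * b = 0 := by
      by_cases hj' : j = j₀
      · subst hj'
        rw [← hab, mul_add, h2, add_zero, mul_assoc, mul_assoc, ← mul_assoc a, ab, mul_zero]
      · by_cases hk : k = i₀
        · subst hk
          rw [← hab, star_add, mul_assoc, add_mul, h2, zero_add, ← mul_assoc, ab', zero_mul]
        · rw [mul_assoc (star a), (hu.orthogonal hk (Ne.symm hj')).2, mul_zero, zero_mul]
    simp only [star_mul, star_star]
    linear_combination (norm := noncomm_ring) u i j₀ * this * star (u i₀ l)
  · intro i j
    by_cases hi' : i = i₀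
    · by_cases hj' : j = j₀
      · subst hi' hj'
        rw [← hab]
        linear_combination (norm := noncomm_ring) -ha - hb - a * h2 - h1' * a - h1' * b -
          h1 * a - h1 * b - b * h2'
      · subst hi'
        have h := hu.row i (Ne.symm hj')
        have h3 := congrArg star (ea' j hj')
        simp only [star_mul, star_star, star_zero] at h3
        rw [← hab, star_add] at h
        rw [← hab]
        linear_combination (norm := noncomm_ring) -h + h1 * u i j + b * eb j hj' + h3 * (a + b)
    · by_cases hj' : j = j₀
      · subst hj'
        have h := hut.row j (Ne.symm hi')
        have h3 := congrArg star (eb' i hi')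
        simp only [star_mul, star_star, star_zero] at h3
        rw [← hab, star_add] at h
        rw [← hab]
        linear_combination (norm := noncomm_ring) -h + (a + b) * ea i hi' + h3 * (a + b)
      · have h := hu i j₀ i₀ j₀ i₀ j
        have h3 := congrArg star (eb' i hi')
        have h4 := congrArg star (ea' j hj')
        simp only [star_mul, star_star, star_zero] at h3 h4
        simp only [and_self, if_true, hj', false_and, if_false, add_zero] at h
        rw [← hab, star_add] at h
        linear_combination (norm := noncomm_ring) -h + h3 * u i₀ j + h4 * u i j₀

end RectGrid

/-! ### Symmetric and skew-symmetric grids -/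

section SymmetricGrid

variable {B : Type*} [Ring B] [StarRing B] [Algebra ℂ B] [StarModule ℂ B] {n : ℕ}

/-- Matrix units from the first row of a symmetric grid: in the model `s i₀ = E i₀ i₀` and
`s i = E i i₀ + E i₀ i`, so that `s i * star (s i₀) * s i = E i i`. -/
theorem isMatrixUnits_of_symmetric {s : Fin n → B} {i₀ : Fin n}
    (h : ∀ i, s i * star (s i) * s i = s i)
    (h₀ : ∀ i, s i * star (s i * star (s i₀) * s i) * s i = s i₀)
    (ho : ∀ i k, i ≠ k → star (s i * star (s i₀) * s i) * (s k * star (s i₀) * s k) = 0 ∧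
      s i * star (s i₀) * s i * star (s k * star (s i₀) * s k) = 0) :
    IsMatrixUnits fun i j => s i * star (s i₀) * s j := by
  have ha := h i₀
  have hl : ∀ i, s i * star (s i) * s i₀ = s i₀ := fun i => by
    have h1 := h₀ i
    generalize star (s i * star (s i₀) * s i) = t at h1
    linear_combination (norm := noncomm_ring) -(s i * star (s i) * h1) + h1 + h i * t * s i
  have hr : ∀ i, s i₀ * star (s i) * s i = s i₀ := fun i => by
    have h1 := h₀ i
    generalize star (s i * star (s i₀) * s i) = t at h1
    linear_combination (norm := noncomm_ring) -(h1 * star (s i) * s i) + h1 + s i * t * h i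
  set a := s i₀
  have ha' : star a * a * star a = star a := by simpa [mul_assoc] using congrArg star ha
  have key := IsMatrixUnits.of_column_row (a := a) (x := fun i => s i * star a * a)
    (y := fun j => a * star a * s j) ha ?_ ?_
  · convert key using 3 with i j
    linear_combination (norm := noncomm_ring) -(s i * ha' * a * star a * s j) - s i * ha' * s j
  · intro i k
    by_cases hik : i = k
    · subst hik
      simp only [star_mul, star_star, if_true]
      linear_combination (norm := noncomm_ring) star a * hr i * star a * a + ha' * a
    · have e : ∀ i, s i * star a * a = s i * star a * s i * star (s i) * a := fun i => by
        linear_combination (norm := noncomm_ring) -(s i * star a * hl i)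
      have := (ho i k hik).1
      rw [if_neg hik, e, e]
      simp only [star_mul, star_star] at this ⊢
      linear_combination (norm := noncomm_ring) star a * s i * this * star (s k) * a
  · intro j l
    by_cases hjl : j = l
    · subst hjl
      simp only [star_mul, star_star, if_true]
      linear_combination (norm := noncomm_ring) a * star a * hl j * star a + ha * star a
    · have e : ∀ i, a * star a * s i = a * star (s i) * (s i * star a * s i) := fun i => by
        linear_combination (norm := noncomm_ring) -(hr i * star a * s i)
      have := (ho j l hjl).2
      rw [if_neg hjl, e, e]
      simp only [star_mul, star_star] at this ⊢
      linear_combination (norm := noncomm_ring) a * star (s j) * this * s l * star a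

end SymmetricGrid

section SkewGrid

variable {B : Type*} [Ring B] [StarRing B] {n : ℕ}

/-- Elements of a star ring among which some of the triple products are those of the skew-symmetric
matrices `E i j - E j i`. -/
structure IsSkewGrid (F : Fin n → Fin n → B) : Prop where
  swap : ∀ i j, F j i = -F i j
  row : ∀ i j k, i ≠ j → k ≠ j → i ≠ k →
    F i j * star (F k j) * F k j + F k j * star (F k j) * F i j = F i j
  path : ∀ i j k l, [i, j, k, l].Nodup →
    F i j * star (F k j) * F k l + F k l * star (F k j) * F i j = F i l
  orth : ∀ i j k l, [i, j, k, l].Nodup → F i j * star (F k l) = 0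
  orth' : ∀ i j k l, [i, j, k, l].Nodup → star (F i j) * F k l = 0

/-- Five indices leave one that avoids four given ones. -/
theorem exists_fresh (hn : 5 ≤ n) (i j k l : Fin n) : ∃ r, r ≠ i ∧ r ≠ j ∧ r ≠ k ∧ r ≠ l := by
  obtain ⟨r, -, hr⟩ := Finset.exists_mem_notMem_of_card_lt_card
    (s := ({i, j, k, l} : Finset (Fin n))) (t := Finset.univ)
    ((Finset.card_le_four).trans_lt (by simpa using Nat.lt_of_succ_le hn))
  exact ⟨r, by simpa [not_or] using hr⟩

namespace IsSkewGrid

open scoped Classical in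
/-- The left matrix units `F k i * star (F l i)` of a skew-symmetric grid, in the model `E k l`. -/
noncomputable def left (F : Fin n → Fin n → B) (k l : Fin n) : B :=
  if h : ∃ i, i ≠ k ∧ i ≠ l then F k h.choose * star (F l h.choose) else 0

open scoped Classical in
/-- The right matrix units `star (F i k) * F i l` of a skew-symmetric grid, in the model `E k l`. -/
noncomputable def right (F : Fin n → Fin n → B) (k l : Fin n) : B :=
  if h : ∃ i, i ≠ k ∧ i ≠ l then star (F h.choose k) * F h.choose l else 0

variable {F : Fin n → Fin n → B}

/-- Passing to the opposite ring exchanges the left and the right matrix units, so that statements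
on the right ones follow from those on the left ones. -/
theorem op (hF : IsSkewGrid F) : IsSkewGrid fun i j => MulOpposite.op (F i j) where
  swap i j := by rw [hF.swap, MulOpposite.op_neg]
  row i j k h1 h2 h3 := by
    simp only [← MulOpposite.op_star, ← MulOpposite.op_mul, ← MulOpposite.op_add]
    rw [add_comm, ← mul_assoc, ← mul_assoc, hF.row i j k h1 h2 h3]
  path i j k l h := by
    simp only [← MulOpposite.op_star, ← MulOpposite.op_mul, ← MulOpposite.op_add]
    rw [add_comm, ← mul_assoc, ← mul_assoc, hF.path i j k l h]
  orth i j k l h := by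
    rw [← MulOpposite.op_star, ← MulOpposite.op_mul, hF.orth', MulOpposite.op_zero]
    simp_all [eq_comm]
  orth' i j k l h := by
    rw [← MulOpposite.op_star, ← MulOpposite.op_mul, hF.orth, MulOpposite.op_zero]
    simp_all [eq_comm]

/-- A fifth index `r` shows that `F k i * star (F l i)` does not depend on `i`; this fails for the
`4 × 4` matrices. -/
theorem left_eq (hF : IsSkewGrid F) (hn : 5 ≤ n) {i k l : Fin n} (hk : i ≠ k) (hl : i ≠ l)
    (hkl : k ≠ l) : left F k l = F k i * star (F l i) := by
  have hex : ∃ i, i ≠ k ∧ i ≠ l := ⟨i, hk, hl⟩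
  rw [left, dif_pos hex]
  have hj := hex.choose_spec
  generalize hex.choose = j at hj
  by_cases hij : i = j
  · rw [hij]
  obtain ⟨r, hri, hrj, hrk, hrl⟩ := exists_fresh hn i j k l
  have h1 := hF.path l j r i (by simp_all [eq_comm])
  have h2 := hF.path k i r j (by simp_all [eq_comm])
  have h3 := hF.orth k i l j (by simp_all [eq_comm])
  have h1 := congrArg star h1
  simp only [star_add, star_mul, star_star] at h1
  linear_combination (norm := noncomm_ring) F k i * h1 - h2 * star (F l j)
    - h3 * F r j * star (F r i) + F r j * star (F r i) * h3

theorem right_eq_unop (hF : IsSkewGrid F) (hn : 5 ≤ n) {k l : Fin n} (hkl : k ≠ l) :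
    right F k l = MulOpposite.unop (left (fun i j => MulOpposite.op (F i j)) l k) := by
  obtain ⟨r, hrk, hrl, -⟩ := exists_fresh hn k l l l
  have hex : ∃ i, i ≠ k ∧ i ≠ l := ⟨r, hrk, hrl⟩
  have hj := hex.choose_spec
  rw [right, dif_pos hex]
  generalize hex.choose = j at hj
  rw [hF.op.left_eq hn hj.2 hj.1 hkl.symm, ← MulOpposite.op_star, ← MulOpposite.op_mul,
    MulOpposite.unop_op, hF.swap k j, hF.swap l j, star_neg, neg_mul_neg]

theorem right_eq (hF : IsSkewGrid F) (hn : 5 ≤ n) {i k l : Fin n} (hk : i ≠ k) (hl : i ≠ l)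
    (hkl : k ≠ l) : right F k l = star (F i k) * F i l := by
  rw [hF.right_eq_unop hn hkl, hF.op.left_eq hn hl hk hkl.symm, ← MulOpposite.op_star,
    ← MulOpposite.op_mul, MulOpposite.unop_op, hF.swap k i, hF.swap l i, star_neg, neg_mul_neg]

theorem star_left (hF : IsSkewGrid F) (hn : 5 ≤ n) {k l : Fin n} (hkl : k ≠ l) :
    star (left F k l) = left F l k := by
  obtain ⟨r, hrk, hrl, -⟩ := exists_fresh hn k l l l
  rw [hF.left_eq hn hrk hrl hkl, hF.left_eq hn hrl hrk hkl.symm, star_mul, star_star]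

theorem star_right (hF : IsSkewGrid F) (hn : 5 ≤ n) {k l : Fin n} (hkl : k ≠ l) :
    star (right F k l) = right F l k := by
  obtain ⟨r, hrk, hrl, -⟩ := exists_fresh hn k l l l
  rw [hF.right_eq hn hrk hrl hkl, hF.right_eq hn hrl hrk hkl.symm, star_mul, star_star]

theorem left_mul_left_of_ne (hF : IsSkewGrid F) (hn : 5 ≤ n) {i j k l : Fin n} (hij : i ≠ j)
    (hkl : k ≠ l) (hjk : j ≠ k) : left F i j * left F k l = 0 := by
  obtain ⟨r, hri, hrj, hrk, -⟩ := exists_fresh hn i j k k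
  obtain ⟨s, hsk, hsl, hsj, hsr⟩ := exists_fresh hn k l j r
  rw [hF.left_eq hn hri hrj hij, hF.left_eq hn hsk hsl hkl, mul_assoc, ← mul_assoc (star _),
    hF.orth' j r k s (by simp_all [eq_comm]), zero_mul, mul_zero]

theorem left_mul_left (hF : IsSkewGrid F) (hn : 5 ≤ n) {i j k : Fin n} (hij : i ≠ j)
    (hjk : j ≠ k) (hik : i ≠ k) : left F i j * left F j k = left F i k := by
  obtain ⟨s, hsi, hsj, hsk, -⟩ := exists_fresh hn i j k k
  have h := hF.left_mul_left_of_ne hn hsk hsi.symm hik.symm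
  rw [hF.left_eq hn hsj hsk hjk, hF.left_eq hn hsi hsk hik, hF.left_eq hn hik.symm hjk.symm hij]
  rw [hF.left_eq hn hsj.symm hjk hsk, hF.left_eq hn hik.symm hsk.symm hsi.symm, hF.swap j s,
    hF.swap j k, hF.swap k s] at h
  simp only [star_neg] at h
  have hp := hF.path i k j s (by simp_all [eq_comm])
  linear_combination (norm := noncomm_ring) hp * star (F k s) + h

theorem left_mul_left_mul_left (hF : IsSkewGrid F) (hn : 5 ≤ n) {i j k : Fin n} (hij : i ≠ j)
    (hjk : j ≠ k) : left F i j * left F j k * left F k j = left F i j := by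
  by_cases hik : i = k
  · subst hik
    obtain ⟨s, hsi, hsj, -⟩ := exists_fresh hn i j j j
    have h1 := hF.left_mul_left hn hsi.symm hsj hij
    have h2 := hF.left_mul_left hn hij.symm hsi.symm hsj.symm
    have h3 := hF.left_mul_left hn hij hsj.symm hsi.symm
    calc left F i j * left F j i * left F i j
        = left F i j * (left F j i * left F i s) * left F s j := by rw [← h1]; simp only [mul_assoc]
      _ = left F i j := by rw [h2, h3, h1]
  · rw [hF.left_mul_left hn hij hjk hik, hF.left_mul_left hn hik hjk.symm hij]

theorem left_mul_left_mul_left' (hF : IsSkewGrid F) (hn : 5 ≤ n) {i j k : Fin n} (hij : i ≠ j)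
    (hjk : j ≠ k) : left F j k * left F k j * left F j i = left F j i := by
  have h := congrArg star (hF.left_mul_left_mul_left hn hij hjk)
  simpa only [star_mul, hF.star_left hn hij, hF.star_left hn hjk, hF.star_left hn hjk.symm,
    mul_assoc] using h

theorem right_mul_right_of_ne (hF : IsSkewGrid F) (hn : 5 ≤ n) {i j k l : Fin n} (hij : i ≠ j)
    (hkl : k ≠ l) (hjk : j ≠ k) : right F i j * right F k l = 0 := by
  rw [hF.right_eq_unop hn hij, hF.right_eq_unop hn hkl, ← MulOpposite.unop_mul,
    hF.op.left_mul_left_of_ne hn hkl.symm hij.symm hjk.symm, MulOpposite.unop_zero]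

theorem right_mul_right (hF : IsSkewGrid F) (hn : 5 ≤ n) {i j k : Fin n} (hij : i ≠ j)
    (hjk : j ≠ k) (hik : i ≠ k) : right F i j * right F j k = right F i k := by
  rw [hF.right_eq_unop hn hij, hF.right_eq_unop hn hjk, hF.right_eq_unop hn hik,
    ← MulOpposite.unop_mul, hF.op.left_mul_left hn hjk.symm hij.symm hik.symm]

theorem right_mul_right_mul_right (hF : IsSkewGrid F) (hn : 5 ≤ n) {i j k : Fin n} (hij : i ≠ j)
    (hjk : j ≠ k) : right F i j * right F j k * right F k j = right F i j := by
  rw [hF.right_eq_unop hn hij, hF.right_eq_unop hn hjk, hF.right_eq_unop hn hjk.symm,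
    ← MulOpposite.unop_mul, ← MulOpposite.unop_mul, ← mul_assoc,
    hF.op.left_mul_left_mul_left' hn hij hjk]

open scoped Classical in
/-- The off-diagonal ternary matrix units of a skew-symmetric grid, in the model `E i j`. -/
noncomputable def unit (F : Fin n → Fin n → B) (i j : Fin n) : B :=
  if h : ∃ k, k ≠ i ∧ k ≠ j then left F i h.choose * F h.choose j else 0

theorem left_mul_eq_mul_right (hF : IsSkewGrid F) (hn : 5 ≤ n) {i j k r : Fin n}
    (h : [i, k, r, j].Nodup) : left F i k * F k j = F i r * right F r j := by
  rw [hF.left_eq hn (i := r) (by simp_all [eq_comm]) (by simp_all [eq_comm]) (by simp_all),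
    hF.right_eq hn (i := k) (by simp_all) (by simp_all) (by simp_all), mul_assoc]

theorem unit_eq_left (hF : IsSkewGrid F) (hn : 5 ≤ n) {i j k : Fin n} (hij : i ≠ j) (hi : k ≠ i)
    (hj : k ≠ j) : unit F i j = left F i k * F k j := by
  have hex : ∃ k, k ≠ i ∧ k ≠ j := ⟨k, hi, hj⟩
  have hl := hex.choose_spec
  rw [unit, dif_pos hex]
  generalize hex.choose = l at hl
  obtain ⟨r, hri, hrj, hrk, hrl⟩ := exists_fresh hn i j k l
  rw [hF.left_mul_eq_mul_right hn (r := r) (by simp_all [eq_comm]),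
    hF.left_mul_eq_mul_right hn (r := r) (by simp_all [eq_comm])]

theorem unit_eq_right (hF : IsSkewGrid F) (hn : 5 ≤ n) {i j k : Fin n} (hij : i ≠ j) (hi : k ≠ i)
    (hj : k ≠ j) : unit F i j = F i k * right F k j := by
  obtain ⟨r, hri, hrj, hrk, -⟩ := exists_fresh hn i j k k
  rw [hF.unit_eq_left hn hij hri hrj, hF.left_mul_eq_mul_right hn (r := k) (by simp_all [eq_comm])]

theorem left_mul_unit (hF : IsSkewGrid F) (hn : 5 ≤ n) {i j l : Fin n} (hij : i ≠ j)
    (hl : i ≠ l) (hlj : l ≠ j) : left F i l * unit F l j = unit F i j := by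
  obtain ⟨k, hki, hkj, hkl, -⟩ := exists_fresh hn i j l l
  rw [hF.unit_eq_left hn hlj hkl hkj, hF.unit_eq_left hn hij hki hkj, ← mul_assoc,
    hF.left_mul_left hn hl hkl.symm hki.symm]

theorem unit_mul_right (hF : IsSkewGrid F) (hn : 5 ≤ n) {i j l : Fin n} (hij : i ≠ j)
    (hl : i ≠ l) (hlj : l ≠ j) : unit F i l * right F l j = unit F i j := by
  obtain ⟨k, hki, hkj, hkl, -⟩ := exists_fresh hn i j l l
  rw [hF.unit_eq_right hn hl hki hkl, hF.unit_eq_right hn hij hki hkj, mul_assoc,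
    hF.right_mul_right hn hkl hlj hkj]

/-- The decomposition of the grid that the matrix units have to provide. -/
theorem unit_sub_unit (hF : IsSkewGrid F) (hn : 5 ≤ n) {i j : Fin n} (hij : i ≠ j) :
    unit F i j - unit F j i = F i j := by
  obtain ⟨k, hki, hkj, -⟩ := exists_fresh hn i j j j
  have h := hF.row i j k hij hkj hki.symm
  rw [hF.unit_eq_left hn hij hki hkj, hF.left_eq hn hij.symm hkj.symm hki.symm,
    hF.unit_eq_right hn hij.symm hkj hki, hF.right_eq hn hkj.symm hij.symm hki, hF.swap k j,
    hF.swap i j]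
  simp only [star_neg]
  linear_combination (norm := noncomm_ring) h

theorem star_unit_mul_unit (hF : IsSkewGrid F) (hn : 5 ≤ n) {i j k : Fin n} (hij : i ≠ j)
    (hi : k ≠ i) (hj : k ≠ j) : star (unit F i j) * unit F i j = right F j k * right F k j := by
  obtain ⟨r, hri, hrj, hrk, -⟩ := exists_fresh hn i j k k
  rw [hF.unit_eq_right hn hij hri hrj, star_mul, hF.star_right hn hrj,
    ← hF.unit_eq_right hn hij hri hrj, hF.unit_eq_right hn hij hi hj, mul_assoc,
    ← mul_assoc (star _), ← hF.right_eq hn hri.symm hi.symm hrk, ← mul_assoc, hF.right_mul_right hn hrj.symm hrk hj.symm]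

/-- The partial isometry `unit F p q` as corner, completed to its column and its row by the left
and by the right matrix units. -/
theorem exists_units (hF : IsSkewGrid F) (hn : 5 ≤ n) :
    ∃ e : Fin n → Fin n → B, IsMatrixUnits e ∧ ∀ i j, i ≠ j → F i j = e i j - e j i := by
  obtain ⟨p, q, hpq⟩ : ∃ p q : Fin n, p ≠ q := ⟨⟨0, by omega⟩, ⟨1, by omega⟩, by simp⟩
  obtain ⟨k, hkp, hkq, -⟩ := exists_fresh hn p q q q
  have hl := hF.unit_eq_left hn hpq hkp hkq
  have hr := hF.unit_eq_right hn hpq hkp hkq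
  have hs := hF.star_unit_mul_unit hn hpq hkp hkq
  have ha : unit F p q * star (unit F p q) * unit F p q = unit F p q := by
    rw [mul_assoc, hs, hr, mul_assoc, ← mul_assoc (right F k q),
      hF.right_mul_right_mul_right hn hkq hkq.symm]
  have hcol : ∀ i, i ≠ p → left F p i * left F i p * unit F p q = unit F p q := fun i hi => by
    rw [hl, ← mul_assoc, hF.left_mul_left_mul_left' hn hkp hi.symm]
  have hrow : ∀ j, j ≠ q → unit F p q * right F q j * right F j q = unit F p q := fun j hj => by
    rw [hr, mul_assoc, mul_assoc, ← mul_assoc (right F k q),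
      hF.right_mul_right_mul_right hn hkq hj.symm]
  have hcol' : ∀ i, i ≠ p → star (unit F p q) * left F i p = 0 := fun i hi => by
    rw [hl, star_mul, hF.star_left hn hkp.symm, mul_assoc,
      hF.left_mul_left_of_ne hn hkp hi hi.symm, mul_zero]
  have hrow' : ∀ j, j ≠ q → unit F p q * right F j q = 0 := fun j hj => by
    rw [hr, mul_assoc, hF.right_mul_right_of_ne hn hkq hj hj.symm, mul_zero]
  set a := unit F p q with ha_def
  refine ⟨_, IsMatrixUnits.of_column_row (a := a)
    (x := fun i => if i = p then a else left F i p * a)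
    (y := fun j => if j = q then a else a * right F q j) ha ?_ ?_, ?_⟩
  · intro i l
    by_cases hi : i = p
    · by_cases hl' : l = p
      · simp [hi, hl']
      · have : ¬ p = l := fun h => hl' h.symm
        simp only [hi, hl', this, if_true, if_false]
        rw [← mul_assoc, hcol' l hl', zero_mul]
    · rw [if_neg hi, star_mul, hF.star_left hn hi]
      by_cases hl' : l = p
      · have h := congrArg star (hcol' i hi)
        rw [star_mul, star_star, hF.star_left hn hi, star_zero] at h
        simp only [hl', hi, if_true, if_false]
        rw [mul_assoc, h, mul_zero]
      · rw [if_neg hl', mul_assoc, ← mul_assoc (left F p i)]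
        by_cases hil : i = l
        · rw [← hil, hcol i hi, if_pos rfl]
        · rw [hF.left_mul_left_of_ne hn (Ne.symm hi) hl' hil, if_neg hil, zero_mul, mul_zero]
  · intro j l
    by_cases hj : j = q
    · by_cases hl' : l = q
      · simp [hj, hl']
      · have : ¬ q = l := fun h => hl' h.symm
        simp only [hj, hl', this, if_true, if_false]
        rw [star_mul, hF.star_right hn (Ne.symm hl'), ← mul_assoc, hrow' l hl', zero_mul]
    · rw [if_neg hj]
      by_cases hl' : l = q
      · have h := congrArg star (hrow' j hj)
        rw [star_mul, hF.star_right hn hj, star_zero] at h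
        simp only [hl', hj, if_true, if_false]
        rw [mul_assoc, h, mul_zero]
      · rw [if_neg hl', star_mul, hF.star_right hn (Ne.symm hl'), mul_assoc,
          ← mul_assoc (right F q j)]
        by_cases hjl : j = l
        · rw [← hjl, ← mul_assoc, ← mul_assoc, hrow j hj, if_pos rfl]
        · rw [hF.right_mul_right_of_ne hn (Ne.symm hj) hl' hjl, if_neg hjl, zero_mul, mul_zero]
  · have key : ∀ i j, i ≠ j → (if i = p then a else left F i p * a) * star a *
        (if j = q then a else a * right F q j) = unit F i j := by
      intro i j hij
      by_cases hi : i = p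
      · subst hi
        by_cases hj : j = q
        · subst hj; rw [if_pos rfl, if_pos rfl, ha]
        · rw [if_pos rfl, if_neg hj, ← mul_assoc, ha, ha_def,
            hF.unit_mul_right hn hij hpq (Ne.symm hj)]
      · rw [if_neg hi]
        have e : left F i p * a * star a * a = left F i p * a := by
          rw [mul_assoc, mul_assoc, ← mul_assoc a, ha]
        by_cases hj : j = q
        · subst hj; rw [if_pos rfl, e, ha_def, hF.left_mul_unit hn hij hi hpq]
        · rw [if_neg hj, ← mul_assoc, e]
          by_cases hiq : i = q
          · by_cases hjp : j = p
            · subst hiq hjp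
              -- both indices of the unit are occupied by the base point: detour over a new index
              obtain ⟨s, hsi, hsj, hsk, -⟩ := exists_fresh hn i j k k
              rw [hr, mul_assoc, mul_assoc, hF.right_mul_right hn hkq hpq.symm hkp, ← mul_assoc,
                ← hF.unit_eq_left hn hkq.symm hpq hkp.symm, hF.unit_eq_right hn hkq.symm hsi hsk,
                mul_assoc, hF.right_mul_right hn hsk hkp hsj, ← hF.unit_eq_right hn hij hsi hsj]
            · rw [mul_assoc, ha_def, hF.unit_mul_right hn (Ne.symm hjp) hpq (Ne.symm hj),
                hF.left_mul_unit hn hij hi (Ne.symm hjp)]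
          · rw [ha_def, hF.left_mul_unit hn hiq hi hpq, hF.unit_mul_right hn hij hiq (Ne.symm hj)]
    intro i j hij
    simp only [key i j hij, key j i hij.symm, hF.unit_sub_unit hn hij]

end IsSkewGrid

end SkewGrid

/-! ### The universal TRO -/

section Universal

variable {B : Type*} [Ring B] [StarRing B] [Algebra ℂ B] [StarModule ℂ B] {Z : Factor}

/-- Linear maps from a factor to a star ring that preserve the triple product. -/
def IsTripleHom (φ : Z.Elt →ₗ[ℂ] B) : Prop :=
  ∀ a b c, φ (Z.tri a b c) =
    (1 / 2 : ℂ) • (φ a * star (φ b) * φ c + φ c * star (φ b) * φ a)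

/-- Linear maps from `τ(Z)` to a star ring that preserve `x y* z`. -/
def IsTernaryHom (Φ : Z.Tau →ₗ[ℂ] B) : Prop :=
  ∀ x y z : Z.Tau, Φ (fun i => x i * (y i)ᴴ * z i) = Φ x * star (Φ y) * Φ z

theorem IsTripleHom.map_add {φ : Z.Elt →ₗ[ℂ] B} (hφ : IsTripleHom φ) {a b c d : Z.Elt}
    (h : a.1 * b.1ᴴ * c.1 + c.1 * b.1ᴴ * a.1 = d.1) :
    φ a * star (φ b) * φ c + φ c * star (φ b) * φ a = φ d := by
  have h1 : Z.tri a b c = (1 / 2 : ℂ) • d := Subtype.ext (by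
    change (1 / 2 : ℂ) • (a.1 * b.1ᴴ * c.1 + c.1 * b.1ᴴ * a.1) = (1 / 2 : ℂ) • d.1
    rw [h])
  have h2 := hφ a b c
  rw [h1, map_smul] at h2
  exact (smul_right_injective B (by norm_num : (1 / 2 : ℂ) ≠ 0) h2).symm

theorem IsTripleHom.map_quadratic {φ : Z.Elt →ₗ[ℂ] B} (hφ : IsTripleHom φ) {a b d : Z.Elt}
    (h : a.1 * b.1ᴴ * a.1 = d.1) : φ a * star (φ b) * φ a = φ d := by
  have h1 : Z.tri a b a = d := Subtype.ext (by
    change (1 / 2 : ℂ) • (a.1 * b.1ᴴ * a.1 + a.1 * b.1ᴴ * a.1) = d.1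
    rw [h, ← two_smul ℂ, smul_smul]; norm_num)
  have h2 := hφ a b a
  rw [h1, ← two_smul ℂ, smul_smul] at h2
  rw [h2]; norm_num

theorem IsTripleHom.orthogonal {φ : Z.Elt →ₗ[ℂ] B} (hφ : IsTripleHom φ) {a b : Z.Elt}
    (h : a.1 * a.1ᴴ * a.1 = a.1) (h₁ : a.1 * a.1ᴴ * b.1 + b.1 * a.1ᴴ * a.1 = 0)
    (h₂ : a.1 * b.1ᴴ * a.1 = 0) : star (φ a) * φ b = 0 ∧ φ b * star (φ a) = 0 := by
  refine orthogonal_of_triple (hφ.map_quadratic h) ?_ ?_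
  · rw [hφ.map_add (d := 0) h₁, map_zero]
  · rw [hφ.map_quadratic (d := 0) h₂, map_zero]

theorem single_mul_single_one {l m n : ℕ} (i : Fin l) (j k : Fin m) (p : Fin n) :
    single i j (1 : ℂ) * single k p (1 : ℂ) = if j = k then single i p 1 else 0 := by
  split_ifs with h
  · rw [h, single_mul_single_same, one_mul]
  · rw [single_mul_single_of_ne _ _ _ _ h]

/-- The standard basis of a factor of type I. -/
def rectUnit {m n : ℕ} (i : Fin m) (j : Fin n) : (rect m n).Elt := ⟨single i j 1, Submodule.mem_top⟩

/-- The elements `E i j + E j i` of a factor of type III. -/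
def hermUnit {n : ℕ} (i j : Fin n) : (herm n).Elt :=
  ⟨single i j 1 + single j i 1, by
    change (single i j 1 + single j i 1)ᵀ = _
    rw [transpose_add, transpose_single, transpose_single, add_comm]⟩

/-- The diagonal elements `E i i` of a factor of type III. -/
def hermDiag {n : ℕ} (i : Fin n) : (herm n).Elt := ⟨single i i 1, transpose_single i i 1⟩

/-- The elements `E i j - E j i` of a factor of type II. -/
def skewUnit {n : ℕ} (i j : Fin n) : (symp n).Elt :=
  ⟨single i j 1 - single j i 1, by
    change (single i j 1 - single j i 1)ᵀ = -_
    rw [transpose_sub, transpose_single, transpose_single, neg_sub]⟩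

theorem IsTripleHom.isRectGrid {m n : ℕ} {φ : (rect m n).Elt →ₗ[ℂ] B} (hφ : IsTripleHom φ) :
    IsRectGrid fun i j => φ (rectUnit i j) := by
  intro i j k l p q
  rw [hφ.map_add (d := (if j = l ∧ k = p then rectUnit i q else 0) +
    (if q = l ∧ k = i then rectUnit p j else 0))]
  · rw [_root_.map_add, apply_ite φ, apply_ite φ, map_zero]
  · simp only [rectUnit, conjTranspose_single, star_one, single_mul_single_one]
    by_cases h1 : j = l <;> by_cases h2 : k = p <;> by_cases h3 : q = l <;> by_cases h4 : k = i <;>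
      simp [h1, h2, h3, h4, single_mul_single_one, apply_ite Subtype.val]

/-- The projection of the universal TRO onto a block. -/
def Factor.tauProj (F : Factor) (i : Fin F.tauBlocks) :
    F.Tau →ₗ[ℂ] Matrix (Fin (F.tauRows i)) (Fin (F.tauCols i)) ℂ :=
  LinearMap.proj i

theorem rect_eq_sum {m n : ℕ} (A : (rect m n).Elt) :
    A = ∑ i : Fin m, ∑ j : Fin n, A.1 i j • rectUnit i j := by
  apply Subtype.ext
  simp only [Submodule.coe_sum, Submodule.coe_smul, rectUnit, smul_single, smul_eq_mul, mul_one]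
  exact matrix_eq_sum_single A.1

theorem herm_eq_sum {n : ℕ} (A : (herm n).Elt) :
    A = (1 / 2 : ℂ) • ∑ i : Fin n, ∑ j : Fin n, A.1 i j • hermUnit i j := by
  have hA : A.1ᵀ = A.1 := A.2
  apply Subtype.ext
  simp only [Submodule.coe_smul, Submodule.coe_sum, hermUnit, smul_add, Finset.sum_add_distrib,
    smul_single, smul_eq_mul, mul_one]
  have h1 := matrix_eq_sum_single A.1
  have h2 := congrArg transpose h1
  rw [hA] at h2
  simp only [transpose_sum, transpose_single] at h2
  erw [← h1, ← h2]
  rw [← smul_add, ← two_smul ℂ, smul_smul]; norm_num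

theorem symp_eq_sum {n : ℕ} (A : (symp n).Elt) :
    A = (1 / 2 : ℂ) • ∑ i : Fin n, ∑ j : Fin n, A.1 i j • skewUnit i j := by
  have hA : A.1ᵀ = -A.1 := A.2
  apply Subtype.ext
  simp only [Submodule.coe_smul, Submodule.coe_sum, skewUnit, smul_sub, Finset.sum_sub_distrib,
    smul_single, smul_eq_mul, mul_one]
  have h1 := matrix_eq_sum_single A.1
  have h2 := congrArg transpose h1
  rw [hA] at h2
  simp only [transpose_sum, transpose_single] at h2
  erw [← h1, ← h2]
  rw [← smul_sub, sub_neg_eq_add, ← two_smul ℂ, smul_smul]; norm_num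

/-- The first block of `τ(Z)` acts through the matrix units of the grid, the second one through
those of the orthogonal transposed system. -/
theorem exists_ternaryHom_rect {m n : ℕ} (hm : 2 ≤ m) (hn : 2 ≤ n) {φ : (rect m n).Elt →ₗ[ℂ] B}
    (hφ : IsTripleHom φ) : ∃ Φ : (rect m n).Tau →ₗ[ℂ] B, IsTernaryHom Φ ∧
      ∀ A, Φ ((rect m n).rho A) = φ A := by
  obtain ⟨e, f, he, hf, h1, h2, h⟩ := hφ.isRectGrid.exists_units hm hn
  refine ⟨(ofUnits e).comp ((rect m n).tauProj 0) + (ofUnits f).comp ((rect m n).tauProj 1), ?_, ?_⟩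
  · intro x y z
    have key : ∀ (X Y Z : Matrix (Fin m) (Fin n) ℂ) (X' Y' Z' : Matrix (Fin n) (Fin m) ℂ),
        ofUnits e (X * Yᴴ * Z) + ofUnits f (X' * Y'ᴴ * Z') = (ofUnits e X + ofUnits f X') *
          star (ofUnits e Y + ofUnits f Y') * (ofUnits e Z + ofUnits f Z') := by
      intro X Y Z X' Y' Z'
      have e1 := ofUnits_mul_star_eq_zero h2 X Y'
      have e2 := star_ofUnits_mul_eq_zero h1 Y Z'
      have e3 := congrArg star (ofUnits_mul_star_eq_zero h2 Y X')
      have e4 := congrArg star (star_ofUnits_mul_eq_zero h1 Z Y')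
      rw [star_mul, star_star, star_zero] at e3 e4
      rw [he.ofUnits_mul, hf.ofUnits_mul, star_add]
      linear_combination (norm := noncomm_ring) -(e1 * (ofUnits e Z + ofUnits f Z'))
        - e3 * (ofUnits e Z + ofUnits f Z') - ofUnits e X * e2 - ofUnits f X' * e4
    exact key _ _ _ _ _ _
  · intro A
    change ofUnits e A.1 + ofUnits f A.1ᵀ = φ A
    conv_rhs => rw [rect_eq_sum A]
    simp only [map_sum, map_smul, h, smul_add, Finset.sum_add_distrib, ofUnits_apply]
    congr 1
    exact Finset.sum_comm

/-- The elements `E i i₀ + E i₀ i`, with `E i₀ i₀` at the index `i₀`, generate matrix units. -/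
theorem exists_ternaryHom_herm {n : ℕ} (hn : 2 ≤ n) {φ : (herm n).Elt →ₗ[ℂ] B}
    (hφ : IsTripleHom φ) : ∃ Φ : (herm n).Tau →ₗ[ℂ] B, IsTernaryHom Φ ∧
      ∀ A, Φ ((herm n).rho A) = φ A := by
  set i₀ : Fin n := ⟨0, by omega⟩
  set w : Fin n → (herm n).Elt := fun i => if i = i₀ then hermDiag i₀ else hermUnit i i₀ with hw
  have hw0 : w i₀ = hermDiag i₀ := by simp [hw]
  have hd : ∀ i, φ (w i) * star (φ (w i₀)) * φ (w i) = φ (hermDiag i) := fun i =>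
    hφ.map_quadratic (by
      by_cases h : i = i₀
      · subst h
        simp [hw, hermDiag]
      · have h' := Ne.symm h
        simp [hw, hermDiag, hermUnit, h, h', Matrix.add_mul,
          Matrix.mul_add])
  have he := isMatrixUnits_of_symmetric (s := fun i => φ (w i)) (i₀ := i₀) ?_ ?_ ?_
  · refine ⟨(ofUnits _).comp ((herm n).tauProj 0),
      fun x y z => he.ofUnits_mul (x 0) (y 0) (z 0), fun A => ?_⟩
    change ofUnits _ A.1 = φ A
    have hA : A.1ᵀ = A.1 := A.2
    have hs : ∀ i j, φ (w i) * star (φ (w i₀)) * φ (w j) + φ (w j) * star (φ (w i₀)) * φ (w i)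
        = φ (hermUnit i j) := fun i j => hφ.map_add (by
      by_cases h : i = i₀
      · by_cases h' : j = i₀
        · simp [hw, h, h', hermDiag, hermUnit]
        · simp [hw, h, h', Ne.symm h', hermDiag, hermUnit, Matrix.add_mul,
          Matrix.mul_add]
      · by_cases h' : j = i₀
        · simp [hw, h, h', Ne.symm h, hermDiag, hermUnit, Matrix.add_mul,
          Matrix.mul_add]
        · simp [hw, h, h', Ne.symm h, Ne.symm h', hermDiag, hermUnit, Matrix.add_mul,
          Matrix.mul_add])
    conv_rhs => rw [herm_eq_sum A]
    simp only [map_sum, map_smul, ← hs, smul_add, Finset.sum_add_distrib, ofUnits_apply]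
    rw [Finset.sum_comm (f := fun i j => A.1 i j • (φ (w j) * star (φ (w i₀)) * φ (w i)))]
    have : ∀ i j, A.1 j i = A.1 i j := fun i j => congrFun (congrFun hA i) j
    simp only [this]
    rw [← smul_add, ← two_smul ℂ, smul_smul]
    norm_num
  · intro i
    refine hφ.map_quadratic ?_
    by_cases h : i = i₀
    · simp [hw, h, hermDiag]
    · simp [hw, hermDiag, hermUnit, h, Ne.symm h, Matrix.add_mul,
          Matrix.mul_add]
  · intro i
    rw [hd]
    refine hφ.map_quadratic ?_
    by_cases h : i = i₀
    · simp [hw, h, hermDiag]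
    · simp [hw, hermDiag, hermUnit, h, Ne.symm h, Matrix.add_mul,
          Matrix.mul_add]
  · intro i k hik
    rw [hd, hd]
    have h1 := hφ.orthogonal (a := hermDiag i) (b := hermDiag k) (by simp [hermDiag])
      (by simp [hermDiag, hik, hik.symm])
      (by simp [hermDiag, hik])
    exact ⟨h1.1, by simpa using congrArg star h1.2⟩

theorem nodup_four {α : Type*} {i j k l : α} :
    [i, j, k, l].Nodup ↔ i ≠ j ∧ i ≠ k ∧ i ≠ l ∧ j ≠ k ∧ j ≠ l ∧ k ≠ l := by
  simp [and_assoc]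

theorem IsTripleHom.isSkewGrid {n : ℕ} {φ : (symp n).Elt →ₗ[ℂ] B} (hφ : IsTripleHom φ) :
    IsSkewGrid fun i j => φ (skewUnit i j) where
  swap i j := by
    rw [← map_neg]; congr 1; exact Subtype.ext (neg_sub _ _).symm
  row i j k h1 h2 h3 := hφ.map_add (by
    simp [skewUnit, h1, h2, h3, h1.symm, h2.symm, h3.symm, Matrix.sub_mul, Matrix.mul_sub,
      Matrix.add_mul, ← sub_eq_add_neg])
  path i j k l h := hφ.map_add (by
    obtain ⟨h1, h2, h3, h4, h5, h6⟩ := nodup_four.1 h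
    simp [skewUnit, *, Ne.symm h1, Ne.symm h4,
      Ne.symm h5, Ne.symm h6, Matrix.sub_mul, Matrix.mul_sub,
      ← sub_eq_add_neg])
  orth i j k l h := by
    obtain ⟨h1, h2, h3, h4, h5, h6⟩ := nodup_four.1 h
    refine (hφ.orthogonal (a := skewUnit k l) (b := skewUnit i j) ?_ ?_ ?_).2 <;>
    simp [skewUnit, *, Ne.symm h2, Ne.symm h3, Ne.symm h4,
      Ne.symm h5, Ne.symm h6, Matrix.sub_mul, Matrix.mul_sub,
      Matrix.add_mul]
  orth' i j k l h := by
    obtain ⟨h1, h2, h3, h4, h5, h6⟩ := nodup_four.1 h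
    refine (hφ.orthogonal (a := skewUnit i j) (b := skewUnit k l) ?_ ?_ ?_).1 <;>
    simp [skewUnit, *, Ne.symm h1, Ne.symm h2, Ne.symm h3, Ne.symm h4,
      Ne.symm h5, Matrix.sub_mul, Matrix.mul_sub,
      Matrix.add_mul]

theorem exists_ternaryHom_symp {n : ℕ} (hn : 5 ≤ n) {φ : (symp n).Elt →ₗ[ℂ] B}
    (hφ : IsTripleHom φ) : ∃ Φ : (symp n).Tau →ₗ[ℂ] B, IsTernaryHom Φ ∧
      ∀ A, Φ ((symp n).rho A) = φ A := by
  obtain ⟨e, he, h⟩ := hφ.isSkewGrid.exists_units hn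
  refine ⟨(ofUnits e).comp ((symp n).tauProj 0),
    fun x y z => he.ofUnits_mul (x 0) (y 0) (z 0), fun A => ?_⟩
  change ofUnits e A.1 = φ A
  have hA : A.1ᵀ = -A.1 := A.2
  have hs : ∀ i j, φ (skewUnit i j) = e i j - e j i := fun i j => by
    by_cases hij : i = j
    · subst hij
      have : (skewUnit i i : (symp n).Elt) = 0 := Subtype.ext (sub_self _)
      rw [this, map_zero, sub_self]
    · exact h i j hij
  conv_rhs => rw [symp_eq_sum A]
  simp only [map_sum, map_smul, hs, smul_sub, Finset.sum_sub_distrib, ofUnits_apply]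
  rw [Finset.sum_comm (f := fun i j => A.1 i j • e j i)]
  have h2 : ∑ i, ∑ j, A.1 j i • e i j = -∑ i, ∑ j, A.1 i j • e i j := by
    rw [← Finset.sum_neg_distrib]
    refine Finset.sum_congr rfl fun i _ => ?_
    rw [← Finset.sum_neg_distrib]
    refine Finset.sum_congr rfl fun j _ => ?_
    rw [← neg_smul]
    exact congrArg (· • e i j) (congrFun (congrFun hA i) j)
  rw [← smul_sub]
  erw [h2]
  rw [sub_neg_eq_add, ← two_smul ℂ, smul_smul]
  norm_num

end Universal

/-! ### The factor generates its universal TRO -/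

section Generation

/-- The element `X ⊕ Y` of the universal TRO of a factor of type I. -/
def rectPair {m n : ℕ} (X : Matrix (Fin m) (Fin n) ℂ) (Y : Matrix (Fin n) (Fin m) ℂ) :
    (rect m n).Tau := fun i =>
  match i with
  | 0 => X
  | 1 => Y

theorem rho_rect {m n : ℕ} (A : (rect m n).Elt) : (rect m n).rho A = rectPair A.1 A.1ᵀ := rfl

theorem rectPair_eta {m n : ℕ} (x : (rect m n).Tau) : x = rectPair (x 0) (x 1) := by
  funext i; fin_cases i <;> rfl

/-- `rectPair` as a linear map on pairs. -/
def rectPairₗ (m n : ℕ) :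
    Matrix (Fin m) (Fin n) ℂ × Matrix (Fin n) (Fin m) ℂ →ₗ[ℂ] (rect m n).Tau where
  toFun p := rectPair p.1 p.2
  map_add' p q := by funext i; fin_cases i <;> rfl
  map_smul' a p := by funext i; fin_cases i <;> rfl

theorem rectPair_triple {m n : ℕ} (X X' X'' : Matrix (Fin m) (Fin n) ℂ)
    (Y Y' Y'' : Matrix (Fin n) (Fin m) ℂ) :
    (fun i => rectPair X Y i * (rectPair X' Y' i)ᴴ * rectPair X'' Y'' i) =
      rectPair (X * X'ᴴ * X'') (Y * Y'ᴴ * Y'') := by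
  funext i; fin_cases i <;> rfl

theorem mem_of_single_mem {m n : ℕ} {V : Type*} [AddCommGroup V] [Module ℂ V]
    (S : Submodule ℂ V) (L : Matrix (Fin m) (Fin n) ℂ →ₗ[ℂ] V)
    (h : ∀ i j, L (single i j 1) ∈ S) (X) : L X ∈ S := by
  rw [matrix_eq_sum_single X, map_sum]
  refine S.sum_mem fun i _ => ?_
  rw [map_sum]
  refine S.sum_mem fun j _ => ?_
  have : single i j (X i j) = X i j • single i j (1 : ℂ) := by
    rw [smul_single, smul_eq_mul, mul_one]
  rw [this, map_smul]
  exact S.smul_mem _ (h i j)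

/-- The image of `ρ` generates `τ(Z)` as a TRO. -/
theorem eq_top_of_rho_mem {Z : Factor} (hZ : Z.IsSource) (S : Submodule ℂ Z.Tau)
    (hS : ∀ x ∈ S, ∀ y ∈ S, ∀ z ∈ S, (fun i => x i * (y i)ᴴ * z i) ∈ S)
    (hρ : ∀ A, Z.rho A ∈ S) : S = ⊤ := by
  rw [eq_top_iff]
  rintro x -
  match Z, hZ with
  | rect m n, hZ =>
    obtain ⟨hm, hn⟩ := hZ
    have : Nontrivial (Fin m) := Fin.nontrivial_iff_two_le.2 hm
    have : Nontrivial (Fin n) := Fin.nontrivial_iff_two_le.2 hn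
    -- `E i j ⊕ 0` is the product of `ρ(E i k)`, `ρ(E i k)`, `ρ(E i j)`, whose transposes have
    -- product zero
    have h1 := mem_of_single_mem S ((rectPairₗ m n).comp (LinearMap.inl ℂ _ _)) (fun i j => by
      obtain ⟨k, hk⟩ := exists_ne j
      have := hS _ (hρ (rectUnit i k)) _ (hρ (rectUnit i k)) _ (hρ (rectUnit i j))
      rw [rho_rect, rho_rect, rectPair_triple] at this
      refine (congrArg (· ∈ S) (congrArg₂ rectPair ?_ ?_)).mpr this <;> simp [rectUnit, hk]) (x 0)
    have h2 := mem_of_single_mem S ((rectPairₗ m n).comp (LinearMap.inr ℂ _ _)) (fun j i => by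
      obtain ⟨k, hk⟩ := exists_ne i
      have := hS _ (hρ (rectUnit k j)) _ (hρ (rectUnit k j)) _ (hρ (rectUnit i j))
      rw [rho_rect, rho_rect, rectPair_triple] at this
      refine (congrArg (· ∈ S) (congrArg₂ rectPair ?_ ?_)).mpr this <;> simp [rectUnit, hk]) (x 1)
    have h3 : x = rectPair (m := m) (n := n) (x 0) 0 + rectPair (m := m) (n := n) 0 (x 1) := by
      conv_lhs => rw [rectPair_eta x]
      funext i; fin_cases i
      · exact (add_zero (x 0)).symm
      · exact (zero_add (x 1)).symm
    rw [h3]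
    exact S.add_mem h1 h2
  | symp n, hZ =>
    change 5 ≤ n at hZ
    -- with `G i j = E i j - E j i`, the product of `G i k`, `G i k`, `G i j` is `E i j`
    have h1 : ∀ i j : Fin n, i ≠ j → (fun _ => single i j 1 : (symp n).Tau) ∈ S := fun i j hij => by
      obtain ⟨k, hki, hkj, -⟩ := exists_fresh hZ i j j j
      have := hS _ (hρ (skewUnit i k)) _ (hρ (skewUnit i k)) _ (hρ (skewUnit i j))
      convert this using 1
      funext _
      simp [rho, skewUnit, hki, hkj, hij, hki.symm,
        Matrix.sub_mul, Matrix.mul_sub, Matrix.add_mul]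
    have h2 := mem_of_single_mem S (LinearMap.pi fun _ => LinearMap.id) (fun i j => by
      by_cases hij : i = j
      · subst hij
        obtain ⟨k, hki, -⟩ := exists_fresh hZ i i i i
        obtain ⟨l, hli, hlk, -⟩ := exists_fresh hZ i k k k
        have := hS _ (h1 i l hli.symm) _ (h1 k l hlk.symm) _ (h1 k i hki)
        convert this using 1
        funext _
        simp
      · exact h1 i j hij) (x 0)
    convert h2 using 1
    funext i; fin_cases i; rfl
  | herm n, hZ =>
    have h2 := mem_of_single_mem S (LinearMap.pi fun _ => LinearMap.id) (fun i j => by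
      by_cases hij : i = j
      · subst hij
        exact hρ (hermDiag i)
      · have := hS _ (hρ (hermDiag i)) _ (hρ (hermDiag i)) _ (hρ (hermUnit i j))
        convert this using 1
        funext _
        simp [rho, hermUnit, hermDiag, hij, Matrix.mul_add]) (x 0)
    convert h2 using 1
    funext i; fin_cases i; rfl

/-- Maps that preserve a ternary operation are determined by their restriction to `ρ(Z)`. -/
theorem tau_hom_ext {Z : Factor} (hZ : Z.IsSource) {V : Type*} [AddCommGroup V] [Module ℂ V]
    (t : V → V → V → V) {Φ Ψ : Z.Tau →ₗ[ℂ] V}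
    (hΦ : ∀ x y z : Z.Tau, Φ (fun i => x i * (y i)ᴴ * z i) = t (Φ x) (Φ y) (Φ z))
    (hΨ : ∀ x y z : Z.Tau, Ψ (fun i => x i * (y i)ᴴ * z i) = t (Ψ x) (Ψ y) (Ψ z))
    (h : ∀ A, Φ (Z.rho A) = Ψ (Z.rho A)) : Φ = Ψ := by
  have := eq_top_of_rho_mem hZ (LinearMap.eqLocus Φ Ψ) (fun x hx y hy z hz => by
    rw [LinearMap.mem_eqLocus] at *
    rw [hΦ, hΨ, hx, hy, hz]) h
  exact LinearMap.eqLocus_eq_top.1 this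

end Generation

/-! ### The universal property -/

section Universal

variable {Z : Factor}

theorem IsTripleHom.exists_ternaryHom {B : Type*} [Ring B] [StarRing B] [Algebra ℂ B]
    [StarModule ℂ B] (hZ : Z.IsSource) {φ : Z.Elt →ₗ[ℂ] B} (hφ : IsTripleHom φ) :
    ∃ Φ : Z.Tau →ₗ[ℂ] B, IsTernaryHom Φ ∧ ∀ A, Φ (Z.rho A) = φ A := by
  match Z, hZ with
  | rect m n, hZ => exact exists_ternaryHom_rect hZ.1 hZ.2 hφ
  | symp n, hZ => exact exists_ternaryHom_symp hZ hφ
  | herm n, hZ => exact exists_ternaryHom_herm hZ hφ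

theorem IsTernaryHom.mem {B : Type*} [Ring B] [StarRing B] [Algebra ℂ B]
    (hZ : Z.IsSource) {Φ : Z.Tau →ₗ[ℂ] B} (hΦ : IsTernaryHom Φ) (T : Submodule ℂ B)
    (hT : ∀ x ∈ T, ∀ y ∈ T, ∀ z ∈ T, x * star y * z ∈ T) (h : ∀ A, Φ (Z.rho A) ∈ T) (x) :
    Φ x ∈ T := by
  have := eq_top_of_rho_mem hZ (T.comap Φ) (fun x hx y hy z hz => by
    rw [Submodule.mem_comap] at *
    rw [hΦ]
    exact hT _ hx _ hy _ hz) h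
  exact (eq_top_iff.1 this trivial : x ∈ T.comap Φ)

theorem isUniversalTRO (hZ : Z.IsSource) : IsUniversalTRO.{u} Z := by
  intro B _ T _ hT φ hφT hφ
  obtain ⟨Φ, hΦ, h⟩ := IsTripleHom.exists_ternaryHom hZ (φ := φ) hφ
  refine ⟨Φ, ⟨hΦ.mem hZ T hT fun A => ?_, hΦ, h⟩, ?_⟩
  · rw [h]; exact hφT A
  · rintro Ψ ⟨-, hΨ, h'⟩
    exact tau_hom_ext hZ (fun a b c => a * star b * c) hΨ hΦ fun A => by rw [h, h']

/-- Linear maps from a finite dimensional TRO to a matrix space that preserve `x y* z`. -/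
def IsMatrixTernaryHom {p k l : ℕ} {r c : Fin p → ℕ}
    (Φ : TRO r c →ₗ[ℂ] Matrix (Fin k) (Fin l) ℂ) : Prop :=
  ∀ x y z : TRO r c, Φ (fun i => x i * (y i)ᴴ * z i) = Φ x * (Φ y)ᴴ * Φ z

/-- The corner embedding of the `k × l` matrices into a C*-algebra. -/
def cornerEmb (k l : ℕ) :
    Matrix (Fin k) (Fin l) ℂ →ₗ[ℂ] Matrix (Fin k ⊕ Fin l) (Fin k ⊕ Fin l) ℂ where
  toFun A := fromBlocks 0 A 0 0
  map_add' A A' := by simp [fromBlocks_add]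
  map_smul' a A := by simp [fromBlocks_smul]

theorem cornerEmb_mul {k l : ℕ} (a b c : Matrix (Fin k) (Fin l) ℂ) :
    cornerEmb k l a * star (cornerEmb k l b) * cornerEmb k l c = cornerEmb k l (a * bᴴ * c) := by
  simp [cornerEmb, star_eq_conjTranspose, fromBlocks_conjTranspose, fromBlocks_multiply]

theorem exists_matrixTernaryHom (hZ : Z.IsSource) {k l : ℕ}
    {φ : Z.Elt →ₗ[ℂ] Matrix (Fin k) (Fin l) ℂ}
    (hφ : ∀ a b c, φ (Z.tri a b c) = triple (φ a) (φ b) (φ c)) :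
    ∃ Φ : Z.Tau →ₗ[ℂ] Matrix (Fin k) (Fin l) ℂ, IsMatrixTernaryHom Φ ∧
      ∀ A, Φ (Z.rho A) = φ A := by
  have h1 : IsTripleHom ((cornerEmb k l).comp φ) := fun a b c => by
    simp only [LinearMap.comp_apply, cornerEmb_mul, hφ, triple, map_smul, map_add]
  obtain ⟨Φ, hΦ, h⟩ := h1.exists_ternaryHom hZ
  have hmem := hΦ.mem hZ (LinearMap.range (cornerEmb k l)) (by
    rintro _ ⟨x, rfl⟩ _ ⟨y, rfl⟩ _ ⟨z, rfl⟩
    exact ⟨_, (cornerEmb_mul x y z).symm⟩) fun A => by rw [h]; exact ⟨_, rfl⟩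
  let π : Matrix (Fin k ⊕ Fin l) (Fin k ⊕ Fin l) ℂ →ₗ[ℂ] Matrix (Fin k) (Fin l) ℂ :=
    { toFun := toBlocks₁₂
      map_add' := fun _ _ => rfl
      map_smul' := fun _ _ => rfl }
  have hπ : ∀ A, π (cornerEmb k l A) = A := fun A => toBlocks_fromBlocks₁₂ _ _ _ _
  refine ⟨π.comp Φ, fun x y z => ?_, fun A => ?_⟩
  · obtain ⟨a, ha⟩ := hmem x
    obtain ⟨b, hb⟩ := hmem y
    obtain ⟨c, hc⟩ := hmem z
    simp only [LinearMap.comp_apply, hΦ x y z, ← ha, ← hb, ← hc, cornerEmb_mul, hπ]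
  · simp only [LinearMap.comp_apply, h, hπ]

end Universal

/-! ### Projections and isometries of matrices -/

/-- A projection matrix is `W Wᴴ` with an isometry `W`. -/
theorem exists_isometry_of_projection {l : ℕ} {Q : Matrix (Fin l) (Fin l) ℂ} (hQ : Qᴴ = Q)
    (hQ' : Q * Q = Q) : ∃ (α : ℕ) (W : Matrix (Fin l) (Fin α) ℂ), Wᴴ * W = 1 ∧ W * Wᴴ = Q := by
  let f := Matrix.toEuclideanLin Q
  let b := stdOrthonormalBasis ℂ (LinearMap.range f)
  have hfix : ∀ s, Q *ᵥ (fun w => (b s).1 w) = fun w => (b s).1 w := fun s => by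
    obtain ⟨v, hv⟩ := (b s).2
    have h1 : (b s).1.ofLp = Q *ᵥ v.ofLp := by rw [← hv]; rfl
    change Q *ᵥ (b s).1.ofLp = (b s).1.ofLp
    rw [h1, mulVec_mulVec, hQ']
  refine ⟨_, Matrix.of fun y s => (b s).1 y, ?_, ?_⟩
  · ext s t
    have h := b.orthonormal
    rw [orthonormal_iff_ite] at h
    have := h s t
    rw [Submodule.coe_inner, PiLp.inner_apply] at this
    simp only [mul_apply, conjTranspose_apply, of_apply, one_apply]
    rw [← this]
    refine Finset.sum_congr rfl fun w _ => ?_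
    simp [mul_comm]
  · ext y z
    have hz : (WithLp.toLp 2 (fun w => Q w z) : EuclideanSpace ℂ (Fin l)) ∈ LinearMap.range f :=
      ⟨EuclideanSpace.single z 1, by
        ext w
        simp [f, Matrix.toLpLin_apply]⟩
    have h1 := congrArg (fun v => v.1 y) (b.sum_repr' ⟨_, hz⟩)
    simp only [Submodule.coe_sum, Submodule.coe_smul, Submodule.coe_inner] at h1
    simp only [mul_apply, conjTranspose_apply, of_apply]
    trans Q y z
    swap; rfl
    refine Eq.trans ?_ h1
    rw [WithLp.ofLp_sum, Finset.sum_apply]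
    refine Finset.sum_congr rfl fun s _ => ?_
    have h2 := congrFun (hfix s) z
    simp only [mulVec, dotProduct] at h2
    rw [PiLp.smul_apply, smul_eq_mul, mul_comm, PiLp.inner_apply]
    congr 1
    rw [← h2, star_sum]
    refine Finset.sum_congr rfl fun w _ => ?_
    have h3 : star (Q z w) = Q w z := congrFun (congrFun hQ w) z
    simp [← h3]

/-- An isometry can be completed to a unitary matrix, with its columns in prescribed places. -/
theorem exists_unitary_of_isometry {k z : ℕ} {ι : Type*} [Fintype ι] [DecidableEq ι]
    {V₀ : Matrix (Fin k) ι ℂ} (h : V₀ᴴ * V₀ = 1) (e : ι ⊕ Fin z ≃ Fin k) :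
    ∃ V : Matrix.unitaryGroup (Fin k) ℂ,
      ∀ x i, (V : Matrix (Fin k) (Fin k) ℂ) x (e (Sum.inl i)) = V₀ x i := by
  let v : Fin k → EuclideanSpace ℂ (Fin k) := fun j =>
    match e.symm j with
    | Sum.inl i => WithLp.toLp 2 fun x => V₀ x i
    | Sum.inr _ => 0
  have hv : ∀ i, v (e (Sum.inl i)) = WithLp.toLp 2 fun x => V₀ x i := fun i => by simp [v]
  have ho : Orthonormal ℂ ((Set.range fun i => e (Sum.inl i)).domRestrict v) := by
    rw [orthonormal_iff_ite]
    rintro ⟨_, i, rfl⟩ ⟨_, j, rfl⟩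
    have := congrFun (congrFun h i) j
    simp only [mul_apply, conjTranspose_apply, one_apply] at this
    have hij : i = j ↔ (⟨e (Sum.inl i), i, rfl⟩ : Set.range fun i => e (Sum.inl i)) =
        ⟨e (Sum.inl j), j, rfl⟩ := ⟨fun h => by subst h; rfl,
      fun h => Sum.inl_injective (e.injective (congrArg Subtype.val h))⟩
    refine Eq.trans ?_ (if_congr hij rfl rfl)
    change inner ℂ (v (e (Sum.inl i))) (v (e (Sum.inl j))) = _
    rw [hv, hv, ← this, PiLp.inner_apply]
    refine Finset.sum_congr rfl fun w _ => ?_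
    simp [mul_comm]
  obtain ⟨b, hb⟩ := ho.exists_orthonormalBasis_extension_of_card_eq (by simp)
  refine ⟨⟨Matrix.of fun x j => b j x, ?_⟩, fun x i => ?_⟩
  · rw [Matrix.mem_unitaryGroup_iff']
    ext i j
    have h' := b.orthonormal
    rw [orthonormal_iff_ite] at h'
    rw [one_apply, ← h' i j, PiLp.inner_apply]
    simp only [star_eq_conjTranspose, mul_apply, conjTranspose_apply, of_apply]
    refine Finset.sum_congr rfl fun w _ => ?_
    simp [mul_comm]
  · change (b (e (Sum.inl i))).ofLp x = _
    rw [hb _ ⟨i, rfl⟩, hv]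

/-! ### Decomposition of TRO-morphisms into identity representations -/

section Multiplicity

variable {p k l : ℕ} {r c : Fin p → ℕ}

/-- The representation `⨁ i, id_i ^ α i` of a finite dimensional TRO. -/
def repSum (α : Fin p → ℕ) (x : TRO r c) :
    Matrix (Σ i : Fin p, Fin (r i) × Fin (α i)) (Σ i : Fin p, Fin (c i) × Fin (α i)) ℂ :=
  Matrix.blockDiagonal' fun i => Matrix.blockDiagonal fun _ : Fin (α i) => x i

theorem tro_single_triple (i : Fin p) (X Y Z : Matrix (Fin (r i)) (Fin (c i)) ℂ) :
    (fun t => (Pi.single i X : TRO r c) t * ((Pi.single i Y : TRO r c) t)ᴴ *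
      (Pi.single i Z : TRO r c) t) = Pi.single i (X * Yᴴ * Z) := by
  funext t
  by_cases h : t = i
  · subst h; simp
  · simp [h]

theorem tro_single_triple_of_ne {i j : Fin p} (hij : i ≠ j) (X : Matrix (Fin (r i)) (Fin (c i)) ℂ)
    (Y Z : Matrix (Fin (r j)) (Fin (c j)) ℂ) :
    (fun t => (Pi.single i X : TRO r c) t * ((Pi.single j Y : TRO r c) t)ᴴ *
      (Pi.single j Z : TRO r c) t) = 0 := by
  funext t
  by_cases h : t = i
  · subst h; simp [hij]
  · simp [h]

theorem tro_single_triple_of_ne' {i j : Fin p} (hij : i ≠ j)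
    (X Y : Matrix (Fin (r i)) (Fin (c i)) ℂ) (Z : Matrix (Fin (r j)) (Fin (c j)) ℂ) :
    (fun t => (Pi.single i X : TRO r c) t * ((Pi.single i Y : TRO r c) t)ᴴ *
      (Pi.single j Z : TRO r c) t) = 0 := by
  funext t
  by_cases h : t = j
  · subst h; simp [hij.symm]
  · simp [h]

/-- The image under `Φ` of the standard matrix unit `(i, j)` of the block `b`. -/
def blockUnit (Φ : TRO r c →ₗ[ℂ] Matrix (Fin k) (Fin l) ℂ) (b : Fin p) (i : Fin (r b))
    (j : Fin (c b)) : Matrix (Fin k) (Fin l) ℂ := Φ (Pi.single b (single i j 1))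

theorem map_eq_sum_blockUnit (Φ : TRO r c →ₗ[ℂ] Matrix (Fin k) (Fin l) ℂ) (x : TRO r c) :
    Φ x = ∑ b, ∑ i, ∑ j, x b i j • blockUnit Φ b i j := by
  conv_lhs => rw [← Finset.univ_sum_single x, map_sum]
  refine Finset.sum_congr rfl fun b _ => ?_
  have h : ∀ X : Matrix (Fin (r b)) (Fin (c b)) ℂ, Φ (Pi.single b X) =
      (Φ.comp (LinearMap.single ℂ (fun i => Matrix (Fin (r i)) (Fin (c i)) ℂ) b)) X := fun X => rfl
  rw [h]
  conv_lhs => rw [matrix_eq_sum_single (x b)]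
  simp only [map_sum]
  refine Finset.sum_congr rfl fun i _ => Finset.sum_congr rfl fun j _ => ?_
  have : single i j (x b i j) = x b i j • single i j (1 : ℂ) := by
    rw [smul_single, smul_eq_mul, mul_one]
  rw [this, map_smul]
  rfl

namespace IsMatrixTernaryHom

variable {Φ : TRO r c →ₗ[ℂ] Matrix (Fin k) (Fin l) ℂ}

theorem blockUnit_mul (hΦ : IsMatrixTernaryHom Φ) (b i j i' j' i'' j'') :
    blockUnit Φ b i j * (blockUnit Φ b i' j')ᴴ * blockUnit Φ b i'' j'' =
      if j = j' ∧ i' = i'' then blockUnit Φ b i j'' else 0 := by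
  rw [blockUnit, blockUnit, blockUnit, ← hΦ, tro_single_triple, conjTranspose_single, star_one,
    single_mul_single_one]
  by_cases h1 : j = j'
  · by_cases h2 : i' = i''
    · simp [h1, h2, blockUnit]
    · simp [h1, h2]
  · simp [h1]

open scoped ComplexOrder in
/-- Here `a bᴴ` vanishes because `(a bᴴ) (a bᴴ)ᴴ` does. -/
theorem mul_conjTranspose_eq_zero {a b : Matrix (Fin k) (Fin l) ℂ} (h : a * bᴴ * b = 0) :
    a * bᴴ = 0 := by
  rw [← self_mul_conjTranspose_eq_zero]
  simp only [conjTranspose_mul, conjTranspose_conjTranspose]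
  rw [← Matrix.mul_assoc, h, Matrix.zero_mul]

open scoped ComplexOrder in
theorem conjTranspose_mul_eq_zero {a b : Matrix (Fin k) (Fin l) ℂ} (h : a * aᴴ * b = 0) :
    aᴴ * b = 0 := by
  rw [← conjTranspose_mul_self_eq_zero]
  simp only [conjTranspose_mul, conjTranspose_conjTranspose]
  rw [Matrix.mul_assoc, ← Matrix.mul_assoc a, h, Matrix.mul_zero]

theorem blockUnit_orthogonal (hΦ : IsMatrixTernaryHom Φ) {b b'} (i j i' j')
    (h : (⟨b, j⟩ : Σ b, Fin (c b)) ≠ ⟨b', j'⟩) :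
    blockUnit Φ b i j * (blockUnit Φ b' i' j')ᴴ = 0 := by
  apply mul_conjTranspose_eq_zero
  by_cases hb : b = b'
  · subst hb
    rw [hΦ.blockUnit_mul, if_neg]
    rintro ⟨rfl, -⟩
    exact h rfl
  · rw [blockUnit, blockUnit, ← hΦ, tro_single_triple_of_ne hb, map_zero]

theorem blockUnit_orthogonal' (hΦ : IsMatrixTernaryHom Φ) {b b'} (i j i' j')
    (h : (⟨b, i⟩ : Σ b, Fin (r b)) ≠ ⟨b', i'⟩) :
    (blockUnit Φ b i j)ᴴ * blockUnit Φ b' i' j' = 0 := by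
  apply conjTranspose_mul_eq_zero
  by_cases hb : b = b'
  · subst hb
    rw [hΦ.blockUnit_mul, if_neg]
    rintro ⟨-, rfl⟩
    exact h rfl
  · rw [blockUnit, blockUnit, ← hΦ, tro_single_triple_of_ne' hb, map_zero]

/-- A morphism of finite dimensional TROs is a direct sum of identity representations: the copies
of `id_b` are indexed by an orthonormal basis of the initial space of the corner `blockUnit b 0 0`,
which is moved to the other rows and columns by the matrix units. -/
theorem exists_isometries (hΦ : IsMatrixTernaryHom Φ) (hr : ∀ i, 0 < r i) (hc : ∀ i, 0 < c i) :
    ∃ (α : Fin p → ℕ) (V : Matrix (Fin k) (Σ i : Fin p, Fin (r i) × Fin (α i)) ℂ)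
      (U : Matrix (Fin l) (Σ i : Fin p, Fin (c i) × Fin (α i)) ℂ),
      Vᴴ * V = 1 ∧ Uᴴ * U = 1 ∧ ∀ x, Φ x = V * repSum α x * Uᴴ := by
  let i₀ : ∀ b, Fin (r b) := fun b => ⟨0, hr b⟩
  let j₀ : ∀ b, Fin (c b) := fun b => ⟨0, hc b⟩
  let a : Fin p → Matrix (Fin k) (Fin l) ℂ := fun b => blockUnit Φ b (i₀ b) (j₀ b)
  have ha : ∀ b, a b * (a b)ᴴ * a b = a b := fun b => by
    simp only [a]; rw [hΦ.blockUnit_mul]; simp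
  have hW : ∀ b, ∃ (α : ℕ) (W : Matrix (Fin l) (Fin α) ℂ), Wᴴ * W = 1 ∧ W * Wᴴ = (a b)ᴴ * a b :=
    fun b => exists_isometry_of_projection (by simp) (by
      rw [Matrix.mul_assoc, ← Matrix.mul_assoc (a b), ha])
  choose α W hW1 hW2 using hW
  have haW : ∀ b, (W b)ᴴ * ((a b)ᴴ * a b) * W b = 1 := fun b => by
    rw [← hW2, ← Matrix.mul_assoc, hW1, Matrix.one_mul, hW1]
  -- the rows `L b i` and columns `R b j` of the block `b`, each an isometry of `ℂ ^ α b`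
  let L : ∀ b, Fin (r b) → Matrix (Fin k) (Fin (α b)) ℂ := fun b i => blockUnit Φ b i (j₀ b) * W b
  let R : ∀ b, Fin (c b) → Matrix (Fin l) (Fin (α b)) ℂ :=
    fun b j => (blockUnit Φ b (i₀ b) j)ᴴ * a b * W b
  have hLL : ∀ b i b' i', (⟨b, i⟩ : Σ b, Fin (r b)) ≠ ⟨b', i'⟩ → (L b i)ᴴ * L b' i' = 0 := by
    intro b i b' i' h
    simp only [L, conjTranspose_mul]
    rw [Matrix.mul_assoc, ← Matrix.mul_assoc _ _ (W b'), hΦ.blockUnit_orthogonal' _ _ _ _ h,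
      Matrix.zero_mul, Matrix.mul_zero]
  have hRR : ∀ b i b' i', (⟨b, i⟩ : Σ b, Fin (c b)) ≠ ⟨b', i'⟩ → (R b i)ᴴ * R b' i' = 0 := by
    intro b i b' i' h
    simp only [R, conjTranspose_mul, conjTranspose_conjTranspose]
    have := hΦ.blockUnit_orthogonal (i₀ b) i (i₀ b') i' h
    calc _ = (W b)ᴴ * (a b)ᴴ * (blockUnit Φ b (i₀ b) i * (blockUnit Φ b' (i₀ b') i')ᴴ) *
          (a b' * W b') := by simp only [Matrix.mul_assoc]
      _ = 0 := by rw [this, Matrix.mul_zero, Matrix.zero_mul]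
  have hL : ∀ b i, (L b i)ᴴ * L b i = 1 := fun b i => by
    have h1 : (blockUnit Φ b i (j₀ b))ᴴ * blockUnit Φ b i (j₀ b) = (a b)ᴴ * a b := by
      have h1 := hΦ.blockUnit_mul b i (j₀ b) (i₀ b) (j₀ b) (i₀ b) (j₀ b)
      have h2 := hΦ.blockUnit_mul b (i₀ b) (j₀ b) i (j₀ b) i (j₀ b)
      simp only [and_self, if_true] at h1 h2
      conv_lhs => rw [← h1]
      simp only [conjTranspose_mul, conjTranspose_conjTranspose]
      rw [Matrix.mul_assoc, Matrix.mul_assoc, ← Matrix.mul_assoc (blockUnit Φ b (i₀ b) (j₀ b)),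
        h1, h2]
    simp only [L, conjTranspose_mul]
    rw [Matrix.mul_assoc, ← Matrix.mul_assoc _ _ (W b), h1, ← Matrix.mul_assoc, haW]
  have hR : ∀ b i, (R b i)ᴴ * R b i = 1 := fun b i => by
    have h1 := hΦ.blockUnit_mul b (i₀ b) i (i₀ b) i (i₀ b) (j₀ b)
    simp only [and_self, if_true] at h1
    simp only [R, conjTranspose_mul, conjTranspose_conjTranspose]
    calc _ = (W b)ᴴ * ((a b)ᴴ * (blockUnit Φ b (i₀ b) i * (blockUnit Φ b (i₀ b) i)ᴴ *
          blockUnit Φ b (i₀ b) (j₀ b))) * W b := by simp only [Matrix.mul_assoc, a]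
      _ = 1 := by rw [h1, haW]
  have hLR : ∀ b i j, blockUnit Φ b i j = L b i * (R b j)ᴴ := fun b i j => by
    have h1 := hΦ.blockUnit_mul b i (j₀ b) (i₀ b) (j₀ b) (i₀ b) j
    have h2 := hΦ.blockUnit_mul b i (j₀ b) (i₀ b) (j₀ b) (i₀ b) (j₀ b)
    simp only [and_self, if_true] at h1 h2
    simp only [L, R, conjTranspose_mul, conjTranspose_conjTranspose]
    calc _ = blockUnit Φ b i (j₀ b) * (a b)ᴴ * blockUnit Φ b (i₀ b) j := h1.symm
      _ = blockUnit Φ b i (j₀ b) * (a b)ᴴ * a b * (a b)ᴴ * blockUnit Φ b (i₀ b) j := by rw [h2]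
      _ = blockUnit Φ b i (j₀ b) * ((a b)ᴴ * a b) * (a b)ᴴ * blockUnit Φ b (i₀ b) j := by
        simp only [Matrix.mul_assoc]
      _ = _ := by rw [← hW2]; simp only [Matrix.mul_assoc]
  refine ⟨α, Matrix.of fun y t => L t.1 t.2.1 y t.2.2, Matrix.of fun y t => R t.1 t.2.1 y t.2.2,
    ?_, ?_, ?_⟩
  · ext ⟨b, i, s⟩ ⟨b', i', s'⟩
    change ((L b i)ᴴ * L b' i') s s' = _
    by_cases h : (⟨b, i⟩ : Σ b, Fin (r b)) = ⟨b', i'⟩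
    · obtain ⟨rfl, h⟩ := Sigma.mk.inj_iff.1 h
      obtain rfl := eq_of_heq h
      rw [hL]; simp [one_apply]
    · rw [hLL _ _ _ _ h, one_apply_ne]
      · rfl
      · intro h'; apply h; cases h'; rfl
  · ext ⟨b, i, s⟩ ⟨b', i', s'⟩
    change ((R b i)ᴴ * R b' i') s s' = _
    by_cases h : (⟨b, i⟩ : Σ b, Fin (c b)) = ⟨b', i'⟩
    · obtain ⟨rfl, h⟩ := Sigma.mk.inj_iff.1 h
      obtain rfl := eq_of_heq h
      rw [hR]; simp [one_apply]
    · rw [hRR _ _ _ _ h, one_apply_ne]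
      · rfl
      · intro h'; apply h; cases h'; rfl
  · intro x
    have hD : ∀ (M : Matrix (Σ i : Fin p, Fin (c i) × Fin (α i)) (Fin l) ℂ) (b i s z),
        (repSum α x * M) ⟨b, i, s⟩ z = ∑ j, x b i j * M ⟨b, j, s⟩ z := by
      intro M b i s z
      rw [mul_apply, Fintype.sum_sigma, Finset.sum_eq_single b]
      · rw [Fintype.sum_prod_type]
        refine Finset.sum_congr rfl fun j _ => ?_
        rw [Finset.sum_eq_single s]
        · simp [repSum, blockDiagonal'_apply_eq, blockDiagonal_apply_eq]
        · intro s' _ hs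
          simp [repSum, blockDiagonal'_apply_eq, blockDiagonal_apply_ne _ _ _ hs.symm]
        · simp
      · intro b' _ hb
        refine Finset.sum_eq_zero fun t _ => ?_
        simp [repSum, blockDiagonal'_apply_ne _ _ _ hb.symm]
      · simp
    rw [map_eq_sum_blockUnit, Matrix.mul_assoc]
    ext y z
    rw [mul_apply, Fintype.sum_sigma, Matrix.sum_apply]
    refine Finset.sum_congr rfl fun b _ => ?_
    rw [Fintype.sum_prod_type, Matrix.sum_apply]
    refine Finset.sum_congr rfl fun i _ => ?_
    simp only [hD, hLR, Matrix.sum_apply, Matrix.smul_apply, mul_apply, conjTranspose_apply,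
      of_apply, smul_eq_mul, Finset.mul_sum]
    rw [Finset.sum_comm]
    refine Finset.sum_congr rfl fun s _ => Finset.sum_congr rfl fun j _ => ?_
    ring

end IsMatrixTernaryHom

end Multiplicity

section Multiplicity

variable {p k l : ℕ} {r c : Fin p → ℕ}

theorem trace_repSum (α : Fin p → ℕ) (x : TRO r c) :
    trace (repSum α x * (repSum α x)ᴴ) = ∑ i, (α i : ℂ) * trace (x i * (x i)ᴴ) := by
  simp only [repSum, blockDiagonal'_conjTranspose, blockDiagonal_conjTranspose,
    ← blockDiagonal'_mul, ← blockDiagonal_mul, trace_blockDiagonal', trace_blockDiagonal,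
    Finset.sum_const, Finset.card_univ, Fintype.card_fin, nsmul_eq_mul]

theorem trace_unitary_mul {V : Matrix.unitaryGroup (Fin k) ℂ} {U : Matrix.unitaryGroup (Fin l) ℂ}
    (A : Matrix (Fin k) (Fin l) ℂ) :
    trace ((V : Matrix (Fin k) (Fin k) ℂ) * A * (U : Matrix (Fin l) (Fin l) ℂ) *
      ((V : Matrix (Fin k) (Fin k) ℂ) * A * (U : Matrix (Fin l) (Fin l) ℂ))ᴴ) =
      trace (A * Aᴴ) := by
  have hU := Matrix.mem_unitaryGroup_iff.1 U.2
  have hV := Matrix.mem_unitaryGroup_iff'.1 V.2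
  rw [star_eq_conjTranspose] at hU hV
  simp only [conjTranspose_mul]
  have : (V : Matrix (Fin k) (Fin k) ℂ) * A * (U : Matrix (Fin l) (Fin l) ℂ) *
      ((U : Matrix (Fin l) (Fin l) ℂ)ᴴ * (Aᴴ * (V : Matrix (Fin k) (Fin k) ℂ)ᴴ)) =
      (V : Matrix (Fin k) (Fin k) ℂ) * A *
        ((U : Matrix (Fin l) (Fin l) ℂ) * (U : Matrix (Fin l) (Fin l) ℂ)ᴴ) *
        (Aᴴ * (V : Matrix (Fin k) (Fin k) ℂ)ᴴ) := by simp only [Matrix.mul_assoc]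
  rw [this, hU, Matrix.mul_one, ← Matrix.mul_assoc, trace_mul_comm, Matrix.mul_assoc,
    ← Matrix.mul_assoc, hV, Matrix.one_mul]

theorem trace_reindex_fromBlocks {ι κ : Type*} [Fintype ι] [Fintype κ] {z z' : ℕ}
    (e : ι ⊕ Fin z ≃ Fin k) (f : κ ⊕ Fin z' ≃ Fin l) (D : Matrix ι κ ℂ) :
    trace (Matrix.reindex e f (fromBlocks D 0 0 0) * (Matrix.reindex e f (fromBlocks D 0 0 0))ᴴ)
      = trace (D * Dᴴ) := by
  rw [conjTranspose_reindex]
  simp only [reindex_apply, submatrix_mul_equiv, fromBlocks_conjTranspose, fromBlocks_multiply]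
  have : ∀ M : Matrix (ι ⊕ Fin z) (ι ⊕ Fin z) ℂ, trace (M.submatrix e.symm e.symm) = trace M :=
    fun M => e.symm.sum_comp fun i => M i i
  rw [this]
  simp [trace, Fintype.sum_sum_type]

theorem card_repSum (α : Fin p → ℕ) : Fintype.card (Σ i : Fin p, Fin (r i) × Fin (α i)) =
    ∑ i, r i * α i := by
  simp [Fintype.card_sigma]

theorem card_le_of_isometry {ι : Type*} [Fintype ι] [DecidableEq ι] {V : Matrix (Fin k) ι ℂ}
    (h : Vᴴ * V = 1) : Fintype.card ι ≤ k := by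
  rw [← rank_one (R := ℂ) (n := ι), ← h]
  exact (rank_mul_le_right _ _).trans (by simpa using V.rank_le_card_height)

/-- The decomposition into identity representations in unitary form; the places `e` and `f` of the
blocks can be prescribed. -/
theorem IsMatrixTernaryHom.exists_multiplicity {Φ : TRO r c →ₗ[ℂ] Matrix (Fin k) (Fin l) ℂ}
    (hΦ : IsMatrixTernaryHom Φ) (hr : ∀ i, 0 < r i) (hc : ∀ i, 0 < c i) :
    ∃ α : Fin p → ℕ, ∑ i, r i * α i ≤ k ∧ ∑ i, c i * α i ≤ l ∧
      ∀ (z z' : ℕ) (e : (Σ i : Fin p, Fin (r i) × Fin (α i)) ⊕ Fin z ≃ Fin k)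
        (f : (Σ i : Fin p, Fin (c i) × Fin (α i)) ⊕ Fin z' ≃ Fin l),
        ∃ (V : Matrix.unitaryGroup (Fin k) ℂ) (U : Matrix.unitaryGroup (Fin l) ℂ), ∀ x,
          Φ x = (V : Matrix (Fin k) (Fin k) ℂ) *
            Matrix.reindex e f (fromBlocks (repSum α x) 0 0 0) *
              (U : Matrix (Fin l) (Fin l) ℂ) := by
  obtain ⟨α, V₀, U₀, hV₀, hU₀, h⟩ := hΦ.exists_isometries hr hc
  refine ⟨α, ?_, ?_, fun z z' e f => ?_⟩
  · rw [← card_repSum]; exact card_le_of_isometry hV₀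
  · rw [← card_repSum]; exact card_le_of_isometry hU₀
  · obtain ⟨V, hV⟩ := exists_unitary_of_isometry hV₀ e
    obtain ⟨U, hU⟩ := exists_unitary_of_isometry hU₀ f
    refine ⟨V, star U, fun x => ?_⟩
    rw [h]
    ext y y'
    have h1 : ∀ (A : Matrix (Fin k) (Fin k) ℂ) (B : Matrix (Fin l) (Fin l) ℂ)
        (M : Matrix _ _ ℂ), A * Matrix.reindex e f M * B =
          A.submatrix id e * M * B.submatrix f id := fun A B M => by
      have e1 : A = (A.submatrix id e).submatrix id e.symm := by ext; simp
      have e2 : B = (B.submatrix f id).submatrix f.symm id := by ext; simp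
      conv_lhs => rw [e1, e2, reindex_apply, submatrix_mul_equiv, submatrix_mul_equiv]
      rfl
    have h2 : (V : Matrix (Fin k) (Fin k) ℂ).submatrix id e =
        fromCols V₀ ((V : Matrix (Fin k) (Fin k) ℂ).submatrix id (e ∘ Sum.inr)) := by
      ext a (b | b)
      · exact hV a b
      · rfl
    have h3 : ((star U : Matrix.unitaryGroup (Fin l) ℂ) : Matrix (Fin l) (Fin l) ℂ).submatrix f id =
        fromRows U₀ᴴ (((star U : Matrix.unitaryGroup (Fin l) ℂ) :
          Matrix (Fin l) (Fin l) ℂ).submatrix (f ∘ Sum.inr) id) := by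
      ext (b | b) a
      · exact congrArg star (hU a b)
      · rfl
    rw [h1, h2, h3, fromCols_mul_fromBlocks, fromCols_mul_fromRows]
    simp

end Multiplicity

/-! ### Multiplicity matrices of TRO-morphisms -/

section TROMorphisms

variable {p q : ℕ} {r c : Fin p → ℕ} {k l : Fin q → ℕ} {Φ Ψ : TRO r c →ₗ[ℂ] TRO k l}

theorem IsTROHom.component (hΦ : IsTROHom Φ) (j : Fin q) :
    IsMatrixTernaryHom ((LinearMap.proj (R := ℂ)
      (φ := fun j => Matrix (Fin (k j)) (Fin (l j)) ℂ) j).comp Φ) :=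
  fun x y z => congrFun (hΦ x y z) j

/-- The Hilbert–Schmidt norms of the components of `Φ x` determine the multiplicity matrix. -/
def HasTraceMultiplicity (Φ : TRO r c →ₗ[ℂ] TRO k l) (α : Matrix (Fin q) (Fin p) ℕ) : Prop :=
  ∀ x j, trace (Φ x j * (Φ x j)ᴴ) = ∑ i, (α j i : ℂ) * trace (x i * (x i)ᴴ)

theorem trace_weights_unique (hr : ∀ i, 0 < r i) (hc : ∀ i, 0 < c i) {a b : Fin p → ℕ}
    (h : ∀ x : TRO r c, ∑ i, (a i : ℂ) * trace (x i * (x i)ᴴ) =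
      ∑ i, (b i : ℂ) * trace (x i * (x i)ᴴ)) : a = b := by
  ext i
  have h := h (Pi.single i (single ⟨0, hr i⟩ ⟨0, hc i⟩ 1))
  rw [Finset.sum_eq_single i, Finset.sum_eq_single i] at h
  · simpa using h
  · intro i' _ hi; simp [hi]
  · simp
  · intro i' _ hi; simp [hi]
  · simp

theorem HasTraceMultiplicity.unique (hr : ∀ i, 0 < r i) (hc : ∀ i, 0 < c i)
    {α β : Matrix (Fin q) (Fin p) ℕ} (hα : HasTraceMultiplicity Φ α)
    (hβ : HasTraceMultiplicity Φ β) : α = β :=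
  funext fun j => trace_weights_unique hr hc fun x => (hα x j).symm.trans (hβ x j)

theorem TROHasMultiplicity.hasTraceMultiplicity {α : Matrix (Fin q) (Fin p) ℕ}
    (h : TROHasMultiplicity Φ α) : HasTraceMultiplicity Φ α := by
  intro x j
  obtain ⟨V, U, z, z', e, f, h⟩ := h j
  rw [h x, trace_unitary_mul, trace_reindex_fromBlocks]
  exact trace_repSum (α j) x

theorem exists_equiv_fin {ι : Type*} [Fintype ι] {k : ℕ} (h : Fintype.card ι ≤ k) :
    Nonempty (ι ⊕ Fin (k - Fintype.card ι) ≃ Fin k) :=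
  ⟨Fintype.equivOfCardEq (by simp [h])⟩

/-- The multiplicities, with the decomposition into identity representations at arbitrary places. -/
theorem IsTROHom.exists_traceMultiplicity (hΦ : IsTROHom Φ) (hr : ∀ i, 0 < r i)
    (hc : ∀ i, 0 < c i) : ∃ α : Matrix (Fin q) (Fin p) ℕ, HasTraceMultiplicity Φ α ∧ ∀ j,
      ∑ i, r i * α j i ≤ k j ∧ ∑ i, c i * α j i ≤ l j ∧
      ∀ (z z' : ℕ) (e : (Σ i : Fin p, Fin (r i) × Fin (α j i)) ⊕ Fin z ≃ Fin (k j))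
        (f : (Σ i : Fin p, Fin (c i) × Fin (α j i)) ⊕ Fin z' ≃ Fin (l j)),
        ∃ (V : Matrix.unitaryGroup (Fin (k j)) ℂ) (U : Matrix.unitaryGroup (Fin (l j)) ℂ), ∀ x,
          Φ x j = (V : Matrix (Fin (k j)) (Fin (k j)) ℂ) *
            Matrix.reindex e f (fromBlocks (repSum (α j) x) 0 0 0) *
              (U : Matrix (Fin (l j)) (Fin (l j)) ℂ) := by
  choose α h1 h2 h3 using fun j => (hΦ.component j).exists_multiplicity hr hc
  refine ⟨α, fun x j => ?_, fun j => ⟨h1 j, h2 j, h3 j⟩⟩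
  obtain ⟨e⟩ := exists_equiv_fin ((card_repSum (α j)).trans_le (h1 j))
  obtain ⟨f⟩ := exists_equiv_fin ((card_repSum (α j)).trans_le (h2 j))
  obtain ⟨V, U, h⟩ := h3 j _ _ e f
  have h := h x
  change Φ x j = _ at h
  rw [h, trace_unitary_mul, trace_reindex_fromBlocks, trace_repSum]

theorem HasTraceMultiplicity.sum_le {α : Matrix (Fin q) (Fin p) ℕ} (h : HasTraceMultiplicity Φ α)
    (hΦ : IsTROHom Φ) (hr : ∀ i, 0 < r i) (hc : ∀ i, 0 < c i) (j) :
    ∑ i, r i * α j i ≤ k j ∧ ∑ i, c i * α j i ≤ l j := by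
  obtain ⟨β, hβ, h'⟩ := hΦ.exists_traceMultiplicity hr hc
  obtain rfl := h.unique hr hc hβ
  exact ⟨(h' j).1, (h' j).2.1⟩

theorem HasTraceMultiplicity.troHasMultiplicity {α : Matrix (Fin q) (Fin p) ℕ}
    (h : HasTraceMultiplicity Φ α) (hΦ : IsTROHom Φ) (hr : ∀ i, 0 < r i) (hc : ∀ i, 0 < c i) :
    TROHasMultiplicity Φ α := by
  obtain ⟨β, hβ, h'⟩ := hΦ.exists_traceMultiplicity hr hc
  obtain rfl := h.unique hr hc hβ
  intro j
  obtain ⟨h1, h2, h3⟩ := h' j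
  obtain ⟨e⟩ := exists_equiv_fin ((card_repSum (α j)).trans_le h1)
  obtain ⟨f⟩ := exists_equiv_fin ((card_repSum (α j)).trans_le h2)
  obtain ⟨V, U, h⟩ := h3 _ _ e f
  exact ⟨V, U, _, _, e, f, h⟩

/-- Morphisms with the same multiplicities are equivalent to the same direct sum. -/
theorem HasTraceMultiplicity.troEquivalent {α : Matrix (Fin q) (Fin p) ℕ}
    (h : HasTraceMultiplicity Φ α) (h' : HasTraceMultiplicity Ψ α) (hΦ : IsTROHom Φ)
    (hΨ : IsTROHom Ψ) (hr : ∀ i, 0 < r i) (hc : ∀ i, 0 < c i) : TROEquivalent Φ Ψ := by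
  obtain ⟨β, hβ, hb⟩ := hΦ.exists_traceMultiplicity hr hc
  obtain rfl := h.unique hr hc hβ
  obtain ⟨γ, hγ, hg⟩ := hΨ.exists_traceMultiplicity hr hc
  obtain rfl := h'.unique hr hc hγ
  have key : ∀ j, ∃ (V : Matrix.unitaryGroup (Fin (k j)) ℂ)
      (U : Matrix.unitaryGroup (Fin (l j)) ℂ), ∀ x,
      Φ x j = (V : Matrix (Fin (k j)) (Fin (k j)) ℂ) * Ψ x j *
        (U : Matrix (Fin (l j)) (Fin (l j)) ℂ) := by
    intro j
    obtain ⟨h1, h2, h3⟩ := hb j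
    obtain ⟨-, -, h4⟩ := hg j
    obtain ⟨e⟩ := exists_equiv_fin ((card_repSum (α j)).trans_le h1)
    obtain ⟨f⟩ := exists_equiv_fin ((card_repSum (α j)).trans_le h2)
    obtain ⟨V, U, h⟩ := h3 _ _ e f
    obtain ⟨V', U', h'⟩ := h4 _ _ e f
    refine ⟨V * star V', star U' * U, fun x => ?_⟩
    have hV := Matrix.mem_unitaryGroup_iff'.1 V'.2
    have hU := Matrix.mem_unitaryGroup_iff.1 U'.2
    rw [h, h']
    simp only [Submonoid.coe_mul, Unitary.coe_star]
    generalize Matrix.reindex e f (fromBlocks (repSum (α j) x) 0 0 0) = D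
    calc _ = (V : Matrix (Fin (k j)) (Fin (k j)) ℂ) * (1 : Matrix (Fin (k j)) (Fin (k j)) ℂ) * D *
          (1 : Matrix (Fin (l j)) (Fin (l j)) ℂ) *
          (U : Matrix (Fin (l j)) (Fin (l j)) ℂ) := by rw [Matrix.mul_one, Matrix.mul_one]
      _ = _ := by rw [← hV, ← hU]; simp only [Matrix.mul_assoc]
  choose V U h using key
  exact ⟨V, U, fun x j => h j x⟩

end TROMorphisms

/-! ### The lift of a JB*-morphism and its multiplicity matrix -/

section Lift

variable {Z W : Factor}

theorem Factor.IsSource.tauRows_pos (hZ : Z.IsSource) : ∀ i, 0 < Z.tauRows i := by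
  match Z, hZ with
  | rect m n, hZ => intro i; obtain ⟨h1, h2⟩ := hZ; fin_cases i <;> simp <;> omega
  | symp n, hZ => intro i; change 5 ≤ n at hZ; change 0 < n; omega
  | herm n, hZ => intro i; change 2 ≤ n at hZ; change 0 < n; omega

theorem Factor.IsSource.tauCols_pos (hZ : Z.IsSource) : ∀ i, 0 < Z.tauCols i := by
  match Z, hZ with
  | rect m n, hZ => intro i; obtain ⟨h1, h2⟩ := hZ; fin_cases i <;> simp <;> omega
  | symp n, hZ => intro i; change 5 ≤ n at hZ; change 0 < n; omega
  | herm n, hZ => intro i; change 2 ≤ n at hZ; change 0 < n; omega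

/-- `ρ` as a linear map. -/
def rhoₗ (W : Factor) : W.Elt →ₗ[ℂ] W.Tau where
  toFun := W.rho
  map_add' a b := by
    match W with
    | rect m n => funext i; fin_cases i <;> rfl
    | symp n => rfl
    | herm n => rfl
  map_smul' a b := by
    match W with
    | rect m n => funext i; fin_cases i <;> rfl
    | symp n => rfl
    | herm n => rfl

theorem rho_injective (W : Factor) : Function.Injective W.rho := by
  intro a b h
  match W with
  | rect m n => exact Subtype.ext (congrFun h 0)
  | symp n => exact Subtype.ext (congrFun h 0)
  | herm n => exact Subtype.ext (congrFun h 0)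

theorem conjTranspose_transpose_comm {m n : ℕ} (A : Matrix (Fin m) (Fin n) ℂ) : Aᵀᴴ = Aᴴᵀ := rfl

theorem transpose_triple_rect {m n : ℕ} (a b c : Matrix (Fin m) (Fin n) ℂ) :
    (triple a b c)ᵀ = triple aᵀ bᵀ cᵀ := by
  simp only [triple, transpose_smul, transpose_add, transpose_mul, conjTranspose_transpose_comm,
    Matrix.mul_assoc]
  rw [add_comm]

theorem rho_tri (W : Factor) (a b c : W.Elt) (j) :
    W.rho (W.tri a b c) j = triple (W.rho a j) (W.rho b j) (W.rho c j) := by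
  match W with
  | rect m n =>
    match j with
    | 0 => rfl
    | 1 => exact transpose_triple_rect _ _ _
  | symp n => rfl
  | herm n => rfl

/-- The blocks of `ρ_W ∘ φ` are triple homomorphisms into matrix spaces, which extend to `τ(Z)`. -/
theorem existsUnique_lift (hZ : Z.IsSource) {φ : Z.Elt →ₗ[ℂ] W.Elt} (hφ : IsJBHom φ) :
    ∃! Φ : Z.Tau →ₗ[ℂ] W.Tau, IsLift φ Φ := by
  have h : ∀ j, ∃ Φ : Z.Tau →ₗ[ℂ] Matrix (Fin (W.tauRows j)) (Fin (W.tauCols j)) ℂ,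
      IsMatrixTernaryHom Φ ∧ ∀ A, Φ (Z.rho A) = ((LinearMap.proj (R := ℂ)
        (φ := fun j => Matrix (Fin (W.tauRows j)) (Fin (W.tauCols j)) ℂ) j).comp
          ((rhoₗ W).comp φ)) A := fun j => exists_matrixTernaryHom hZ fun a b c => by
    change W.rho (φ (Z.tri a b c)) j = _
    rw [hφ, rho_tri]
    rfl
  choose Φ hΦ hΦ' using h
  refine ⟨LinearMap.pi Φ, ⟨fun x y z => funext fun j => hΦ j x y z,
    fun A => funext fun j => hΦ' j A⟩, ?_⟩
  rintro Ψ ⟨hΨ, hΨ'⟩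
  refine tau_hom_ext hZ (fun a b c : W.Tau => fun j => a j * (b j)ᴴ * c j) hΨ
    (fun x y z => funext fun j => hΦ j x y z) fun A => ?_
  rw [hΨ']
  exact funext fun j => (hΦ' j A).symm

theorem hasMultiplicity_iff (hZ : Z.IsSource) {φ : Z.Elt →ₗ[ℂ] W.Elt} (hφ : IsJBHom φ)
    {Φ : Z.Tau →ₗ[ℂ] W.Tau} (hΦ : IsLift φ Φ) {α} :
    HasMultiplicity φ α ↔ HasTraceMultiplicity Φ α := by
  constructor
  · rintro ⟨Ψ, hΨ, h⟩
    rw [(existsUnique_lift hZ hφ).unique hΦ hΨ]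
    exact h.hasTraceMultiplicity
  · exact fun h => ⟨Φ, hΦ, h.troHasMultiplicity hΦ.1 hZ.tauRows_pos hZ.tauCols_pos⟩

theorem existsUnique_multiplicity (hZ : Z.IsSource) {φ : Z.Elt →ₗ[ℂ] W.Elt} (hφ : IsJBHom φ) :
    ∃! α : Matrix (Fin W.tauBlocks) (Fin Z.tauBlocks) ℕ, HasMultiplicity φ α := by
  obtain ⟨Φ, hΦ, -⟩ := existsUnique_lift hZ hφ
  obtain ⟨α, hα, -⟩ := hΦ.1.exists_traceMultiplicity hZ.tauRows_pos hZ.tauCols_pos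
  refine ⟨α, (hasMultiplicity_iff hZ hφ hΦ).2 hα, fun β hβ => ?_⟩
  exact ((hasMultiplicity_iff hZ hφ hΦ).1 hβ).unique hZ.tauRows_pos hZ.tauCols_pos hα

theorem unitarilyEquivalent_of_hasMultiplicity (hZ : Z.IsSource) {φ ψ : Z.Elt →ₗ[ℂ] W.Elt}
    (hφ : IsJBHom φ) (hψ : IsJBHom ψ) {α} (h : HasMultiplicity φ α) (h' : HasMultiplicity ψ α) :
    UnitarilyEquivalent φ ψ := by
  obtain ⟨Φ, hΦ, -⟩ := existsUnique_lift hZ hφ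
  obtain ⟨Ψ, hΨ, -⟩ := existsUnique_lift hZ hψ
  rw [hasMultiplicity_iff hZ hφ hΦ] at h
  rw [hasMultiplicity_iff hZ hψ hΨ] at h'
  exact ⟨Φ, Ψ, hΦ, hΨ, h.troEquivalent h' hΦ.1 hΨ.1 hZ.tauRows_pos hZ.tauCols_pos⟩

open scoped ComplexOrder in
theorem HasMultiplicity.ne_zero (hZ : Z.IsSource) {φ : Z.Elt →ₗ[ℂ] W.Elt} (hφ : IsJBHom φ) {α}
    (h : HasMultiplicity φ α) : α ≠ 0 ↔ φ ≠ 0 := by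
  obtain ⟨Φ, hΦ, -⟩ := existsUnique_lift hZ hφ
  rw [hasMultiplicity_iff hZ hφ hΦ] at h
  rw [not_iff_not]
  constructor
  · rintro rfl
    have h0 : ∀ x, Φ x = 0 := fun x => funext fun j => by
      have := h x j
      simp only [Matrix.zero_apply, Nat.cast_zero, zero_mul, Finset.sum_const_zero] at this
      exact trace_mul_conjTranspose_self_eq_zero_iff.1 this
    refine LinearMap.ext fun A => rho_injective W ?_
    rw [← hΦ.2, h0]
    exact ((rhoₗ W).map_zero).symm
  · rintro rfl
    have h1 : IsLift (0 : Z.Elt →ₗ[ℂ] W.Elt) 0 :=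
      ⟨fun x y z => by funext j; simp, fun A => ((rhoₗ W).map_zero).symm⟩
    have := (existsUnique_lift hZ hφ).unique hΦ h1
    subst this
    refine h.unique hZ.tauRows_pos hZ.tauCols_pos fun x j => ?_
    simp

/-- The copies of the identity representations have to fit into the blocks of `τ(W)`. -/
theorem HasMultiplicity.sum_le (hZ : Z.IsSource) {φ : Z.Elt →ₗ[ℂ] W.Elt} (hφ : IsJBHom φ) {α}
    (h : HasMultiplicity φ α) (j) : ∑ i, Z.tauRows i * α j i ≤ W.tauRows j ∧
      ∑ i, Z.tauCols i * α j i ≤ W.tauCols j := by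
  obtain ⟨Φ, hΦ, -⟩ := existsUnique_lift hZ hφ
  rw [hasMultiplicity_iff hZ hφ hΦ] at h
  exact h.sum_le hΦ.1 hZ.tauRows_pos hZ.tauCols_pos j

end Lift

/-! ### The canonical involution of the universal TRO -/

namespace Factor

/-- The canonical linear anti-automorphism of `τ(Z)`: the transposition, combined with the exchange
of the two blocks for type I. -/
def flip : (F : Factor) → F.Tau →ₗ[ℂ] F.Tau
  | rect m n =>
    { toFun := fun x => rectPair (m := m) (n := n) (x 1)ᵀ (x 0)ᵀ
      map_add' := fun x y => by funext i; fin_cases i <;> rfl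
      map_smul' := fun a x => by funext i; fin_cases i <;> rfl }
  | symp _ =>
    { toFun := fun x => fun i => (x i)ᵀ
      map_add' := fun _ _ => rfl
      map_smul' := fun _ _ => rfl }
  | herm _ =>
    { toFun := fun x => fun i => (x i)ᵀ
      map_add' := fun _ _ => rfl
      map_smul' := fun _ _ => rfl }

/-- The permutation of the blocks of `τ(Z)` under `flip`. -/
def swap : (F : Factor) → Fin F.tauBlocks → Fin F.tauBlocks
  | rect _ _ => Fin.rev
  | symp _ => id
  | herm _ => id

/-- The sign by which `flip` acts on `ρ(Z)`. -/
def sign : Factor → ℂ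
  | rect _ _ => 1
  | symp _ => -1
  | herm _ => 1

theorem sign_mul_self (F : Factor) : F.sign * F.sign = 1 := by
  cases F <;> simp [sign]

theorem star_sign (F : Factor) : star F.sign = F.sign := by
  cases F <;> simp [sign]

theorem swap_swap (F : Factor) (i) : F.swap (F.swap i) = i := by
  cases F <;> simp [swap]

theorem flip_rho (F : Factor) (A : F.Elt) : F.flip (F.rho A) = F.sign • F.rho A := by
  match F with
  | rect m n => simp only [sign, one_smul]; funext i; fin_cases i <;> rfl
  | symp n =>
    simp only [sign]
    funext i
    have : A.1ᵀ = -A.1 := A.2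
    change A.1ᵀ = (-1 : ℂ) • A.1
    rw [this, neg_smul, one_smul]
  | herm n =>
    simp only [sign, one_smul]
    funext i
    exact A.2

theorem transpose_triple_product {m n : ℕ} (x y z : Matrix (Fin m) (Fin n) ℂ) :
    (x * yᴴ * z)ᵀ = zᵀ * yᵀᴴ * xᵀ := by
  rw [transpose_mul, transpose_mul, Matrix.mul_assoc]; rfl

theorem flip_triple (F : Factor) (x y z : F.Tau) : F.flip (fun i => x i * (y i)ᴴ * z i) =
    fun i => F.flip z i * (F.flip y i)ᴴ * F.flip x i := by
  match F with
  | rect m n => funext i; fin_cases i <;> exact transpose_triple_product _ _ _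
  | symp n => funext i; exact transpose_triple_product _ _ _
  | herm n => funext i; exact transpose_triple_product _ _ _

theorem trace_transpose_mul {m n : ℕ} (x : Matrix (Fin m) (Fin n) ℂ) :
    trace (xᵀ * xᵀᴴ) = trace (x * xᴴ) := by
  rw [conjTranspose_transpose_comm, ← transpose_mul, trace_transpose, trace_mul_comm]

theorem trace_flip (F : Factor) (x : F.Tau) (i) : trace (F.flip x i * (F.flip x i)ᴴ) =
    trace (x (F.swap i) * (x (F.swap i))ᴴ) := by
  match F with
  | rect m n =>
    match i with
    | 0 => exact trace_transpose_mul _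
    | 1 => exact trace_transpose_mul _
  | symp n => exact trace_transpose_mul _
  | herm n => exact trace_transpose_mul _

end Factor

section Symmetry

variable {Z W : Factor}

/-- The uniqueness of the lift makes it commute with the canonical involutions, up to the signs. -/
theorem IsLift.flip (hZ : Z.IsSource) {φ : Z.Elt →ₗ[ℂ] W.Elt} (hφ : IsJBHom φ)
    {Φ : Z.Tau →ₗ[ℂ] W.Tau} (hΦ : IsLift φ Φ) (x : Z.Tau) :
    Φ x = (Z.sign * W.sign) • W.flip (Φ (Z.flip x)) := by
  have h : IsLift φ ((Z.sign * W.sign) • (W.flip.comp (Φ.comp Z.flip))) := by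
    constructor
    · intro x y z
      simp only [LinearMap.smul_apply, LinearMap.comp_apply, flip_triple]
      rw [hΦ.1, flip_triple]
      funext j
      have hs : Z.sign * W.sign =
          (Z.sign * W.sign) * star (Z.sign * W.sign) * (Z.sign * W.sign) := by
        rw [star_mul, star_sign, star_sign]
        linear_combination (-Z.sign * W.sign * Z.sign * Z.sign) * W.sign_mul_self
          - Z.sign * W.sign * Z.sign_mul_self
      simp only [Pi.smul_apply, conjTranspose_smul, Matrix.smul_mul, Matrix.mul_smul, smul_smul]
      congr 1
      rw [← mul_assoc]
      exact hs
    · intro A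
      simp only [LinearMap.smul_apply, LinearMap.comp_apply, flip_rho, map_smul, hΦ.2, smul_smul]
      rw [show Z.sign * W.sign * (Z.sign * W.sign) = 1 by
        linear_combination (W.sign * W.sign) * Z.sign_mul_self + W.sign_mul_self, one_smul]
  exact LinearMap.congr_fun ((existsUnique_lift hZ hφ).unique hΦ h) x

/-- Both canonical involutions preserve Hilbert–Schmidt norms up to the exchange of the blocks, so
the multiplicity matrix is symmetric under that exchange. -/
theorem HasMultiplicity.swap (hZ : Z.IsSource) {φ : Z.Elt →ₗ[ℂ] W.Elt} (hφ : IsJBHom φ) {α}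
    (h : HasMultiplicity φ α) (j i) : α (W.swap j) (Z.swap i) = α j i := by
  obtain ⟨Φ, hΦ, -⟩ := existsUnique_lift hZ hφ
  rw [hasMultiplicity_iff hZ hφ hΦ] at h
  have h' : HasTraceMultiplicity Φ (α.submatrix W.swap Z.swap) := by
    intro x j
    have h1 := h (Z.flip x) (W.swap j)
    rw [hΦ.flip hZ hφ x]
    have hs : star (Z.sign * W.sign) * (Z.sign * W.sign) = 1 := by
      rw [star_mul, star_sign, star_sign]
      linear_combination (W.sign * W.sign) * Z.sign_mul_self + W.sign_mul_self
    have key : ∀ (c : ℂ) (y : W.Tau), star c * c = 1 →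
        trace ((c • y) j * ((c • y) j)ᴴ) = trace (y j * (y j)ᴴ) := by
      intro c y hc
      rw [Pi.smul_apply, conjTranspose_smul, Matrix.smul_mul, Matrix.mul_smul, smul_smul,
        mul_comm c, hc, one_smul]
    rw [key _ _ hs, trace_flip, h1]
    refine (Equiv.sum_comp (Function.Involutive.toPerm _ Z.swap_swap) _).symm.trans ?_
    refine Finset.sum_congr rfl fun i _ => ?_
    rw [trace_flip]
    have h2 := congrArg (fun i => trace (x i * (x i)ᴴ)) (Z.swap_swap i)
    exact congrArg (fun t => (α (W.swap j) (Z.swap i) : ℂ) * t) h2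
  exact congrFun (congrFun (h'.unique hZ.tauRows_pos hZ.tauCols_pos h) j) i

end Symmetry

/-! ### Skew-symmetric partial isometries -/

section Parity

/-- A skew-symmetric partial isometry has even rank: it is given by a unitary skew-symmetric matrix
on its initial space. -/
theorem even_of_transpose_eq_neg {n α : ℕ} {a : Matrix (Fin n) (Fin n) ℂ} (ha : a * aᴴ * a = a)
    (ht : aᵀ = -a) (hα : trace (a * aᴴ) = α) : Even α := by
  obtain ⟨β, W, hW, hW'⟩ := exists_isometry_of_projection (Q := aᴴ * a) (by simp)
    (by rw [Matrix.mul_assoc, ← Matrix.mul_assoc a, ha])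
  have hαβ : α = β := by
    have h1 : trace (W * Wᴴ) = β := by rw [trace_mul_comm, hW, trace_one, Fintype.card_fin]
    rw [hW', trace_mul_comm, hα] at h1
    exact_mod_cast h1
  subst hαβ
  have ht' : aᴴᵀ = -aᴴ := by rw [← conjTranspose_transpose_comm, ht, conjTranspose_neg]
  have h2 : Wᵀᴴ * Wᵀ = a * aᴴ := by
    have := congrArg transpose hW'
    rw [transpose_mul, transpose_mul, ht, ht'] at this
    rw [conjTranspose_transpose_comm, this]
    simp
  -- as `aᵀ = -a`, the final space of `a` is the complex conjugate of the initial one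
  have h3 : (Wᵀ * a * W)ᴴ * (Wᵀ * a * W) = 1 := by
    calc (Wᵀ * a * W)ᴴ * (Wᵀ * a * W) = Wᴴ * aᴴ * (Wᵀᴴ * Wᵀ) * a * W := by
          simp only [conjTranspose_mul, Matrix.mul_assoc]
      _ = Wᴴ * (aᴴ * (a * aᴴ * a)) * W := by rw [h2]; simp only [Matrix.mul_assoc]
      _ = 1 := by rw [ha, ← hW', ← Matrix.mul_assoc, hW, Matrix.one_mul, hW]
  have h4 : (Wᵀ * a * W)ᵀ = -(Wᵀ * a * W) := by
    rw [transpose_mul, transpose_mul, transpose_transpose, ht]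
    simp [Matrix.mul_assoc]
  have h5 := congrArg det h4
  rw [det_transpose, det_neg, Fintype.card_fin] at h5
  have h6 : det (Wᵀ * a * W) ≠ 0 := by
    intro h
    have := congrArg det h3
    rw [det_mul, h, mul_zero, det_one] at this
    exact zero_ne_one this
  by_contra hodd
  rw [Nat.not_even_iff_odd] at hodd
  rw [hodd.neg_one_pow, neg_one_mul] at h5
  exact h6 (self_eq_neg.1 h5)

end Parity

/-! ### The standard morphisms -/

namespace Factor

/-- The matrices `X` and `Y` such that `x` is `X ⊕ Y` for type I, and `x = X = ± Y` for the types
II and III. The sign makes `ρ(A)` correspond to `A` and `Aᵀ`. -/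
def pair : (F : Factor) →
    F.Tau →ₗ[ℂ] Matrix (Fin F.rows) (Fin F.cols) ℂ × Matrix (Fin F.cols) (Fin F.rows) ℂ
  | rect _ _ =>
    { toFun := fun x => (x 0, x 1)
      map_add' := fun _ _ => rfl
      map_smul' := fun _ _ => rfl }
  | symp _ =>
    { toFun := fun x => (x 0, -x 0)
      map_add' := fun _ _ => Prod.ext rfl (neg_add _ _)
      map_smul' := fun a x => Prod.ext rfl (smul_neg a (x 0)).symm }
  | herm _ =>
    { toFun := fun x => (x 0, x 0)
      map_add' := fun _ _ => rfl
      map_smul' := fun _ _ => rfl }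

theorem pair_rho (F : Factor) (A : F.Elt) : F.pair (F.rho A) = (A.1, A.1ᵀ) := by
  match F with
  | rect m n => rfl
  | symp n => exact Prod.ext rfl (show -A.1 = A.1ᵀ from (show A.1ᵀ = -A.1 from A.2).symm)
  | herm n => exact Prod.ext rfl (show A.1 = A.1ᵀ from (show A.1ᵀ = A.1 from A.2).symm)

theorem pair_triple (F : Factor) (x y z : F.Tau) : F.pair (fun i => x i * (y i)ᴴ * z i) =
    ((F.pair x).1 * (F.pair y).1ᴴ * (F.pair z).1,
      (F.pair x).2 * (F.pair y).2ᴴ * (F.pair z).2) := by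
  match F with
  | rect m n => rfl
  | symp n =>
    refine Prod.ext rfl (show -(x 0 * (y 0)ᴴ * z 0) = -x 0 * (-y 0)ᴴ * -z 0 from ?_)
    simp
  | herm n => rfl

/-- The block of `τ(F)` in which the first component of `pair` lies. -/
def base : (F : Factor) → Fin F.tauBlocks
  | rect _ _ => 0
  | symp _ => 0
  | herm _ => 0

theorem eq_base_or (F : Factor) (j) : j = F.base ∨ F.swap j = F.base := by
  match F with
  | rect m n =>
    match j with
    | 0 => exact Or.inl rfl
    | 1 => exact Or.inr rfl
  | symp n => exact Or.inl (Subsingleton.elim (α := Fin 1) _ _)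
  | herm n => exact Or.inl (Subsingleton.elim (α := Fin 1) _ _)

theorem trace_pair_fst (F : Factor) (x : F.Tau) : trace ((F.pair x).1 * (F.pair x).1ᴴ) =
    trace (x F.base * (x F.base)ᴴ) := by
  match F with
  | rect m n => rfl
  | symp n => rfl
  | herm n => rfl

/-- The multiplicities, in the blocks of `τ(F)`, of a sum of `k` copies of the first and `l` copies
of the second component of `pair`. -/
def weight : (F : Factor) → ℕ → ℕ → Fin F.tauBlocks → ℕ
  | rect _ _, k, l => ![k, l]
  | symp _, k, l => fun _ => k + l
  | herm _, k, l => fun _ => k + l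

theorem sum_weight (F : Factor) (k l : ℕ) (x : F.Tau) :
    ∑ i, (F.weight k l i : ℂ) * trace (x i * (x i)ᴴ) =
      k * trace ((F.pair x).1 * (F.pair x).1ᴴ) + l * trace ((F.pair x).2 * (F.pair x).2ᴴ) := by
  match F with
  | rect m n =>
    exact Fin.sum_univ_two
      (fun i : Fin 2 => ((rect m n).weight k l i : ℂ) * trace (x i * (x i)ᴴ))
  | symp n =>
    refine (Fin.sum_univ_one _).trans ?_
    change ((k + l : ℕ) : ℂ) * trace (x 0 * (x 0)ᴴ) =
      k * trace (x 0 * (x 0)ᴴ) + l * trace (-x 0 * (-x 0)ᴴ)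
    simp [add_mul]
  | herm n =>
    refine (Fin.sum_univ_one _).trans ?_
    change ((k + l : ℕ) : ℂ) * trace (x 0 * (x 0)ᴴ) =
      k * trace (x 0 * (x 0)ᴴ) + l * trace (x 0 * (x 0)ᴴ)
    simp [add_mul]

end Factor

/-- A linear map on pairs of matrices that preserves the ternary product and consists, as far as
Hilbert–Schmidt norms can tell, of `k` copies of the first and `l` copies of the second
argument. -/
structure IsForm {m n M N : ℕ} (k l : ℕ)
    (F : Matrix (Fin m) (Fin n) ℂ → Matrix (Fin n) (Fin m) ℂ → Matrix (Fin M) (Fin N) ℂ) :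
    Prop where
  map_add : ∀ X Y X' Y', F (X + X') (Y + Y') = F X Y + F X' Y'
  map_smul : ∀ (a : ℂ) X Y, F (a • X) (a • Y) = a • F X Y
  map_triple : ∀ X Y X' Y' X'' Y'', F (X * X'ᴴ * X'') (Y * Y'ᴴ * Y'') =
    F X Y * (F X' Y')ᴴ * F X'' Y''
  trace_eq : ∀ X Y, trace (F X Y * (F X Y)ᴴ) = k * trace (X * Xᴴ) + l * trace (Y * Yᴴ)

section Forms

variable {Z W : Factor}

/-- If `A ↦ F A Aᵀ` maps `Z` into `W`, then it is a JB*-morphism, and the block of its multiplicity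
matrix determined by `F`, together with the symmetry of that matrix, gives the whole matrix. -/
theorem IsForm.exists_hom (hZ : Z.IsSource) {k l : ℕ}
    {F : Matrix (Fin Z.rows) (Fin Z.cols) ℂ → Matrix (Fin Z.cols) (Fin Z.rows) ℂ →
      Matrix (Fin W.rows) (Fin W.cols) ℂ} (hF : IsForm k l F)
    (hmem : ∀ A : Z.Elt, F A.1 A.1ᵀ ∈ W.carrier)
    {α : Matrix (Fin W.tauBlocks) (Fin Z.tauBlocks) ℕ}
    (hα : ∀ j i, α (W.swap j) (Z.swap i) = α j i) (h0 : α W.base = Z.weight k l) :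
    ∃ ψ : Z.Elt →ₗ[ℂ] W.Elt, IsJBHom ψ ∧ (∀ A, (ψ A).1 = F A.1 A.1ᵀ) ∧ HasMultiplicity ψ α := by
  let ψ : Z.Elt →ₗ[ℂ] W.Elt :=
    { toFun := fun A => ⟨F A.1 A.1ᵀ, hmem A⟩
      map_add' := fun A A' => Subtype.ext (hF.map_add _ _ _ _)
      map_smul' := fun a A => Subtype.ext (hF.map_smul _ _ _) }
  have hψ : IsJBHom ψ := by
    intro a b c
    refine Subtype.ext ?_
    change F (triple a.1 b.1 c.1) (triple a.1 b.1 c.1)ᵀ =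
      triple (F a.1 a.1ᵀ) (F b.1 b.1ᵀ) (F c.1 c.1ᵀ)
    rw [transpose_triple_rect]
    simp only [triple, hF.map_smul, hF.map_add, hF.map_triple]
  refine ⟨ψ, hψ, fun _ => rfl, ?_⟩
  obtain ⟨Φ, hΦ, -⟩ := existsUnique_lift hZ hψ
  obtain ⟨β, hβ, -⟩ := existsUnique_multiplicity hZ hψ
  have hβ' := (hasMultiplicity_iff hZ hψ hΦ).1 hβ
  let F' : Z.Tau →ₗ[ℂ] Matrix (Fin W.rows) (Fin W.cols) ℂ :=
    { toFun := fun x => F (Z.pair x).1 (Z.pair x).2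
      map_add' := fun x y => by rw [_root_.map_add]; exact hF.map_add _ _ _ _
      map_smul' := fun a x => by rw [_root_.map_smul]; exact hF.map_smul _ _ _ }
  -- the lift agrees with `F` in the base block, since both extend `ψ` to `τ(Z)`
  have h1 : (LinearMap.fst ℂ _ _).comp (W.pair.comp Φ) = F' := by
    refine tau_hom_ext hZ (fun a b c => a * bᴴ * c) (fun x y z => ?_) (fun x y z => ?_) fun A => ?_
    · change (W.pair (Φ _)).1 = _
      rw [hΦ.1, pair_triple]
      rfl
    · change F (Z.pair _).1 (Z.pair _).2 = _
      rw [pair_triple]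
      exact hF.map_triple _ _ _ _ _ _
    · change (W.pair (Φ _)).1 = F (Z.pair _).1 (Z.pair _).2
      rw [hΦ.2, pair_rho, pair_rho]
      rfl
  have h2 : β W.base = Z.weight k l := by
    refine trace_weights_unique hZ.tauRows_pos hZ.tauCols_pos fun x => ?_
    rw [sum_weight, ← hF.trace_eq, ← hβ' x, ← trace_pair_fst]
    rw [show (W.pair (Φ x)).1 = F (Z.pair x).1 (Z.pair x).2 from LinearMap.congr_fun h1 x]
  have h3 : β = α := by
    ext j i
    rcases W.eq_base_or j with rfl | hj
    · rw [h2, h0]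
    · rw [← hα, ← hβ.swap hZ hψ, hj, h2, h0]
  exact h3 ▸ hβ

end Forms

section Copies

variable {k m n p : ℕ}

theorem diagCopies_add (X Y : Matrix (Fin m) (Fin n) ℂ) :
    diagCopies k (X + Y) = diagCopies k X + diagCopies k Y :=
  blockDiagonal_add (fun _ => X) (fun _ => Y)

theorem diagCopies_smul (a : ℂ) (X : Matrix (Fin m) (Fin n) ℂ) :
    diagCopies k (a • X) = a • diagCopies k X :=
  blockDiagonal_smul a (fun _ => X)

theorem diagCopies_conjTranspose (X : Matrix (Fin m) (Fin n) ℂ) :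
    (diagCopies k X)ᴴ = diagCopies k Xᴴ :=
  blockDiagonal_conjTranspose (fun _ => X)

theorem diagCopies_transpose (X : Matrix (Fin m) (Fin n) ℂ) :
    (diagCopies k X)ᵀ = diagCopies k Xᵀ :=
  blockDiagonal_transpose (fun _ => X)

theorem diagCopies_mul (X : Matrix (Fin m) (Fin n) ℂ) (Y : Matrix (Fin n) (Fin p) ℂ) :
    diagCopies k (X * Y) = diagCopies k X * diagCopies k Y :=
  blockDiagonal_mul (fun _ => X) (fun _ => Y)

theorem trace_diagCopies (X : Matrix (Fin m) (Fin m) ℂ) :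
    trace (diagCopies k X) = k * trace X := by
  simp [diagCopies, trace_blockDiagonal]

theorem adiagCopies_add (X Y : Matrix (Fin m) (Fin n) ℂ) :
    adiagCopies k (X + Y) = adiagCopies k X + adiagCopies k Y := by
  rw [adiagCopies, diagCopies_add]; rfl

theorem adiagCopies_smul (a : ℂ) (X : Matrix (Fin m) (Fin n) ℂ) :
    adiagCopies k (a • X) = a • adiagCopies k X := by
  rw [adiagCopies, diagCopies_smul]; rfl

theorem adiagCopies_transpose (X : Matrix (Fin m) (Fin n) ℂ) :
    (adiagCopies k X)ᵀ = adiagCopies k Xᵀ := by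
  ext ⟨i, a⟩ ⟨j, b⟩
  simp only [adiagCopies, diagCopies, transpose_apply, submatrix_apply, blockDiagonal_apply,
    Prod.map_apply, id]
  exact if_congr (eq_comm.trans Fin.rev_eq_iff) rfl rfl

/-- Reversing the order of the blocks makes the antidiagonal matrices diagonal. -/
theorem adiagCopies_mul_conjTranspose (X : Matrix (Fin m) (Fin n) ℂ)
    (Y : Matrix (Fin p) (Fin n) ℂ) :
    adiagCopies k X * (adiagCopies k Y)ᴴ = diagCopies k (X * Yᴴ) := by
  rw [diagCopies_mul, ← diagCopies_conjTranspose]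
  exact submatrix_mul_equiv (diagCopies k X) (diagCopies k Y)ᴴ id
    ((Equiv.refl (Fin n)).prodCongr Fin.revPerm) id

theorem diagCopies_mul_adiagCopies (X : Matrix (Fin m) (Fin n) ℂ) (Y : Matrix (Fin n) (Fin p) ℂ) :
    diagCopies k X * adiagCopies k Y = adiagCopies k (X * Y) := by
  rw [adiagCopies, adiagCopies, diagCopies_mul]
  rfl

end Copies

section TwoArguments

variable {k l z z' m n M N : ℕ} {ε : ℂ}

/-- The matrix `formA`, with the roles of `A` and `Aᵀ` played by independent matrices. -/
def formA₂ (k l z z' : ℕ) {m n M N : ℕ} (h : k * m + z + l * n = M) (h' : k * n + z' + l * m = N)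
    (X : Matrix (Fin m) (Fin n) ℂ) (Y : Matrix (Fin n) (Fin m) ℂ) : Matrix (Fin M) (Fin N) ℂ :=
  Matrix.reindex (listBlocks k m z l n h) (listBlocks k n z' l m h')
    (Matrix.fromBlocks (Matrix.fromBlocks (diagCopies k X) 0 0 0) 0 0 (diagCopies l Y))

/-- The matrix `formB`, with the roles of `A` and `Aᵀ` played by independent matrices. -/
def formB₂ (k z z' : ℕ) (ε : ℂ) {m n M N : ℕ} (h : k * m + z + k * n = M)
    (h' : k * m + z' + k * n = N) (X : Matrix (Fin m) (Fin n) ℂ) (Y : Matrix (Fin n) (Fin m) ℂ) :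
    Matrix (Fin M) (Fin N) ℂ :=
  Matrix.reindex (listBlocks k m z k n h) (listBlocks k m z' k n h')
    (Matrix.fromBlocks 0 (Matrix.fromRows (adiagCopies k X) 0)
      (Matrix.fromCols (adiagCopies k (ε • Y)) 0) 0)

theorem reindex_triple {ι κ μ ν : Type*} [Fintype ι] [Fintype κ] [Fintype μ] [Fintype ν]
    (e : ι ≃ μ) (f : κ ≃ ν) (x y z : Matrix ι κ ℂ) :
    reindex e f (x * yᴴ * z) = reindex e f x * (reindex e f y)ᴴ * reindex e f z := by
  simp only [reindex_apply, conjTranspose_submatrix, submatrix_mul_equiv]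

theorem trace_reindex_mul {ι κ μ ν : Type*} [Fintype ι] [Fintype κ] [Fintype μ] [Fintype ν]
    (e : ι ≃ μ) (f : κ ≃ ν) (x : Matrix ι κ ℂ) :
    trace (reindex e f x * (reindex e f x)ᴴ) = trace (x * xᴴ) := by
  simp only [reindex_apply, conjTranspose_submatrix, submatrix_mul_equiv]
  exact Equiv.sum_comp e.symm (fun i => (x * xᴴ) i i)

theorem trace_fromBlocks_eq {ι κ : Type*} [Fintype ι] [Fintype κ] (a : Matrix ι ι ℂ)
    (b : Matrix ι κ ℂ) (c : Matrix κ ι ℂ) (d : Matrix κ κ ℂ) :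
    trace (fromBlocks a b c d) = trace a + trace d := by
  simp [trace]

theorem isForm_formA₂ (h : k * m + z + l * n = M) (h' : k * n + z' + l * m = N) :
    IsForm k l (formA₂ k l z z' h h') where
  map_add X Y X' Y' := by
    simp only [formA₂, diagCopies_add]
    rw [show fromBlocks (fromBlocks (diagCopies k X + diagCopies k X') 0 0 0) 0 0
        (diagCopies l Y + diagCopies l Y') =
          fromBlocks (fromBlocks (diagCopies k X) 0 0 (0 : Matrix (Fin z) (Fin z') ℂ)) 0 0
            (diagCopies l Y) + fromBlocks (fromBlocks (diagCopies k X') 0 0 0) 0 0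
            (diagCopies l Y') by simp [fromBlocks_add]]
    rfl
  map_smul a X Y := by
    simp only [formA₂, diagCopies_smul]
    rw [show fromBlocks (fromBlocks (a • diagCopies k X) 0 0 0) 0 0 (a • diagCopies l Y) =
          a • fromBlocks (fromBlocks (diagCopies k X) 0 0 (0 : Matrix (Fin z) (Fin z') ℂ)) 0 0
            (diagCopies l Y) by simp [fromBlocks_smul]]
    rfl
  map_triple X Y X' Y' X'' Y'' := by
    simp only [formA₂, ← reindex_triple]
    congr 1
    simp [fromBlocks_conjTranspose, fromBlocks_multiply, diagCopies_mul, diagCopies_conjTranspose]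
  trace_eq X Y := by
    rw [formA₂, trace_reindex_mul]
    simp [fromBlocks_conjTranspose, fromBlocks_multiply, diagCopies_conjTranspose,
      ← diagCopies_mul, trace_fromBlocks_eq, trace_diagCopies]

theorem isForm_formB₂ (hε : ε * star ε = 1) (h : k * m + z + k * n = M)
    (h' : k * m + z' + k * n = N) : IsForm k k (formB₂ k z z' ε h h') where
  map_add X Y X' Y' := by
    simp only [formB₂, adiagCopies_add, smul_add]
    rw [show fromBlocks 0 (fromRows (adiagCopies k X + adiagCopies k X') 0)
        (fromCols (adiagCopies k (ε • Y) + adiagCopies k (ε • Y')) 0) 0 =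
          fromBlocks (0 : Matrix (_ ⊕ Fin z) (_ ⊕ Fin z') ℂ) (fromRows (adiagCopies k X) 0)
            (fromCols (adiagCopies k (ε • Y)) 0) 0 +
          fromBlocks 0 (fromRows (adiagCopies k X') 0)
            (fromCols (adiagCopies k (ε • Y')) 0) 0 by
        simp only [fromBlocks_add, add_zero]
        congr 1
        · ext (i | i) j <;> simp
        · ext i (j | j) <;> simp]
    rfl
  map_smul a X Y := by
    simp only [formB₂, smul_comm ε a, adiagCopies_smul _ X, adiagCopies_smul a]
    rw [show fromBlocks 0 (fromRows (a • adiagCopies k X) 0)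
        (fromCols (a • adiagCopies k (ε • Y)) 0) 0 =
          a • fromBlocks (0 : Matrix (_ ⊕ Fin z) (_ ⊕ Fin z') ℂ) (fromRows (adiagCopies k X) 0)
            (fromCols (adiagCopies k (ε • Y)) 0) 0 by
        simp only [fromBlocks_smul, smul_zero]
        congr 1
        · ext (i | i) j <;> simp
        · ext i (j | j) <;> simp]
    rfl
  map_triple X Y X' Y' X'' Y'' := by
    simp only [formB₂, ← reindex_triple]
    congr 1
    have h1 : ε • (Y * Y'ᴴ * Y'') = (ε • Y) * (ε • Y')ᴴ * (ε • Y'') := by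
      simp only [conjTranspose_smul, Matrix.smul_mul, Matrix.mul_smul, smul_smul]
      rw [← mul_assoc, hε, one_mul]
    rw [h1]
    simp [fromBlocks_conjTranspose, fromBlocks_multiply,
      conjTranspose_fromRows_eq_fromCols_conjTranspose,
      conjTranspose_fromCols_eq_fromRows_conjTranspose, fromRows_mul, fromCols_mul_fromRows,
      mul_fromCols, adiagCopies_mul_conjTranspose,
      diagCopies_mul_adiagCopies]
  trace_eq X Y := by
    rw [formB₂, trace_reindex_mul]
    have h1 : trace ((ε • Y) * (ε • Y)ᴴ) = trace (Y * Yᴴ) := by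
      rw [conjTranspose_smul, Matrix.smul_mul, Matrix.mul_smul, smul_smul, hε, one_smul]
    have h2 : ∀ A : Matrix (Fin m × Fin k) (Fin m × Fin k) ℂ, trace (fromCols
        (fromRows A (0 : Matrix (Fin z) _ ℂ)) (0 : Matrix _ (Fin z) ℂ)) = trace A :=
      fun A => by simp [trace]
    simp [fromBlocks_conjTranspose, fromBlocks_multiply, fromCols_mul_fromRows,
      conjTranspose_fromRows_eq_fromCols_conjTranspose,
      conjTranspose_fromCols_eq_fromRows_conjTranspose, adiagCopies_mul_conjTranspose,
      trace_fromBlocks_eq, trace_diagCopies, h2, -conjTranspose_smul, -Matrix.smul_mul, h1]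

/-- With `l = 0` and zero blocks of the same size on both sides the form commutes with the
transposition. -/
theorem formA₂_transpose (h : k * n + z + 0 * n = M) (A B : Matrix (Fin n) (Fin n) ℂ) :
    (formA₂ k 0 z z h h A B)ᵀ = formA₂ k 0 z z h h Aᵀ Bᵀ := by
  simp only [formA₂, reindex_apply, transpose_submatrix, fromBlocks_transpose, transpose_zero,
    diagCopies_transpose]

theorem formB₂_transpose (hε : ε * ε = 1) (hε' : ε * star ε = 1) (h : k * m + z + k * n = M)
    (A : Matrix (Fin m) (Fin n) ℂ) :
    (formB₂ k z z ε h h A Aᵀ)ᵀ = ε • formB₂ k z z ε h h A Aᵀ := by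
  rw [← (isForm_formB₂ (hε') h h).map_smul]
  simp only [formB₂, reindex_apply, transpose_submatrix, fromBlocks_transpose, transpose_zero,
    adiagCopies_transpose, transpose_fromRows, transpose_fromCols]
  simp [smul_smul, hε]

end TwoArguments

/-! ### The classification of the morphisms -/

section Classification

variable {Z W : Factor}

/-- The morphism `A ↦ formA k l A` from `Z` to `W` exists and has multiplicity matrix `α`. -/
def FormAOccurs (Z W : Factor) (k l : ℕ) (α : Matrix (Fin W.tauBlocks) (Fin Z.tauBlocks) ℕ) :
    Prop :=
  ∃ (ψ : Z.Elt →ₗ[ℂ] W.Elt) (z z' : ℕ) (h : k * Z.rows + z + l * Z.cols = W.rows)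
    (h' : k * Z.cols + z' + l * Z.rows = W.cols),
    IsJBHom ψ ∧ (∀ A, (ψ A).1 = formA k l z z' h h' A.1) ∧ HasMultiplicity ψ α

/-- The morphism `A ↦ formB k ε A` from `Z` to `W` exists and has multiplicity matrix `α`. -/
def FormBOccurs (Z W : Factor) (k : ℕ) (ε : ℂ)
    (α : Matrix (Fin W.tauBlocks) (Fin Z.tauBlocks) ℕ) : Prop :=
  ∃ (ψ : Z.Elt →ₗ[ℂ] W.Elt) (z z' : ℕ) (h : k * Z.rows + z + k * Z.cols = W.rows)
    (h' : k * Z.rows + z' + k * Z.cols = W.cols),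
    IsJBHom ψ ∧ (∀ A, (ψ A).1 = formB k z z' ε h h' A.1) ∧ HasMultiplicity ψ α

theorem FormAOccurs.occurs (hZ : Z.IsSource) {k l : ℕ} {α} (h : FormAOccurs Z W k l α)
    (hα : α ≠ 0) : Occurs Z W α := by
  obtain ⟨ψ, -, -, -, -, hψ, -, hm⟩ := h
  exact ⟨ψ, hψ, (hm.ne_zero hZ hψ).1 hα, hm⟩

theorem FormBOccurs.occurs (hZ : Z.IsSource) {k : ℕ} {ε : ℂ} {α} (h : FormBOccurs Z W k ε α)
    (hα : α ≠ 0) : Occurs Z W α := by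
  obtain ⟨ψ, -, -, -, -, hψ, -, hm⟩ := h
  exact ⟨ψ, hψ, (hm.ne_zero hZ hψ).1 hα, hm⟩

theorem FormAOccurs.classA (hZ : Z.IsSource) {k l : ℕ} {α} (h : FormAOccurs Z W k l α)
    {φ : Z.Elt →ₗ[ℂ] W.Elt} (hφ : IsJBHom φ) (hα : HasMultiplicity φ α) : ClassA k l φ := by
  obtain ⟨ψ, z, z', h, h', hψ, hf, hm⟩ := h
  exact ⟨ψ, z, z', h, h', hψ, hf, unitarilyEquivalent_of_hasMultiplicity hZ hφ hψ hα hm⟩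

theorem FormBOccurs.classB (hZ : Z.IsSource) {k : ℕ} {ε : ℂ} {α} (h : FormBOccurs Z W k ε α)
    {φ : Z.Elt →ₗ[ℂ] W.Elt} (hφ : IsJBHom φ) (hα : HasMultiplicity φ α) : ClassB k ε φ := by
  obtain ⟨ψ, z, z', h, h', hψ, hf, hm⟩ := h
  exact ⟨ψ, z, z', h, h', hψ, hf, unitarilyEquivalent_of_hasMultiplicity hZ hφ hψ hα hm⟩

theorem formAOccurs_rect (hZ : Z.IsSource) {k l M N : ℕ} (h : k * Z.rows + l * Z.cols ≤ M)
    (h' : k * Z.cols + l * Z.rows ≤ N)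
    {α : Matrix (Fin (rect M N).tauBlocks) (Fin Z.tauBlocks) ℕ}
    (hα : ∀ j i, α ((rect M N).swap j) (Z.swap i) = α j i)
    (h0 : α (rect M N).base = Z.weight k l) : FormAOccurs Z (rect M N) k l α := by
  have h1 : k * Z.rows + (M - (k * Z.rows + l * Z.cols)) + l * Z.cols = M := by omega
  have h2 : k * Z.cols + (N - (k * Z.cols + l * Z.rows)) + l * Z.rows = N := by omega
  obtain ⟨ψ, hψ, hf, hm⟩ := (isForm_formA₂ h1 h2).exists_hom (W := rect M N) hZ
    (fun _ => Submodule.mem_top) hα h0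
  exact ⟨ψ, _, _, h1, h2, hψ, hf, hm⟩

theorem formAOccurs_symp {n N k : ℕ} (hZ : (symp n).IsSource) (h : k * n ≤ N) :
    FormAOccurs (symp n) (symp N) k 0 !![k] := by
  have h1 : k * n + (N - k * n) + 0 * n = N := by omega
  obtain ⟨ψ, hψ, hf, hm⟩ := (isForm_formA₂ h1 h1).exists_hom (Z := symp n) (W := symp N) hZ
    (fun A => by
      have hA : A.1ᵀ = -A.1 := A.2
      change (formA₂ k 0 _ _ h1 h1 A.1 A.1ᵀ)ᵀ = -(formA₂ k 0 _ _ h1 h1 A.1 A.1ᵀ)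
      have h2 := (isForm_formA₂ (l := 0) h1 h1).map_smul (-1) A.1 A.1ᵀ
      rw [neg_one_smul, neg_one_smul, neg_one_smul] at h2
      rw [formA₂_transpose, ← h2, hA, transpose_neg, hA]) (α := !![k])
    (fun j i => rfl) (by funext i; fin_cases i; rfl)
  exact ⟨ψ, _, _, h1, h1, hψ, hf, hm⟩

theorem formAOccurs_herm {n N k : ℕ} (hZ : (herm n).IsSource) (h : k * n ≤ N) :
    FormAOccurs (herm n) (herm N) k 0 !![k] := by
  have h1 : k * n + (N - k * n) + 0 * n = N := by omega
  obtain ⟨ψ, hψ, hf, hm⟩ := (isForm_formA₂ h1 h1).exists_hom (Z := herm n) (W := herm N) hZ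
    (fun A => by
      have hA : A.1ᵀ = A.1 := A.2
      change (formA₂ k 0 _ _ h1 h1 A.1 A.1ᵀ)ᵀ = formA₂ k 0 _ _ h1 h1 A.1 A.1ᵀ
      rw [formA₂_transpose, hA, hA]) (α := !![k])
    (fun j i => rfl) (by funext i; fin_cases i; rfl)
  exact ⟨ψ, _, _, h1, h1, hψ, hf, hm⟩

theorem formBOccurs_symp (hZ : Z.IsSource) {k N : ℕ} (h : k * Z.rows + k * Z.cols ≤ N)
    {α : Matrix (Fin (symp N).tauBlocks) (Fin Z.tauBlocks) ℕ}
    (hα : ∀ j i, α ((symp N).swap j) (Z.swap i) = α j i)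
    (h0 : α (symp N).base = Z.weight k k) : FormBOccurs Z (symp N) k (-1) α := by
  have h1 : k * Z.rows + (N - (k * Z.rows + k * Z.cols)) + k * Z.cols = N := by omega
  obtain ⟨ψ, hψ, hf, hm⟩ := (isForm_formB₂ (ε := -1) (by simp) h1 h1).exists_hom (W := symp N) hZ
    (fun A => (formB₂_transpose (by simp) (by simp) h1 A.1).trans (neg_one_smul _ _)) hα h0
  exact ⟨ψ, _, _, h1, h1, hψ, hf, hm⟩

theorem formBOccurs_herm (hZ : Z.IsSource) {k N : ℕ} (h : k * Z.rows + k * Z.cols ≤ N)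
    {α : Matrix (Fin (herm N).tauBlocks) (Fin Z.tauBlocks) ℕ}
    (hα : ∀ j i, α ((herm N).swap j) (Z.swap i) = α j i)
    (h0 : α (herm N).base = Z.weight k k) : FormBOccurs Z (herm N) k 1 α := by
  have h1 : k * Z.rows + (N - (k * Z.rows + k * Z.cols)) + k * Z.cols = N := by omega
  obtain ⟨ψ, hψ, hf, hm⟩ := (isForm_formB₂ (ε := 1) (by simp) h1 h1).exists_hom (W := herm N) hZ
    (fun A => (formB₂_transpose (by simp) (by simp) h1 A.1).trans (one_smul _ _)) hα h0
  exact ⟨ψ, _, _, h1, h1, hψ, hf, hm⟩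

theorem morphism_rect_rect {m n M N : ℕ} (hZ : (rect m n).IsSource) :
    (∀ φ : (rect m n).Elt →ₗ[ℂ] (rect M N).Elt, IsJBHom φ → φ ≠ 0 →
      ∃ α β : ℕ, 1 ≤ α + β ∧ α * m + β * n ≤ M ∧ α * n + β * m ≤ N ∧
        ClassA α β φ ∧ HasMultiplicity φ !![α, β; β, α]) ∧
    (∀ α β : ℕ, 1 ≤ α + β → α * m + β * n ≤ M → α * n + β * m ≤ N →
      Occurs (rect m n) (rect M N) !![α, β; β, α]) := by
  have key : ∀ α β : ℕ, α * m + β * n ≤ M → α * n + β * m ≤ N →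
      FormAOccurs (rect m n) (rect M N) α β !![α, β; β, α] := fun α β h h' =>
    formAOccurs_rect hZ h h' (fun j i => by fin_cases j <;> fin_cases i <;> rfl)
      (by funext i; fin_cases i <;> rfl)
  have hne : ∀ α β : ℕ, 1 ≤ α + β ↔ !![α, β; β, α] ≠ 0 := fun α β => by
    rw [Nat.one_le_iff_ne_zero, not_iff_not]
    simp [← Matrix.ext_iff, Fin.forall_fin_two]
    tauto
  refine ⟨fun φ hφ h0 => ?_, fun α β h1 h2 h3 => (key α β h2 h3).occurs hZ ((hne _ _).1 h1)⟩
  obtain ⟨α, hα, -⟩ := existsUnique_multiplicity hZ hφ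
  change Matrix (Fin 2) (Fin 2) ℕ at α
  have hshape : α = !![α 0 0, α 0 1; α 0 1, α 0 0] := by
    ext j i
    fin_cases j <;> fin_cases i
    · rfl
    · rfl
    · exact hα.swap hZ hφ 0 1
    · exact hα.swap hZ hφ 0 0
  have hb := hα.sum_le hZ hφ 0
  have h1 : m * α 0 0 + n * α 0 1 ≤ M :=
    (Fin.sum_univ_two (fun i : Fin 2 => ![m, n] i * α 0 i)).symm.trans_le hb.1
  have h2 : n * α 0 0 + m * α 0 1 ≤ N :=
    (Fin.sum_univ_two (fun i : Fin 2 => ![n, m] i * α 0 i)).symm.trans_le hb.2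
  rw [mul_comm, mul_comm n] at h1
  rw [mul_comm, mul_comm m] at h2
  have hα' : HasMultiplicity φ !![α 0 0, α 0 1; α 0 1, α 0 0] := by rw [← hshape]; exact hα
  exact ⟨α 0 0, α 0 1, (hne _ _).2 ((hα'.ne_zero hZ hφ).2 h0), h1, h2,
    (key _ _ h1 h2).classA hZ hφ hα', hα'⟩

theorem morphism_rect_symp {m n N : ℕ} (hZ : (rect m n).IsSource) :
    (∀ φ : (rect m n).Elt →ₗ[ℂ] (symp N).Elt, IsJBHom φ → φ ≠ 0 →
      ∃ α : ℕ, 1 ≤ α ∧ α * (m + n) ≤ N ∧ ClassB α (-1) φ ∧ HasMultiplicity φ !![α, α]) ∧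
    (∀ α : ℕ, 1 ≤ α → α * (m + n) ≤ N → Occurs (rect m n) (symp N) !![α, α]) := by
  have key : ∀ α : ℕ, α * (m + n) ≤ N → FormBOccurs (rect m n) (symp N) α (-1) !![α, α] :=
    fun α h => formBOccurs_symp hZ ((mul_add α m n).symm.trans_le h)
      (fun j i => by fin_cases j; fin_cases i <;> rfl) (by funext i; fin_cases i <;> rfl)
  have hne : ∀ α : ℕ, 1 ≤ α ↔ !![α, α] ≠ 0 := fun α => by
    rw [Nat.one_le_iff_ne_zero, not_iff_not]
    simp [← Matrix.ext_iff, Fin.forall_fin_two]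
  refine ⟨fun φ hφ h0 => ?_, fun α h1 h2 => (key α h2).occurs hZ ((hne _).1 h1)⟩
  obtain ⟨α, hα, -⟩ := existsUnique_multiplicity hZ hφ
  change Matrix (Fin 1) (Fin 2) ℕ at α
  have hshape : α = !![α 0 0, α 0 0] := by
    ext j i
    fin_cases j; fin_cases i
    · rfl
    · exact hα.swap hZ hφ 0 0
  have hα' : HasMultiplicity φ !![α 0 0, α 0 0] := by rw [← hshape]; exact hα
  have h1 : m * α 0 0 + n * α 0 0 ≤ N :=
    (Fin.sum_univ_two (fun i : Fin 2 => ![m, n] i * !![α 0 0, α 0 0] 0 i)).symm.trans_le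
      (hα'.sum_le hZ hφ 0).1
  rw [← add_mul, mul_comm] at h1
  exact ⟨α 0 0, (hne _).2 ((hα'.ne_zero hZ hφ).2 h0), h1, (key _ h1).classB hZ hφ hα', hα'⟩

theorem morphism_rect_herm {m n N : ℕ} (hZ : (rect m n).IsSource) :
    (∀ φ : (rect m n).Elt →ₗ[ℂ] (herm N).Elt, IsJBHom φ → φ ≠ 0 →
      ∃ α : ℕ, 1 ≤ α ∧ α * (m + n) ≤ N ∧ ClassB α 1 φ ∧ HasMultiplicity φ !![α, α]) ∧
    (∀ α : ℕ, 1 ≤ α → α * (m + n) ≤ N → Occurs (rect m n) (herm N) !![α, α]) := by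
  have key : ∀ α : ℕ, α * (m + n) ≤ N → FormBOccurs (rect m n) (herm N) α 1 !![α, α] :=
    fun α h => formBOccurs_herm hZ ((mul_add α m n).symm.trans_le h)
      (fun j i => by fin_cases j; fin_cases i <;> rfl) (by funext i; fin_cases i <;> rfl)
  have hne : ∀ α : ℕ, 1 ≤ α ↔ !![α, α] ≠ 0 := fun α => by
    rw [Nat.one_le_iff_ne_zero, not_iff_not]
    simp [← Matrix.ext_iff, Fin.forall_fin_two]
  refine ⟨fun φ hφ h0 => ?_, fun α h1 h2 => (key α h2).occurs hZ ((hne _).1 h1)⟩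
  obtain ⟨α, hα, -⟩ := existsUnique_multiplicity hZ hφ
  change Matrix (Fin 1) (Fin 2) ℕ at α
  have hshape : α = !![α 0 0, α 0 0] := by
    ext j i
    fin_cases j; fin_cases i
    · rfl
    · exact hα.swap hZ hφ 0 0
  have hα' : HasMultiplicity φ !![α 0 0, α 0 0] := by rw [← hshape]; exact hα
  have h1 : m * α 0 0 + n * α 0 0 ≤ N :=
    (Fin.sum_univ_two (fun i : Fin 2 => ![m, n] i * !![α 0 0, α 0 0] 0 i)).symm.trans_le
      (hα'.sum_le hZ hφ 0).1
  rw [← add_mul, mul_comm] at h1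
  exact ⟨α 0 0, (hne _).2 ((hα'.ne_zero hZ hφ).2 h0), h1, (key _ h1).classB hZ hφ hα', hα'⟩

theorem morphism_symp_rect {n M N : ℕ} (hZ : (symp n).IsSource) :
    (∀ φ : (symp n).Elt →ₗ[ℂ] (rect M N).Elt, IsJBHom φ → φ ≠ 0 →
      ∃ α : ℕ, 1 ≤ α ∧ α * n ≤ min M N ∧ ClassA α 0 φ ∧ HasMultiplicity φ !![α; α]) ∧
    (∀ α : ℕ, 1 ≤ α → α * n ≤ min M N → Occurs (symp n) (rect M N) !![α; α]) := by
  have key : ∀ α : ℕ, α * n ≤ min M N → FormAOccurs (symp n) (rect M N) α 0 !![α; α] :=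
    fun α h => by
      rw [le_min_iff] at h
      exact formAOccurs_rect hZ (by simpa using h.1) (by simpa using h.2)
        (fun j i => by fin_cases j <;> rfl) (by funext i; fin_cases i; rfl)
  have hne : ∀ α : ℕ, 1 ≤ α ↔ !![α; α] ≠ 0 := fun α => by
    rw [Nat.one_le_iff_ne_zero, not_iff_not]
    simp [← Matrix.ext_iff, Fin.forall_fin_two]
  refine ⟨fun φ hφ h0 => ?_, fun α h1 h2 => (key α h2).occurs hZ ((hne _).1 h1)⟩
  obtain ⟨α, hα, -⟩ := existsUnique_multiplicity hZ hφ
  change Matrix (Fin 2) (Fin 1) ℕ at α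
  have hshape : α = !![α 0 0; α 0 0] := by
    ext j i
    fin_cases i; fin_cases j
    · rfl
    · exact hα.swap hZ hφ 0 0
  have hα' : HasMultiplicity φ !![α 0 0; α 0 0] := by rw [← hshape]; exact hα
  have hb := hα.sum_le hZ hφ 0
  have h1 : n * α 0 0 ≤ M := (Fin.sum_univ_one (fun i : Fin 1 => n * α 0 i)).symm.trans_le hb.1
  have h2 : n * α 0 0 ≤ N := (Fin.sum_univ_one (fun i : Fin 1 => n * α 0 i)).symm.trans_le hb.2
  have h3 : α 0 0 * n ≤ min M N := by rw [mul_comm]; exact le_min h1 h2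
  exact ⟨α 0 0, (hne _).2 ((hα'.ne_zero hZ hφ).2 h0), h3, (key _ h3).classA hZ hφ hα', hα'⟩

theorem morphism_herm_rect {n M N : ℕ} (hZ : (herm n).IsSource) :
    (∀ φ : (herm n).Elt →ₗ[ℂ] (rect M N).Elt, IsJBHom φ → φ ≠ 0 →
      ∃ α : ℕ, 1 ≤ α ∧ α * n ≤ min M N ∧ ClassA α 0 φ ∧ HasMultiplicity φ !![α; α]) ∧
    (∀ α : ℕ, 1 ≤ α → α * n ≤ min M N → Occurs (herm n) (rect M N) !![α; α]) := by
  have key : ∀ α : ℕ, α * n ≤ min M N → FormAOccurs (herm n) (rect M N) α 0 !![α; α] :=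
    fun α h => by
      rw [le_min_iff] at h
      exact formAOccurs_rect hZ (by simpa using h.1) (by simpa using h.2)
        (fun j i => by fin_cases j <;> rfl) (by funext i; fin_cases i; rfl)
  have hne : ∀ α : ℕ, 1 ≤ α ↔ !![α; α] ≠ 0 := fun α => by
    rw [Nat.one_le_iff_ne_zero, not_iff_not]
    simp [← Matrix.ext_iff, Fin.forall_fin_two]
  refine ⟨fun φ hφ h0 => ?_, fun α h1 h2 => (key α h2).occurs hZ ((hne _).1 h1)⟩
  obtain ⟨α, hα, -⟩ := existsUnique_multiplicity hZ hφ
  change Matrix (Fin 2) (Fin 1) ℕ at α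
  have hshape : α = !![α 0 0; α 0 0] := by
    ext j i
    fin_cases i; fin_cases j
    · rfl
    · exact hα.swap hZ hφ 0 0
  have hα' : HasMultiplicity φ !![α 0 0; α 0 0] := by rw [← hshape]; exact hα
  have hb := hα.sum_le hZ hφ 0
  have h1 : n * α 0 0 ≤ M := (Fin.sum_univ_one (fun i : Fin 1 => n * α 0 i)).symm.trans_le hb.1
  have h2 : n * α 0 0 ≤ N := (Fin.sum_univ_one (fun i : Fin 1 => n * α 0 i)).symm.trans_le hb.2
  have h3 : α 0 0 * n ≤ min M N := by rw [mul_comm]; exact le_min h1 h2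
  exact ⟨α 0 0, (hne _).2 ((hα'.ne_zero hZ hφ).2 h0), h3, (key _ h3).classA hZ hφ hα', hα'⟩

theorem one_le_iff_ne_zero_matrix (a : ℕ) : 1 ≤ a ↔ !![a] ≠ 0 := by
  rw [Nat.one_le_iff_ne_zero, not_iff_not]
  simp [← Matrix.ext_iff]

theorem morphism_symp_symp {n N : ℕ} (hZ : (symp n).IsSource) :
    (∀ φ : (symp n).Elt →ₗ[ℂ] (symp N).Elt, IsJBHom φ → φ ≠ 0 →
      ∃ α : ℕ, 1 ≤ α ∧ α * n ≤ N ∧ ClassA α 0 φ ∧ HasMultiplicity φ !![α]) ∧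
    (∀ α : ℕ, 1 ≤ α → α * n ≤ N → Occurs (symp n) (symp N) !![α]) := by
  refine ⟨fun φ hφ h0 => ?_, fun α h1 h2 =>
    (formAOccurs_symp hZ h2).occurs hZ ((one_le_iff_ne_zero_matrix _).1 h1)⟩
  obtain ⟨α, hα, -⟩ := existsUnique_multiplicity hZ hφ
  change Matrix (Fin 1) (Fin 1) ℕ at α
  have hα' : HasMultiplicity φ !![α 0 0] := by
    rw [show !![α 0 0] = α by ext j i; fin_cases j; fin_cases i; rfl]; exact hα
  have h1 : n * α 0 0 ≤ N :=
    (Fin.sum_univ_one (fun i : Fin 1 => n * α 0 i)).symm.trans_le (hα.sum_le hZ hφ 0).1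
  rw [mul_comm] at h1
  exact ⟨α 0 0, (one_le_iff_ne_zero_matrix _).2 ((hα'.ne_zero hZ hφ).2 h0), h1,
    (formAOccurs_symp hZ h1).classA hZ hφ hα', hα'⟩

theorem morphism_herm_herm {n N : ℕ} (hZ : (herm n).IsSource) :
    (∀ φ : (herm n).Elt →ₗ[ℂ] (herm N).Elt, IsJBHom φ → φ ≠ 0 →
      ∃ α : ℕ, 1 ≤ α ∧ α * n ≤ N ∧ ClassA α 0 φ ∧ HasMultiplicity φ !![α]) ∧
    (∀ α : ℕ, 1 ≤ α → α * n ≤ N → Occurs (herm n) (herm N) !![α]) := by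
  refine ⟨fun φ hφ h0 => ?_, fun α h1 h2 =>
    (formAOccurs_herm hZ h2).occurs hZ ((one_le_iff_ne_zero_matrix _).1 h1)⟩
  obtain ⟨α, hα, -⟩ := existsUnique_multiplicity hZ hφ
  change Matrix (Fin 1) (Fin 1) ℕ at α
  have hα' : HasMultiplicity φ !![α 0 0] := by
    rw [show !![α 0 0] = α by ext j i; fin_cases j; fin_cases i; rfl]; exact hα
  have h1 : n * α 0 0 ≤ N :=
    (Fin.sum_univ_one (fun i : Fin 1 => n * α 0 i)).symm.trans_le (hα.sum_le hZ hφ 0).1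
  rw [mul_comm] at h1
  exact ⟨α 0 0, (one_le_iff_ne_zero_matrix _).2 ((hα'.ne_zero hZ hφ).2 h0), h1,
    (formAOccurs_herm hZ h1).classA hZ hφ hα', hα'⟩

/-- A rank one symmetric partial isometry of `τ(C^III_n)` is mapped to a skew-symmetric one. -/
theorem HasMultiplicity.even_herm_symp {n N : ℕ} (hZ : (herm n).IsSource)
    {φ : (herm n).Elt →ₗ[ℂ] (symp N).Elt} (hφ : IsJBHom φ) {α : Matrix (Fin 1) (Fin 1) ℕ}
    (hα : HasMultiplicity φ α) : Even (α 0 0) := by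
  obtain ⟨Φ, hΦ, -⟩ := existsUnique_lift hZ hφ
  have hn : 0 < n := lt_of_lt_of_le two_pos hZ
  let x : (herm n).Tau := fun _ => single ⟨0, hn⟩ ⟨0, hn⟩ 1
  have hx : (fun i => x i * (x i)ᴴ * x i) = x := by funext i; simp [x]
  refine even_of_transpose_eq_neg (a := Φ x 0) ?_ ?_ ?_
  · have := congrFun (hΦ.1 x x x) 0
    rw [hx] at this
    exact this.symm
  · have hf : (herm n).flip x = x := by funext i; exact transpose_single ..
    have h1 := hΦ.flip hZ hφ x
    rw [hf] at h1
    have h2 : Φ x 0 = (1 * -1 : ℂ) • (Φ x 0)ᵀ := congrFun h1 0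
    rw [one_mul, neg_one_smul] at h2
    exact (neg_eq_iff_eq_neg.2 h2).symm
  · have h1 := (hasMultiplicity_iff hZ hφ hΦ).1 hα x 0
    refine h1.trans ((Fin.sum_univ_one _).trans ?_)
    simp [x]

/-- A rank one symmetric partial isometry of `τ(C^II_n)` is mapped to a skew-symmetric one. -/
theorem HasMultiplicity.even_symp_herm {n N : ℕ} (hZ : (symp n).IsSource)
    {φ : (symp n).Elt →ₗ[ℂ] (herm N).Elt} (hφ : IsJBHom φ) {α : Matrix (Fin 1) (Fin 1) ℕ}
    (hα : HasMultiplicity φ α) : Even (α 0 0) := by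
  obtain ⟨Φ, hΦ, -⟩ := existsUnique_lift hZ hφ
  have hn : 0 < n := lt_of_lt_of_le (by norm_num) hZ
  let x : (symp n).Tau := fun _ => single ⟨0, hn⟩ ⟨0, hn⟩ 1
  have hx : (fun i => x i * (x i)ᴴ * x i) = x := by funext i; simp [x]
  refine even_of_transpose_eq_neg (a := Φ x 0) ?_ ?_ ?_
  · have := congrFun (hΦ.1 x x x) 0
    rw [hx] at this
    exact this.symm
  · have hf : (symp n).flip x = x := by funext i; exact transpose_single ..
    have h1 := hΦ.flip hZ hφ x
    rw [hf] at h1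
    have h2 : Φ x 0 = (-1 * 1 : ℂ) • (Φ x 0)ᵀ := congrFun h1 0
    rw [mul_one, neg_one_smul] at h2
    exact (neg_eq_iff_eq_neg.2 h2).symm
  · have h1 := (hasMultiplicity_iff hZ hφ hΦ).1 hα x 0
    refine h1.trans ((Fin.sum_univ_one _).trans ?_)
    simp [x]

theorem morphism_symp_herm {n N : ℕ} (hZ : (symp n).IsSource) :
    (∀ φ : (symp n).Elt →ₗ[ℂ] (herm N).Elt, IsJBHom φ → φ ≠ 0 →
      ∃ α : ℕ, 1 ≤ α ∧ 2 * α * n ≤ N ∧ ClassB α 1 φ ∧ HasMultiplicity φ !![2 * α]) ∧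
    (∀ α : ℕ, 1 ≤ α → 2 * α * n ≤ N → Occurs (symp n) (herm N) !![2 * α]) := by
  have key : ∀ α : ℕ, 2 * α * n ≤ N → FormBOccurs (symp n) (herm N) α 1 !![2 * α] :=
    fun α h => formBOccurs_herm hZ (show α * n + α * n ≤ N by linarith) (fun j i => rfl)
      (by funext i; fin_cases i; exact two_mul α)
  refine ⟨fun φ hφ h0 => ?_, fun α h1 h2 =>
    (key α h2).occurs hZ ((one_le_iff_ne_zero_matrix _).1 (by omega))⟩
  obtain ⟨α, hα, -⟩ := existsUnique_multiplicity hZ hφ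
  change Matrix (Fin 1) (Fin 1) ℕ at α
  obtain ⟨β, hβ⟩ := even_iff_two_dvd.1 (hα.even_symp_herm hZ hφ)
  have hα' : HasMultiplicity φ !![2 * β] := by
    rw [show !![2 * β] = α by ext j i; fin_cases j; fin_cases i; exact hβ.symm]; exact hα
  have h1 : n * α 0 0 ≤ N :=
    (Fin.sum_univ_one (fun i : Fin 1 => n * α 0 i)).symm.trans_le (hα.sum_le hZ hφ 0).1
  rw [mul_comm, hβ] at h1
  have h2 := (one_le_iff_ne_zero_matrix _).2 ((hα'.ne_zero hZ hφ).2 h0)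
  exact ⟨β, by omega, h1, (key _ h1).classB hZ hφ hα', hα'⟩

theorem morphism_herm_symp {n N : ℕ} (hZ : (herm n).IsSource) :
    (∀ φ : (herm n).Elt →ₗ[ℂ] (symp N).Elt, IsJBHom φ → φ ≠ 0 →
      ∃ α : ℕ, 1 ≤ α ∧ 2 * α * n ≤ N ∧ ClassB α (-1) φ ∧ HasMultiplicity φ !![2 * α]) ∧
    (∀ α : ℕ, 1 ≤ α → 2 * α * n ≤ N → Occurs (herm n) (symp N) !![2 * α]) := by
  have key : ∀ α : ℕ, 2 * α * n ≤ N → FormBOccurs (herm n) (symp N) α (-1) !![2 * α] :=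
    fun α h => formBOccurs_symp hZ (show α * n + α * n ≤ N by linarith) (fun j i => rfl)
      (by funext i; fin_cases i; exact two_mul α)
  refine ⟨fun φ hφ h0 => ?_, fun α h1 h2 =>
    (key α h2).occurs hZ ((one_le_iff_ne_zero_matrix _).1 (by omega))⟩
  obtain ⟨α, hα, -⟩ := existsUnique_multiplicity hZ hφ
  change Matrix (Fin 1) (Fin 1) ℕ at α
  obtain ⟨β, hβ⟩ := even_iff_two_dvd.1 (hα.even_herm_symp hZ hφ)
  have hα' : HasMultiplicity φ !![2 * β] := by
    rw [show !![2 * β] = α by ext j i; fin_cases j; fin_cases i; exact hβ.symm]; exact hα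
  have h1 : n * α 0 0 ≤ N :=
    (Fin.sum_univ_one (fun i : Fin 1 => n * α 0 i)).symm.trans_le (hα.sum_le hZ hφ 0).1
  rw [mul_comm, hβ] at h1
  have h2 := (one_le_iff_ne_zero_matrix _).2 ((hα'.ne_zero hZ hφ).2 h0)
  exact ⟨β, by omega, h1, (key _ h1).classB hZ hφ hα', hα'⟩

end Classification

/-! ### Hilbert spaces -/

/-- Every orthonormal family is an initial segment of an orthonormal basis. -/
theorem _root_.Orthonormal.exists_orthonormalBasis_castLE {𝕜 E : Type*} [RCLike 𝕜]
    [NormedAddCommGroup E] [InnerProductSpace 𝕜 E] [FiniteDimensional 𝕜 E] {n m : ℕ}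
    {v : Fin n → E} (hv : Orthonormal 𝕜 v) (hm : Module.finrank 𝕜 E = m) :
    ∃ (h : n ≤ m) (b : OrthonormalBasis (Fin m) 𝕜 E), ∀ i, v i = b (Fin.castLE h i) := by
  have hn : n ≤ m := by
    simpa [hm] using hv.linearIndependent.fintype_card_le_finrank
  refine ⟨hn, ?_⟩
  obtain ⟨b, hb⟩ := Orthonormal.exists_orthonormalBasis_extension_of_card_eq (𝕜 := 𝕜)
    (ι := Fin m) (by simpa using hm)
    (v := fun j => if hj : j.1 < n then v ⟨j, hj⟩ else 0) (s := {j | j.1 < n}) (by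
      have : (Set.domRestrict {j : Fin m | j.1 < n}
          fun j => if hj : j.1 < n then v ⟨j, hj⟩ else 0) = fun j => v ⟨j.1, j.2⟩ := by
        funext j
        exact dif_pos j.2
      rw [this]
      refine hv.comp (fun j : {j : Fin m | j.1 < n} => (⟨j.1, j.2⟩ : Fin n)) fun i j hij => ?_
      exact Subtype.ext (Fin.ext (congrArg Fin.val hij :)))
  refine ⟨b, fun i => ?_⟩
  rw [hb _ (show (Fin.castLE hn i).1 < n from i.2)]
  simp

section Hilbert

variable {H₁ : Type u} {H₂ : Type v} [NormedAddCommGroup H₁] [InnerProductSpace ℂ H₁]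
  [NormedAddCommGroup H₂] [InnerProductSpace ℂ H₂] {φ : H₁ →ₗ[ℂ] H₂}

theorem hilbertTriple_self (x : H₁) : hilbertTriple x x x = ((‖x‖ : ℂ) ^ 2) • x := by
  rw [hilbertTriple, ← two_smul ℂ, smul_smul, inner_self_eq_norm_sq_to_K]
  norm_num

/-- The cube `{x, x, x} = ‖x‖² x` shows that a non-zero value `φ x` has the norm of `x`, and
`{x, x, y} = (‖x‖² y + ⟨y, x⟩ x) / 2` that `φ` has no kernel. -/
theorem norm_map_of_hilbertTriple
    (h : ∀ x y z, φ (hilbertTriple x y z) = hilbertTriple (φ x) (φ y) (φ z)) (h0 : φ ≠ 0) (x : H₁) :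
    ‖φ x‖ = ‖x‖ := by
  have hx : ((‖x‖ : ℂ) ^ 2) • φ x = ((‖φ x‖ : ℂ) ^ 2) • φ x := by
    rw [← hilbertTriple_self, ← h, hilbertTriple_self, map_smul]
  by_cases hφx : φ x = 0
  · obtain ⟨y, hy⟩ : ∃ y, φ y ≠ 0 := by
      by_contra! hall
      exact h0 (LinearMap.ext hall)
    have h1 := h x x y
    simp only [hilbertTriple, map_smul, map_add, hφx, inner_zero_left, inner_zero_right, zero_smul,
      smul_zero, add_zero] at h1
    have h2 : (inner ℂ x x : ℂ) = 0 := by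
      simpa [hy] using h1
    rw [hφx, inner_self_eq_zero.1 h2, norm_zero, norm_zero]
  · have h1 := smul_left_injective ℂ hφx hx
    have h2 : ‖x‖ ^ 2 = ‖φ x‖ ^ 2 := by exact_mod_cast h1
    exact ((sq_eq_sq₀ (norm_nonneg _) (norm_nonneg _)).1 h2).symm

theorem hilbert_morphism_iff [Nontrivial H₁] :
    ((∀ x y z, φ (hilbertTriple x y z) = hilbertTriple (φ x) (φ y) (φ z)) ∧ φ ≠ 0) ↔
      ∀ x, ‖φ x‖ = ‖x‖ := by
  refine ⟨fun h => norm_map_of_hilbertTriple h.1 h.2, fun h => ⟨fun x y z => ?_, ?_⟩⟩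
  · have hi := (LinearMap.norm_map_iff_inner_map_map φ).1 h
    simp only [hilbertTriple, map_smul, map_add, hi]
  · rintro rfl
    obtain ⟨x, hx⟩ := exists_ne (0 : H₁)
    exact hx (norm_eq_zero.1 (by simpa using (h x).symm))

theorem exists_orthonormalBasis_of_hilbertTriple [FiniteDimensional ℂ H₂] {n : ℕ}
    (b : OrthonormalBasis (Fin n) ℂ H₁)
    (h : ∀ x y z, φ (hilbertTriple x y z) = hilbertTriple (φ x) (φ y) (φ z)) (h0 : φ ≠ 0) :
    ∃ (h : n ≤ Module.finrank ℂ H₂) (b' : OrthonormalBasis (Fin (Module.finrank ℂ H₂)) ℂ H₂),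
      ∀ i, φ (b i) = b' (Fin.castLE h i) := by
  let f : H₁ →ₗᵢ[ℂ] H₂ := ⟨φ, norm_map_of_hilbertTriple h h0⟩
  have ho : Orthonormal ℂ (fun i => φ (b i)) := b.orthonormal.comp_linearIsometry f
  obtain ⟨hn, b', hb'⟩ := ho.exists_orthonormalBasis_castLE rfl
  exact ⟨hn, b', hb'⟩

end Hilbert

/-! ### Spin factors: the scalar product -/

section SpinFactor

variable {A : Type*} [CStarAlgebra A] {n : ℕ} {s : Fin n → A}

theorem spinInner_eq [Nontrivial A] {x y : A} {c : ℂ}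
    (h : x * star y + star y * x = (2 * c) • (1 : A)) : spinInner x y = c := by
  have h' := Classical.epsilon_spec
    (p := fun c : ℂ => x * star y + star y * x = (2 * c) • (1 : A)) ⟨c, h⟩
  exact mul_left_cancel₀ two_ne_zero (smul_left_injective ℂ one_ne_zero (h'.symm.trans h))

theorem mem_spinFactor (s : Fin n → A) (i : Fin n) : s i ∈ spinFactor s :=
  Submodule.subset_span ⟨i, rfl⟩

theorem IsSpinSystem.spinInner_apply [Nontrivial A] (hs : IsSpinSystem s) (i j : Fin n) :
    spinInner (s i) (s j) = if i = j then 1 else 0 := by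
  apply spinInner_eq
  rw [hs.selfAdjoint, hs.anticomm]
  split_ifs
  · rw [mul_one, ofNat_smul_eq_nsmul, nsmul_one, Nat.cast_ofNat]
  · simp

theorem IsSpinSystem.spinInner_smul_left [Nontrivial A] (hs : IsSpinSystem s) (c : ℂ) {x y : A}
    (hx : x ∈ spinFactor s) (hy : y ∈ spinFactor s) :
    spinInner (c • x) y = c * spinInner x y := by
  apply spinInner_eq
  rw [smul_mul_assoc, mul_smul_comm, ← smul_add, hs.spinInner_spec hx hy, smul_smul]
  ring_nf

theorem IsSpinSystem.spinInner_smul_right [Nontrivial A] (hs : IsSpinSystem s) (c : ℂ) {x y : A}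
    (hx : x ∈ spinFactor s) (hy : y ∈ spinFactor s) :
    spinInner x (c • y) = star c * spinInner x y := by
  apply spinInner_eq
  rw [star_smul, smul_mul_assoc, mul_smul_comm, ← smul_add, hs.spinInner_spec hx hy, smul_smul]
  ring_nf

/-- The triple product of a spin factor in terms of the scalar product and the involution. -/
theorem IsSpinSystem.tri_eq (hs : IsSpinSystem s) (x y z : spinFactor s) :
    hs.tri x y z = spinInner (x : A) (y : A) • z + spinInner (z : A) (y : A) • x -
      spinInner (x : A) ((hs.inv z : spinFactor s) : A) • hs.inv y := by
  refine Subtype.ext ?_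
  have h1 := hs.spinInner_spec x.2 y.2
  have h2 := hs.spinInner_spec z.2 y.2
  have h3 := hs.spinInner_spec x.2 (hs.inv z).2
  change x.1 * star (star z.1) + star (star z.1) * x.1 = _ at h3
  rw [star_star] at h3
  change (1 / 2 : ℂ) • (x.1 * star y.1 * z.1 + z.1 * star y.1 * x.1) =
    spinInner (x : A) (y : A) • z.1 + spinInner (z : A) (y : A) • x.1 -
      spinInner (x : A) ((hs.inv z : spinFactor s) : A) • star y.1
  have key : x.1 * star y.1 * z.1 + z.1 * star y.1 * x.1 =
      (x.1 * star y.1 + star y.1 * x.1) * z.1 + (z.1 * star y.1 + star y.1 * z.1) * x.1 -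
        star y.1 * (x.1 * z.1 + z.1 * x.1) := by noncomm_ring
  rw [key, h1, h2, h3, smul_one_mul, smul_one_mul, mul_smul_comm, mul_one, smul_sub, smul_add]
  simp only [smul_smul]
  have h4 : ∀ c : ℂ, 1 / 2 * (2 * c) = c := fun c => by ring
  rw [h4, h4, h4]

theorem IsSpinSystem.inv_inv (hs : IsSpinSystem s) (x : spinFactor s) : hs.inv (hs.inv x) = x :=
  Subtype.ext (star_star x.1)

theorem IsSpinSystem.inv_smul (hs : IsSpinSystem s) (c : ℂ) (x : spinFactor s) :
    hs.inv (c • x) = star c • hs.inv x :=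
  Subtype.ext (star_smul c x.1)

theorem IsSpinSystem.inv_add (hs : IsSpinSystem s) (x y : spinFactor s) :
    hs.inv (x + y) = hs.inv x + hs.inv y :=
  Subtype.ext (star_add x.1 y.1)

end SpinFactor

/-! ### Morphisms of spin factors -/

section SpinMorphism

variable {A : Type u} {B : Type v} [CStarAlgebra A] [Nontrivial A] [CStarAlgebra B] [Nontrivial B]
  {n m : ℕ} {s : Fin n → A} {t : Fin m → B} {φ : spinFactor s →ₗ[ℂ] spinFactor t}

/-- The members of a spin system, as elements of its spin factor. -/
def spinVec (s : Fin n → A) (i : Fin n) : spinFactor s := ⟨s i, Submodule.subset_span ⟨i, rfl⟩⟩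

theorem spinFactor_induction {P : spinFactor s → Prop} (h : ∀ i, P (spinVec s i))
    (hadd : ∀ x y, P x → P y → P (x + y)) (hsmul : ∀ (c : ℂ) x, P x → P (c • x)) (h0 : P 0) (x) :
    P x := by
  obtain ⟨x, hx⟩ := x
  refine Submodule.span_induction (p := fun x hx => P ⟨x, hx⟩) ?_ h0 (fun x y hx hy => hadd _ _)
    (fun c x hx => hsmul c _) hx
  rintro _ ⟨i, rfl⟩
  exact h i

theorem inv_spinVec (hs : IsSpinSystem s) (i : Fin n) : hs.inv (spinVec s i) = spinVec s i :=
  Subtype.ext (hs.selfAdjoint i)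

theorem tri_spinVec (hs : IsSpinSystem s) (i j k : Fin n) :
    hs.tri (spinVec s i) (spinVec s j) (spinVec s k) =
      (if i = j then (1 : ℂ) else 0) • spinVec s k + (if k = j then (1 : ℂ) else 0) • spinVec s i -
        (if i = k then (1 : ℂ) else 0) • spinVec s j := by
  rw [hs.tri_eq, inv_spinVec, inv_spinVec]
  simp only [spinVec, hs.spinInner_apply]

/-- The members of the system are mapped to unitary tripotents which are pairwise orthogonal for
the scalar product and are all self-adjoint up to one and the same phase. The third member of the
system serves to exclude that the images of two members are proportional. -/
theorem exists_spinSystem_of_morphism (hs : IsSpinSystem s) (ht : IsSpinSystem t) (hn : 3 ≤ n)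
    (h : ∀ x y z, φ (hs.tri x y z) = ht.tri (φ x) (φ y) (φ z)) (h0 : φ ≠ 0) :
    ∃ (μ : ℂ) (u : Fin n → B), ‖μ‖ = 1 ∧ IsSpinSystem u ∧ (∀ i, u i ∈ spinFactor t) ∧
      ∀ i, (φ (spinVec s i) : B) = μ • u i := by
  set a : Fin n → spinFactor t := fun i => φ (spinVec s i) with ha_def
  have htri : ∀ i j k, ht.tri (a i) (a j) (a k) =
      (if i = j then (1 : ℂ) else 0) • a k + (if k = j then (1 : ℂ) else 0) • a i -
        (if i = k then (1 : ℂ) else 0) • a j := by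
    intro i j k
    rw [← h, tri_spinVec]
    simp only [map_sub, map_add, map_smul, ha_def]
  have hiij : ∀ i j, ht.tri (a i) (a i) (a j) = a j := by
    intro i j
    rw [htri]
    by_cases hij : i = j
    · subst hij; simp
    · simp [hij, Ne.symm hij]
  have hne : ∀ i, a i ≠ 0 := by
    intro i hi
    refine h0 (LinearMap.ext fun x => ?_)
    refine spinFactor_induction (P := fun x => φ x = 0) (fun j => ?_)
      (fun x y hx hy => by rw [map_add, hx, hy, add_zero])
      (fun c x hx => by rw [map_smul, hx, smul_zero]) (map_zero _) x
    have := hiij i j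
    rw [hi] at this
    change a j = 0
    rw [← this]
    refine Subtype.ext ?_
    simp [IsSpinSystem.tri]
  have hthird : ∀ i j : Fin n, ∃ k, k ≠ i ∧ k ≠ j := fun i j => by
    obtain ⟨k, hk⟩ := Finset.exists_mem_notMem_of_card_lt_card (s := {i, j}) (t := Finset.univ)
      (Finset.card_le_two.trans_lt (by simpa using (show 2 < n from hn)))
    exact ⟨k, by simpa [not_or] using hk⟩
  -- if `a j = c a i`, then `{a i, a j, a k} = 0` yields `star c • a k = 0`
  have hprop : ∀ i j, i ≠ j → ∀ c : ℂ, a j ≠ c • a i := by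
    intro i j hij c hc
    obtain ⟨k, hki, hkj⟩ := hthird i j
    have h1 := htri i j k
    rw [if_neg hij, if_neg hkj, if_neg hki.symm, zero_smul, zero_smul, zero_smul, add_zero,
      sub_zero] at h1
    have h2 : ht.tri (a i) (c • a i) (a k) = star c • ht.tri (a i) (a i) (a k) := by
      refine Subtype.ext ?_
      simp only [IsSpinSystem.tri, Submodule.coe_smul, star_smul, mul_smul_comm, smul_mul_assoc,
        ← smul_add]
      exact smul_comm _ _ _
    rw [hc, h2, hiij] at h1
    rcases smul_eq_zero.1 h1 with h3 | h3
    · rw [star_eq_zero] at h3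
      rw [h3, zero_smul] at hc
      exact hne j hc
    · exact hne k h3
  have hflip : ∀ i j, i ≠ j → (2 * spinInner (a i : B) (a j : B)) • a i -
      spinInner (a i : B) (ht.inv (a i) : B) • ht.inv (a j) = -a j := by
    intro i j hij
    have h1 := htri i j i
    rw [ht.tri_eq, if_neg hij, if_pos rfl, zero_smul, one_smul, add_zero, zero_sub] at h1
    rw [← h1, two_mul, add_smul]
  have hcube : ∀ i, (2 * spinInner (a i : B) (a i : B)) • a i -
      spinInner (a i : B) (ht.inv (a i) : B) • ht.inv (a i) = a i := by
    intro i
    have h1 := hiij i i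
    rw [ht.tri_eq, ← add_smul, ← two_mul] at h1
    exact h1
  -- `hflip` excludes `⟨a i, (a i)*⟩ = 0`, and then `hcube` determines `(a i)*`
  have hlam : ∀ i, ∃ l : ℂ, ht.inv (a i) = l • a i := by
    intro i
    obtain ⟨j, hj, -⟩ := hthird i i
    have hκ : spinInner (a i : B) (ht.inv (a i) : B) ≠ 0 := by
      intro hκ
      have h1 := hflip i j hj.symm
      rw [hκ, zero_smul, sub_zero] at h1
      refine hprop i j hj.symm (-(2 * spinInner (a i : B) (a j : B))) ?_
      rw [neg_smul, h1, neg_neg]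
    refine ⟨(spinInner (a i : B) (ht.inv (a i) : B))⁻¹ *
      (2 * spinInner (a i : B) (a i : B) - 1), ?_⟩
    rw [mul_smul, eq_inv_smul_iff₀ hκ, sub_smul, one_smul, eq_sub_iff_add_eq]
    exact (sub_eq_iff_eq_add'.1 (hcube i)).symm
  choose l hl using hlam
  have hl1 : ∀ i, star (l i) * l i = 1 := by
    intro i
    have h1 := ht.inv_inv (a i)
    rw [hl, ht.inv_smul, hl, smul_smul] at h1
    exact smul_left_injective ℂ (hne i) (h1.trans (one_smul ℂ _).symm)
  have hκ : ∀ i, spinInner (a i : B) (ht.inv (a i) : B) =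
      star (l i) * spinInner (a i : B) (a i : B) := by
    intro i
    rw [hl, Submodule.coe_smul, ht.spinInner_smul_right _ (a i).2 (a i).2]
  have hnorm : ∀ i, spinInner (a i : B) (a i : B) = 1 := by
    intro i
    have h1 := hcube i
    rw [hκ, hl, smul_smul, ← sub_smul] at h1
    have h2 := smul_left_injective ℂ (hne i) (h1.trans (one_smul ℂ _).symm)
    linear_combination h2 + spinInner (a i : B) (a i : B) * hl1 i
  have horth : ∀ i j, i ≠ j → star (l i) * l j = 1 ∧ spinInner (a i : B) (a j : B) = 0 := by
    intro i j hij
    have h1 := hflip i j hij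
    rw [hκ, hnorm, mul_one, hl, smul_smul] at h1
    have h2 : (2 * spinInner (a i : B) (a j : B)) • a i = (star (l i) * l j - 1) • a j := by
      rw [sub_smul, one_smul]
      rw [sub_eq_iff_eq_add] at h1
      rw [h1]; abel
    have h3 : star (l i) * l j - 1 = 0 := by
      by_contra h3
      refine hprop i j hij ((star (l i) * l j - 1)⁻¹ * (2 * spinInner (a i : B) (a j : B))) ?_
      rw [mul_smul, h2, inv_smul_smul₀ h3]
    refine ⟨sub_eq_zero.1 h3, ?_⟩
    rw [h3, zero_smul, smul_eq_zero] at h2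
    simpa using h2.resolve_right (hne i)
  have hconst : ∀ i j, l i = l j := by
    intro i j
    by_cases hij : i = j
    · rw [hij]
    · linear_combination l j * hl1 i - l i * (horth i j hij).1
  let i₀ : Fin n := ⟨0, by omega⟩
  -- a square root of the common phase of `(a i)*` makes `ν • a i` self-adjoint
  obtain ⟨ν, hν⟩ := IsAlgClosed.exists_pow_nat_eq (l i₀) two_pos
  have hν1 : ‖ν‖ = 1 := by
    have h1 : ‖l i₀‖ = 1 := by
      have := congrArg norm (hl1 i₀)
      rw [norm_mul, norm_star, norm_one] at this
      nlinarith [norm_nonneg (l i₀)]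
    rw [← hν, norm_pow] at h1
    exact (pow_eq_one_iff_of_nonneg (norm_nonneg _) two_ne_zero).1 h1
  have hν2 : star ν * ν = 1 := by
    have := Complex.conj_mul' ν
    rw [hν1] at this
    simpa using this
  have hsa : ∀ i, star (ν • (a i : B)) = ν • (a i : B) := by
    intro i
    have h1 : star (a i : B) = l i • (a i : B) := congrArg Subtype.val (hl i)
    rw [star_smul, h1, hconst i i₀, ← hν, smul_smul]
    congr 1
    linear_combination ν * hν2
  refine ⟨star ν, fun i => ν • (a i : B), by rw [norm_star, hν1], ⟨hsa, fun i j => ?_⟩,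
    fun i => Submodule.smul_mem _ _ (a i).2, fun i => by rw [smul_smul, hν2, one_smul]⟩
  have h1 := ht.spinInner_spec (Submodule.smul_mem _ ν (a i).2) (Submodule.smul_mem _ ν (a j).2)
  rw [hsa, ht.spinInner_smul_left _ (a i).2 (Submodule.smul_mem _ ν (a j).2),
    ht.spinInner_smul_right _ (a i).2 (a j).2] at h1
  rw [h1]
  split_ifs with hij
  · subst hij
    rw [hnorm, show 2 * (ν * (star ν * 1)) = 2 by linear_combination 2 * hν2,
      ofNat_smul_eq_nsmul, nsmul_one, Nat.cast_ofNat]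
  · rw [(horth i j hij).2]
    simp

end SpinMorphism

section SpinMorphism

variable {A : Type u} {B : Type v} [CStarAlgebra A] [Nontrivial A] [CStarAlgebra B] [Nontrivial B]
  {n m : ℕ} {s : Fin n → A} {t : Fin m → B}

/-- A linear map that sends a spin system to a spin system respects the involutions and the scalar
products. -/
theorem spin_isometry_of_spinSystem (hs : IsSpinSystem s) (ht : IsSpinSystem t)
    {U : spinFactor s →ₗ[ℂ] spinFactor t} {u : Fin n → B} (hu : IsSpinSystem u)
    (hU : ∀ i, (U (spinVec s i) : B) = u i) :
    (∀ x y, spinInner (U x : B) (U y : B) = spinInner (x : A) (y : A)) ∧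
      ∀ x, U (hs.inv x) = ht.inv (U x) := by
  have hinv : ∀ x, U (hs.inv x) = ht.inv (U x) := by
    refine fun x => spinFactor_induction (P := fun x => U (hs.inv x) = ht.inv (U x))
      (fun i => ?_) (fun x y hx hy => ?_) (fun c x hx => ?_) ?_ x
    · rw [inv_spinVec]
      refine Subtype.ext ?_
      change _ = star (U (spinVec s i) : B)
      rw [hU, hu.selfAdjoint]
    · rw [hs.inv_add, map_add, map_add, ht.inv_add, hx, hy]
    · rw [hs.inv_smul, map_smul, map_smul, ht.inv_smul, hx]
    · have h0 : hs.inv 0 = 0 := Subtype.ext (star_zero A)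
      have h0' : ht.inv 0 = 0 := Subtype.ext (star_zero B)
      rw [h0, map_zero, h0']
  refine ⟨fun x y => ?_, hinv⟩
  have key : ∀ x y : spinFactor s, ∃ c : ℂ, x.1 * y.1 + y.1 * x.1 = (2 * c) • (1 : A) ∧
      (U x : B) * (U y : B) + (U y : B) * (U x : B) = (2 * c) • (1 : B) := by
    intro x y
    refine spinFactor_induction (P := fun x => ∃ c : ℂ,
      x.1 * y.1 + y.1 * x.1 = (2 * c) • (1 : A) ∧
      (U x : B) * (U y : B) + (U y : B) * (U x : B) = (2 * c) • (1 : B))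
      (fun i => ?_) ?_ ?_ ⟨0, by simp⟩ x
    · refine spinFactor_induction (P := fun y => ∃ c : ℂ,
        (spinVec s i).1 * y.1 + y.1 * (spinVec s i).1 = (2 * c) • (1 : A) ∧
        (U (spinVec s i) : B) * (U y : B) + (U y : B) * (U (spinVec s i) : B) =
          (2 * c) • (1 : B)) (fun j => ⟨if i = j then 1 else 0, ?_, ?_⟩) ?_ ?_ ⟨0, by simp⟩ y
      · change s i * s j + s j * s i = _
        rw [hs.anticomm]
        split_ifs
        · rw [mul_one, ofNat_smul_eq_nsmul, nsmul_one, Nat.cast_ofNat]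
        · simp
      · rw [hU, hU, hu.anticomm]
        split_ifs
        · rw [mul_one, ofNat_smul_eq_nsmul, nsmul_one, Nat.cast_ofNat]
        · simp
      · rintro x y ⟨c, hc, hc'⟩ ⟨d, hd, hd'⟩
        refine ⟨c + d, ?_, ?_⟩
        · rw [mul_add, add_smul, ← hc, ← hd]
          simp only [Submodule.coe_add]
          noncomm_ring
        · rw [mul_add, add_smul, ← hc', ← hd']
          simp only [map_add, Submodule.coe_add]
          noncomm_ring
      · rintro a x ⟨c, hc, hc'⟩
        refine ⟨a * c, ?_, ?_⟩
        · rw [mul_left_comm, mul_smul, ← hc, smul_add]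
          simp only [Submodule.coe_smul, smul_mul_assoc, mul_smul_comm]
        · rw [mul_left_comm, mul_smul, ← hc', smul_add]
          simp only [map_smul, Submodule.coe_smul, smul_mul_assoc, mul_smul_comm]
    · rintro x y ⟨c, hc, hc'⟩ ⟨d, hd, hd'⟩
      refine ⟨c + d, ?_, ?_⟩
      · rw [mul_add, add_smul, ← hc, ← hd]
        simp only [Submodule.coe_add]
        noncomm_ring
      · rw [mul_add, add_smul, ← hc', ← hd']
        simp only [map_add, Submodule.coe_add]
        noncomm_ring
    · rintro a x ⟨c, hc, hc'⟩
      refine ⟨a * c, ?_, ?_⟩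
      · rw [mul_left_comm, mul_smul, ← hc, smul_add]
        simp only [Submodule.coe_smul, smul_mul_assoc, mul_smul_comm]
      · rw [mul_left_comm, mul_smul, ← hc', smul_add]
        simp only [map_smul, Submodule.coe_smul, smul_mul_assoc, mul_smul_comm]
  obtain ⟨c, hc, hc'⟩ := key x (hs.inv y)
  rw [hinv] at hc'
  rw [spinInner_eq hc, spinInner_eq hc']

/-- Forward, `U` is the morphism divided by the common phase of the self-adjoint images; backward,
the triple product is expressed by the scalar product and the involution. -/
theorem spin_morphism_iff (hs : IsSpinSystem s) (ht : IsSpinSystem t) (hn : 3 ≤ n)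
    {φ : spinFactor s →ₗ[ℂ] spinFactor t} :
    ((∀ x y z, φ (hs.tri x y z) = ht.tri (φ x) (φ y) (φ z)) ∧ φ ≠ 0) ↔
      ∃ (U : spinFactor s →ₗ[ℂ] spinFactor t) (μ : ℂ), ‖μ‖ = 1 ∧
        (∀ x y, spinInner (U x : B) (U y : B) = spinInner (x : A) (y : A)) ∧
        (∀ x, U (hs.inv x) = ht.inv (U x)) ∧
        ∀ x, φ x = μ • U x := by
  have hunit : ∀ μ : ℂ, ‖μ‖ = 1 → star μ * μ = 1 := fun μ hμ => by
    have := Complex.conj_mul' μ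
    rw [hμ] at this
    simpa using this
  constructor
  · rintro ⟨h, h0⟩
    obtain ⟨μ, u, hμ, hu, -, hφ⟩ := exists_spinSystem_of_morphism hs ht hn h h0
    obtain ⟨h1, h2⟩ := spin_isometry_of_spinSystem hs ht (U := star μ • φ) hu fun i => by
      rw [LinearMap.smul_apply, Submodule.coe_smul, hφ, smul_smul, hunit μ hμ, one_smul]
    refine ⟨star μ • φ, μ, hμ, h1, h2, fun x => ?_⟩
    rw [LinearMap.smul_apply, smul_smul, mul_comm, hunit μ hμ, one_smul]
  · rintro ⟨U, μ, hμ, hU, hinv, hφ⟩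
    have hμ' := hunit μ hμ
    constructor
    · intro x y z
      rw [hs.tri_eq, ht.tri_eq, map_sub, map_add, map_smul, map_smul, map_smul]
      simp only [hφ, ht.inv_smul, Submodule.coe_smul]
      simp only [ht.spinInner_smul_left _ (U _).2 (Submodule.smul_mem _ _ (U _).2),
        ht.spinInner_smul_left _ (U _).2 (Submodule.smul_mem _ _ (ht.inv (U _)).2),
        ht.spinInner_smul_right _ (U _).2 (U _).2,
        ht.spinInner_smul_right _ (U _).2 (ht.inv (U _)).2, star_star]
      have e1 : ∀ a, μ * (star μ * a) = a := fun a => by linear_combination a * hμ'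
      have e2 : ∀ a, μ * (μ * a) * star μ = a * μ := fun a => by linear_combination a * μ * hμ'
      simp only [← hinv, hU, smul_smul, e1, e2]
    · rintro rfl
      have hi : 0 < n := by omega
      have h1 : U (spinVec s ⟨0, hi⟩) = 0 := by
        have := hφ (spinVec s ⟨0, hi⟩)
        rw [LinearMap.zero_apply, eq_comm, smul_eq_zero] at this
        refine this.resolve_left ?_
        rintro rfl
        simp at hμ
      have h2 := hU (spinVec s ⟨0, hi⟩) (spinVec s ⟨0, hi⟩)
      rw [h1] at h2
      have h3 := hs.spinInner_apply ⟨0, hi⟩ ⟨0, hi⟩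
      rw [if_pos rfl] at h3
      have h4 : spinInner (0 : B) (0 : B) = 0 := spinInner_eq (by simp)
      exact one_ne_zero (h3.symm.trans (h2.symm.trans h4))

/-- The linear combination of a spin system with real coefficients. -/
def spinComb (t : Fin m → B) : EuclideanSpace ℝ (Fin m) →ₗ[ℝ] B where
  toFun r := ∑ k, (r k : ℂ) • t k
  map_add' r r' := by
    simp only [PiLp.add_apply, Complex.ofReal_add, add_smul, Finset.sum_add_distrib]
  map_smul' a r := by
    simp only [PiLp.smul_apply, smul_eq_mul, Complex.ofReal_mul, mul_smul, RingHom.id_apply,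
      ← Finset.smul_sum]
    rfl

theorem spinComb_single (t : Fin m → B) (k : Fin m) :
    spinComb t (EuclideanSpace.single k 1) = t k := by
  change ∑ j, ((EuclideanSpace.single k (1 : ℝ) j : ℝ) : ℂ) • t j = t k
  rw [Finset.sum_eq_single k (fun j _ hj => by simp [hj]) (by simp)]
  simp

theorem spinComb_mem (t : Fin m → B) (r : EuclideanSpace ℝ (Fin m)) :
    spinComb t r ∈ spinFactor t :=
  Submodule.sum_mem (t := Finset.univ) (f := fun k => (r k : ℂ) • t k) _ fun k _ =>
    Submodule.smul_mem _ _ (mem_spinFactor t k)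

theorem star_spinComb (ht : IsSpinSystem t) (r : EuclideanSpace ℝ (Fin m)) :
    star (spinComb t r) = spinComb t r := by
  change star (∑ k, (r k : ℂ) • t k) = ∑ k, (r k : ℂ) • t k
  rw [star_sum]
  refine Finset.sum_congr rfl fun k _ => ?_
  rw [star_smul, ht.selfAdjoint]
  congr 1
  exact Complex.conj_ofReal _

theorem sum_smul_anticomm (ht : IsSpinSystem t) (c d : Fin m → ℂ) :
    (∑ k, c k • t k) * (∑ k, d k • t k) + (∑ k, d k • t k) * (∑ k, c k • t k) =
      (2 * ∑ k, c k * d k) • (1 : B) := by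
  have h1 : (∑ k, d k • t k) * (∑ k, c k • t k) = ∑ i, ∑ j, (d j * c i) • (t j * t i) := by
    rw [Finset.sum_mul_sum, Finset.sum_comm]
    simp only [smul_mul_smul_comm]
  rw [h1, Finset.sum_mul_sum, ← Finset.sum_add_distrib, Finset.mul_sum, Finset.sum_smul]
  refine Finset.sum_congr rfl fun i _ => ?_
  rw [← Finset.sum_add_distrib]
  simp only [smul_mul_smul_comm, mul_comm (d _), ← smul_add, ht.anticomm]
  have h2 : (2 : B) = (2 : ℂ) • (1 : B) := by
    rw [ofNat_smul_eq_nsmul, nsmul_one, Nat.cast_ofNat]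
  rw [Finset.sum_eq_single i (fun j _ hj => by rw [if_neg hj.symm, smul_zero]) (by simp),
    if_pos rfl, h2, smul_smul, mul_comm 2]

theorem spinComb_anticomm (ht : IsSpinSystem t) (r r' : EuclideanSpace ℝ (Fin m)) :
    spinComb t r * spinComb t r' + spinComb t r' * spinComb t r =
      (2 * (inner ℝ r r' : ℝ) : ℂ) • (1 : B) := by
  refine (sum_smul_anticomm ht _ _).trans ?_
  congr 2
  simp [PiLp.inner_apply, mul_comm]

/-- The coefficients of a self-adjoint element are real, as they are scalar products of
self-adjoint elements. -/
theorem exists_spinComb_of_selfAdjoint (ht : IsSpinSystem t) {x : B} (hx : x ∈ spinFactor t)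
    (hsa : star x = x) : ∃ r, spinComb t r = x := by
  obtain ⟨c, hc⟩ := (Submodule.mem_span_range_iff_exists_fun ℂ).1 hx
  have hreal : ∀ k, ((c k).re : ℂ) = c k := by
    intro k
    have h1 : x * t k + t k * x = (2 * c k) • (1 : B) := by
      have := sum_smul_anticomm ht c (Pi.single k 1)
      simpa [Pi.single_apply, ite_smul, hc] using this
    have h2 := congrArg star h1
    rw [star_add, star_mul, star_mul, hsa, ht.selfAdjoint, add_comm, h1, star_smul, star_one] at h2
    have h3 := smul_left_injective ℂ one_ne_zero h2
    rw [star_mul, mul_comm (star (c k)), star_ofNat] at h3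
    exact Complex.conj_eq_iff_re.1 (mul_left_cancel₀ two_ne_zero h3).symm
  refine ⟨WithLp.toLp 2 fun k => (c k).re, ?_⟩
  rw [← hc]
  change ∑ k, ((c k).re : ℂ) • t k = ∑ k, c k • t k
  simp only [hreal]

theorem isSpinSystem_spinComb (ht : IsSpinSystem t) {ι : ℕ} {v : Fin ι → EuclideanSpace ℝ (Fin m)}
    (hv : Orthonormal ℝ v) : IsSpinSystem fun k => spinComb t (v k) where
  selfAdjoint k := star_spinComb ht _
  anticomm i j := by
    rw [spinComb_anticomm ht, orthonormal_iff_ite.1 hv]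
    split_ifs
    · rw [Complex.ofReal_one, mul_one, ofNat_smul_eq_nsmul, nsmul_one, Nat.cast_ofNat]
    · simp

/-- The images are orthonormal vectors of the real Hilbert space of the self-adjoint elements, in
which they extend to an orthonormal basis. -/
theorem exists_spinSystem_extension (hs : IsSpinSystem s) (ht : IsSpinSystem t) (hn : 3 ≤ n)
    {φ : spinFactor s →ₗ[ℂ] spinFactor t}
    (h : ∀ x y z, φ (hs.tri x y z) = ht.tri (φ x) (φ y) (φ z)) (h0 : φ ≠ 0) :
    ∃ (h : n ≤ m) (μ : ℂ) (t' : Fin m → B), ‖μ‖ = 1 ∧ IsSpinSystem t' ∧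
      spinFactor t' = spinFactor t ∧
      ∀ i, (φ ⟨s i, Submodule.subset_span ⟨i, rfl⟩⟩ : B) = μ • t' (Fin.castLE h i) := by
  obtain ⟨μ, u, hμ, hu, hut, hφ⟩ := exists_spinSystem_of_morphism hs ht hn h h0
  choose v hv using fun i => exists_spinComb_of_selfAdjoint ht (hut i) (hu.selfAdjoint i)
  have hvo : Orthonormal ℝ v := by
    rw [orthonormal_iff_ite]
    intro i j
    have h1 := spinComb_anticomm ht (v i) (v j)
    rw [hv, hv, hu.anticomm] at h1
    have h2 : (2 * (if i = j then 1 else 0) : ℂ) • (1 : B) = if i = j then 2 else 0 := by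
      split_ifs
      · rw [mul_one, ofNat_smul_eq_nsmul, nsmul_one, Nat.cast_ofNat]
      · simp
    have h3 := mul_left_cancel₀ two_ne_zero (smul_left_injective ℂ one_ne_zero (h2.trans h1))
    split_ifs at h3 ⊢
    · exact_mod_cast h3.symm
    · exact_mod_cast h3.symm
  obtain ⟨hnm, b, hb⟩ := hvo.exists_orthonormalBasis_castLE (finrank_euclideanSpace_fin)
  refine ⟨hnm, μ, fun k => spinComb t (b k), hμ, isSpinSystem_spinComb ht b.orthonormal, ?_,
    fun i => ?_⟩
  · refine le_antisymm (Submodule.span_le.2 ?_) (Submodule.span_le.2 ?_)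
    · rintro _ ⟨k, rfl⟩
      exact spinComb_mem t _
    · rintro _ ⟨k, rfl⟩
      rw [← spinComb_single t k, ← b.sum_repr (EuclideanSpace.single k 1), map_sum]
      refine Submodule.sum_mem _ fun j _ => ?_
      rw [map_smul, ← Complex.coe_smul]
      exact Submodule.smul_mem _ _ (mem_spinFactor _ j)
  · change _ = μ • spinComb t (b (Fin.castLE hnm i))
    rw [← hb, hv]
    exact hφ i

end SpinMorphism

end JBStar

theorem mainTheorem4 :
    -- the concrete TROs are the universal ones
    (∀ Z : Factor, Z.IsSource → IsUniversalTRO.{u} Z) ∧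
    -- every morphism between the factors lifts uniquely to the universal TROs and has exactly one
    -- multiplicity matrix
    (∀ Z W : Factor, Z.IsSource → W.IsTarget → ∀ φ : Z.Elt →ₗ[ℂ] W.Elt, IsJBHom φ →
      (∃! Φ : Z.Tau →ₗ[ℂ] W.Tau, IsLift φ Φ) ∧
      (∃! α : Matrix (Fin W.tauBlocks) (Fin Z.tauBlocks) ℕ, HasMultiplicity φ α)) ∧
    -- I to I
    (∀ m n M N : ℕ, (rect m n).IsSource → (rect M N).IsTarget →
      (∀ φ : (rect m n).Elt →ₗ[ℂ] (rect M N).Elt, IsJBHom φ → φ ≠ 0 →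
        ∃ α β : ℕ, 1 ≤ α + β ∧ α * m + β * n ≤ M ∧ α * n + β * m ≤ N ∧
          ClassA α β φ ∧ HasMultiplicity φ !![α, β; β, α]) ∧
      (∀ α β : ℕ, 1 ≤ α + β → α * m + β * n ≤ M → α * n + β * m ≤ N →
        Occurs (rect m n) (rect M N) !![α, β; β, α])) ∧
    -- I to II
    (∀ m n N : ℕ, (rect m n).IsSource → (symp N).IsTarget →
      (∀ φ : (rect m n).Elt →ₗ[ℂ] (symp N).Elt, IsJBHom φ → φ ≠ 0 →
        ∃ α : ℕ, 1 ≤ α ∧ α * (m + n) ≤ N ∧ ClassB α (-1) φ ∧ HasMultiplicity φ !![α, α]) ∧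
      (∀ α : ℕ, 1 ≤ α → α * (m + n) ≤ N → Occurs (rect m n) (symp N) !![α, α])) ∧
    -- I to III
    (∀ m n N : ℕ, (rect m n).IsSource → (herm N).IsTarget →
      (∀ φ : (rect m n).Elt →ₗ[ℂ] (herm N).Elt, IsJBHom φ → φ ≠ 0 →
        ∃ α : ℕ, 1 ≤ α ∧ α * (m + n) ≤ N ∧ ClassB α 1 φ ∧ HasMultiplicity φ !![α, α]) ∧
      (∀ α : ℕ, 1 ≤ α → α * (m + n) ≤ N → Occurs (rect m n) (herm N) !![α, α])) ∧
    -- II to I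
    (∀ n M N : ℕ, (symp n).IsSource → (rect M N).IsTarget →
      (∀ φ : (symp n).Elt →ₗ[ℂ] (rect M N).Elt, IsJBHom φ → φ ≠ 0 →
        ∃ α : ℕ, 1 ≤ α ∧ α * n ≤ min M N ∧ ClassA α 0 φ ∧ HasMultiplicity φ !![α; α]) ∧
      (∀ α : ℕ, 1 ≤ α → α * n ≤ min M N → Occurs (symp n) (rect M N) !![α; α])) ∧
    -- II to II
    (∀ n N : ℕ, (symp n).IsSource → (symp N).IsTarget →
      (∀ φ : (symp n).Elt →ₗ[ℂ] (symp N).Elt, IsJBHom φ → φ ≠ 0 →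
        ∃ α : ℕ, 1 ≤ α ∧ α * n ≤ N ∧ ClassA α 0 φ ∧ HasMultiplicity φ !![α]) ∧
      (∀ α : ℕ, 1 ≤ α → α * n ≤ N → Occurs (symp n) (symp N) !![α])) ∧
    -- II to III
    (∀ n N : ℕ, (symp n).IsSource → (herm N).IsTarget →
      (∀ φ : (symp n).Elt →ₗ[ℂ] (herm N).Elt, IsJBHom φ → φ ≠ 0 →
        ∃ α : ℕ, 1 ≤ α ∧ 2 * α * n ≤ N ∧ ClassB α 1 φ ∧ HasMultiplicity φ !![2 * α]) ∧
      (∀ α : ℕ, 1 ≤ α → 2 * α * n ≤ N → Occurs (symp n) (herm N) !![2 * α])) ∧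
    -- III to I
    (∀ n M N : ℕ, (herm n).IsSource → (rect M N).IsTarget →
      (∀ φ : (herm n).Elt →ₗ[ℂ] (rect M N).Elt, IsJBHom φ → φ ≠ 0 →
        ∃ α : ℕ, 1 ≤ α ∧ α * n ≤ min M N ∧ ClassA α 0 φ ∧ HasMultiplicity φ !![α; α]) ∧
      (∀ α : ℕ, 1 ≤ α → α * n ≤ min M N → Occurs (herm n) (rect M N) !![α; α])) ∧
    -- III to II
    (∀ n N : ℕ, (herm n).IsSource → (symp N).IsTarget →
      (∀ φ : (herm n).Elt →ₗ[ℂ] (symp N).Elt, IsJBHom φ → φ ≠ 0 →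
        ∃ α : ℕ, 1 ≤ α ∧ 2 * α * n ≤ N ∧ ClassB α (-1) φ ∧ HasMultiplicity φ !![2 * α]) ∧
      (∀ α : ℕ, 1 ≤ α → 2 * α * n ≤ N → Occurs (herm n) (symp N) !![2 * α])) ∧
    -- III to III
    (∀ n N : ℕ, (herm n).IsSource → (herm N).IsTarget →
      (∀ φ : (herm n).Elt →ₗ[ℂ] (herm N).Elt, IsJBHom φ → φ ≠ 0 →
        ∃ α : ℕ, 1 ≤ α ∧ α * n ≤ N ∧ ClassA α 0 φ ∧ HasMultiplicity φ !![α]) ∧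
      (∀ α : ℕ, 1 ≤ α → α * n ≤ N → Occurs (herm n) (herm N) !![α])) ∧
    -- Hilbert spaces: the non-zero morphisms are the isometric embeddings
    (∀ (H₁ : Type u) (H₂ : Type v) [NormedAddCommGroup H₁] [InnerProductSpace ℂ H₁]
      [CompleteSpace H₁] [NormedAddCommGroup H₂] [InnerProductSpace ℂ H₂] [CompleteSpace H₂]
      [Nontrivial H₁] (φ : H₁ →ₗ[ℂ] H₂),
      ((∀ x y z, φ (hilbertTriple x y z) = hilbertTriple (φ x) (φ y) (φ z)) ∧ φ ≠ 0) ↔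
        ∀ x, ‖φ x‖ = ‖x‖) ∧
    -- multiplicity one: in orthonormal bases a non-zero morphism is one copy, `x ↦ (x, 0)`
    (∀ (H₁ : Type u) (H₂ : Type v) [NormedAddCommGroup H₁] [InnerProductSpace ℂ H₁]
      [NormedAddCommGroup H₂] [InnerProductSpace ℂ H₂] [FiniteDimensional ℂ H₂]
      (φ : H₁ →ₗ[ℂ] H₂) (n : ℕ) (b : OrthonormalBasis (Fin n) ℂ H₁),
      (∀ x y z, φ (hilbertTriple x y z) = hilbertTriple (φ x) (φ y) (φ z)) → φ ≠ 0 →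
        ∃ (h : n ≤ Module.finrank ℂ H₂)
          (b' : OrthonormalBasis (Fin (Module.finrank ℂ H₂)) ℂ H₂),
          ∀ i, φ (b i) = b' (Fin.castLE h i)) ∧
    -- spin factors: the non-zero morphisms are the maps `μ U`
    (∀ (A : Type u) (B : Type v) [CStarAlgebra A] [Nontrivial A] [CStarAlgebra B] [Nontrivial B]
      (n m : ℕ) (s : Fin n → A) (t : Fin m → B) (hs : IsSpinSystem s) (ht : IsSpinSystem t),
      3 ≤ n → 2 ≤ m → ∀ φ : spinFactor s →ₗ[ℂ] spinFactor t,
      ((∀ x y z, φ (hs.tri x y z) = ht.tri (φ x) (φ y) (φ z)) ∧ φ ≠ 0) ↔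
        ∃ (U : spinFactor s →ₗ[ℂ] spinFactor t) (μ : ℂ), ‖μ‖ = 1 ∧
          (∀ x y, spinInner (U x : B) (U y : B) = spinInner (x : A) (y : A)) ∧
          (∀ x, U (hs.inv x) = ht.inv (U x)) ∧
          ∀ x, φ x = μ • U x) ∧
    -- multiplicity one: up to the phase, a non-zero morphism is one copy of the spin system
    (∀ (A : Type u) (B : Type v) [CStarAlgebra A] [Nontrivial A] [CStarAlgebra B] [Nontrivial B]
      (n m : ℕ) (s : Fin n → A) (t : Fin m → B) (hs : IsSpinSystem s) (ht : IsSpinSystem t),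
      3 ≤ n → 2 ≤ m → ∀ φ : spinFactor s →ₗ[ℂ] spinFactor t,
      (∀ x y z, φ (hs.tri x y z) = ht.tri (φ x) (φ y) (φ z)) → φ ≠ 0 →
        ∃ (h : n ≤ m) (μ : ℂ) (t' : Fin m → B), ‖μ‖ = 1 ∧ IsSpinSystem t' ∧
          spinFactor t' = spinFactor t ∧
          ∀ i, (φ ⟨s i, Submodule.subset_span ⟨i, rfl⟩⟩ : B) = μ • t' (Fin.castLE h i)) :=
  by
  refine ⟨fun Z hZ => isUniversalTRO hZ, fun Z W hZ _ φ hφ =>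
    ⟨existsUnique_lift hZ hφ, existsUnique_multiplicity hZ hφ⟩,
    fun m n M N hZ _ => morphism_rect_rect hZ, fun m n N hZ _ => morphism_rect_symp hZ,
    fun m n N hZ _ => morphism_rect_herm hZ, fun n M N hZ _ => morphism_symp_rect hZ,
    fun n N hZ _ => morphism_symp_symp hZ, fun n N hZ _ => morphism_symp_herm hZ,
    fun n M N hZ _ => morphism_herm_rect hZ, fun n N hZ _ => morphism_herm_symp hZ,
    fun n N hZ _ => morphism_herm_herm hZ, ?_, ?_, ?_, ?_⟩
  · intro H₁ H₂ _ _ _ _ _ _ _ φ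
    exact hilbert_morphism_iff
  · intro H₁ H₂ _ _ _ _ _ φ n b h h0
    exact exists_orthonormalBasis_of_hilbertTriple b h h0
  · intro A B _ _ _ _ n m s t hs ht hn _ φ
    exact spin_morphism_iff hs ht hn
  · intro A B _ _ _ _ n m s t hs ht hn _ φ h h0
    exact exists_spinSystem_extension hs ht hn h h0
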